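/- Let $\Bbbk$ be a field of characteristic $0$ and $n\ge 2$. For a central arrangement $\mathcal A$ of distinct hyperplanes in $\mathbb C^\ell$, let $E$ be the exterior algebra over $\Bbbk$ on generators $e_H$ ($H\in\mathcal A$), let $\partial$ be the antiderivation of $E$ with $\partial e_H=1$, and let $A=E/I$ be the Orlik–Solomon algebra, where $I$ is generated by the elements $\partial(e_{H_1}\cdots e_{H_m})$ with $\{H_1,\dots,H_m\}$ minimally dependent. The first resonance variety is $$\mathcal R^1(\mathcal A)=\{a\in A^1 \mid H^1(A,a)\neq 0\}\subset A^1=E^1=\Bbbk^{\mathcal A},$$ where $(A,a)$ is the complex $A^0\to A^1\to A^2\to\cdots$ given by right multiplication by $a$. For a partition $\Pi$ of a subarrangement $\mathcal A'\subseteq\mathcal A$, let $L_\Pi\subseteq\Bbbk^{\mathcal A}$ be the subspace of all $u=\sum u_He_H$ such that $\sum_H u_H=0$, $u_H=0$ for $H\notin\mathcal A'$, and $\sum_{H\supset X}u_H=0$ for every rank two flat $X$ of $\mathcal A'$ for which the hyperplanes of $\mathcal A'$ containing $X$ do not all lie in one block of $\Pi$. Write $H_i=\ker(x_i)$ and $H_{i,j}^{\pm}=\ker(x_i\pm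 x_j)$ for $i<j$. Let $\mathcal B_n=\{H_i\}_{1\le i\le n}\cup\{H_{i,j}^\pm\}_{1\le i<j\le n}$ and $\mathcal D_n=\{H_{i,j}^\pm\}_{1\le i<j\le n}$ be the Coxeter arrangements of types B and D in $\mathbb C^n$, and regard $\mathcal R^1(\mathcal D_n)$ as a subset of $\Bbbk^{\mathcal B_n}=\Bbbk^{n^2}$ via extension by zero. Define the following subspaces $L_\Pi$ of $\Bbbk^{\mathcal B_n}$: * for $i<j$, $L_{i,j}=L_\Pi$ with $\Pi=(H_i\mid H_j\mid H_{i,j}^-\mid H_{i,j}^+)$; * for $i<j<k$, $Z_{i,j,k}=L_\Pi$ with $\Pi=(H_i,H_{j,k}^-,H_{j,k}^+\mid H_j,H_{i,k}^-,H_{i,k}^+\mid H_k,H_{i,j}^-,H_{i,j}^+)$; * for $i<j<k$ and $1\le q\le 10$, $Y^q_{i,j,k}=L_{\Pi_q}$, where $$\begin{aligned} \Pi_1&=(H_i,H_{j,k}^-\mid H_j,H_{i,k}^-\mid H_k,H_{i,j}^-), & \Pi_2&=(H_i,H_{j,k}^+\mid H_j,H_{i,k}^+\mid H_k,H_{i,j}^-),\\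 \Pi_3&=(H_i,H_{j,k}^+\mid H_j,H_{i,k}^-\mid H_k,H_{i,j}^+), & \Pi_4&=(H_i,H_{j,k}^-\mid H_j,H_{i,k}^+\mid H_k,H_{i,j}^+),\\ \Pi_5&=(H_i,H_{j,k}^-\mid H_{i,j}^-,H_{i,k}^+\mid H_{i,j}^+,H_{i,k}^-), & \Pi_6&=(H_i,H_{j,k}^+\mid H_{i,j}^-,H_{i,k}^-\mid H_{i,j}^+,H_{i,k}^+),\\ \Pi_7&=(H_j,H_{i,k}^-\mid H_{i,j}^-,H_{j,k}^+\mid H_{i,j}^+,H_{j,k}^-), & \Pi_8&=(H_j,H_{i,k}^+\mid H_{i,j}^-,H_{j,k}^-\mid H_{i,j}^+,H_{j,k}^+),\\ \Pi_9&=(H_k,H_{i,j}^-\mid H_{i,k}^-,H_{j,k}^+\mid H_{i,k}^+,H_{j,k}^-), & \Pi_{10}&=(H_k,H_{i,j}^+\mid H_{i,k}^-,H_{j,k}^-\mid H_{i,k}^+,H_{j,k}^+). \end{aligned}$$ Then $$\mathcal R^1(\mathcal B_n)=\mathcal R^1(\mathcal D_n)\cup\bigcup_{i<j}L_{i,j}\cup\bigcup_{i<j<k}\Bigl(Z_{i,j,k}\cup\bigcup_{q=1}^{10}Y^q_{i,j,k}\Bigr).$$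 Each $L_{i,j}$ is a three-dimensional, and each $Z_{i,j,k}$ and $Y^q_{i,j,k}$ a two-dimensional, irreducible component of $\mathcal R^1(\mathcal B_n)$ in the Zariski topology of $\Bbbk^{n^2}$. Moreover, $\mathcal R^1(\mathcal B_n)$ is the union of its irreducible components; these are all linear subspaces, exactly $16\binom n3+9\binom n4$ of them have dimension two, exactly $\binom n2$ have dimension three, and there are no others. -/

import Mathlib

noncomputable section

/-! ### Resonance varieties of a graded algebra -/

/-- Degree `p` cocycles of the complex `(A, a)`, whose differential is right multiplication by `a`;
`gr p` is the degree `p` piece of `A`. -/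
def aomotoCocycles {k A : Type*} [Field k] [Ring A] [Algebra k A]
    (gr : ℕ → Submodule k A) (a : A) (p : ℕ) : Submodule k A :=
  gr p ⊓ LinearMap.ker (LinearMap.mulRight k a)

/-- Degree `p` coboundaries of the complex `(A, a)`. -/
def aomotoCoboundaries {k A : Type*} [Field k] [Ring A] [Algebra k A]
    (gr : ℕ → Submodule k A) (a : A) : ℕ → Submodule k A
  | 0 => ⊥
  | p + 1 => (gr p).map (LinearMap.mulRight k a)

/-- The cohomology `H^p(A, a)`. -/
abbrev AomotoCohomology {k A : Type*} [Field k] [Ring A] [Algebra k A]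
    (gr : ℕ → Submodule k A) (a : A) (p : ℕ) : Type _ :=
  aomotoCocycles gr a p ⧸ (aomotoCoboundaries gr a p).submoduleOf (aomotoCocycles gr a p)

/-- The first resonance variety `{a ∈ A^1 | H^1(A, a) ≠ 0}`. -/
def firstResonance {k A : Type*} [Field k] [Ring A] [Algebra k A]
    (gr : ℕ → Submodule k A) : Set A :=
  {a | a ∈ gr 1 ∧ Nontrivial (AomotoCohomology gr a 1)}

/-! ### Orlik-Solomon algebras

A central arrangement in a complex vector space `V` is given by pairwise non-proportional nonzero
linear forms `α i`; its hyperplanes are the kernels `ker (α i)`. -/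

/-- The list `l` enumerates, without repetition, a minimally dependent set of hyperplanes. -/
def IsArrCircuit {V ι : Type*} [AddCommGroup V] [Module ℂ V]
    (α : ι → Module.Dual ℂ V) (l : List ι) : Prop :=
  l.Nodup ∧ ¬ LinearIndepOn ℂ α {i | i ∈ l} ∧
    ∀ T : Set ι, T ⊂ {i | i ∈ l} → LinearIndepOn ℂ α T

/-- The antiderivation `∂` of the exterior algebra on generators `e_i` with `∂ e_i = 1`:
contraction with the linear form that sends every `e_i` to `1`. -/
def osBoundary (k : Type*) [Field k] {ι : Type*} [Fintype ι] :
    ExteriorAlgebra k (ι → k) →ₗ[k] ExteriorAlgebra k (ι → k) :=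
  CliffordAlgebra.contractLeft (Q := (0 : QuadraticForm k (ι → k)))
    (∑ i, (LinearMap.proj i : (ι → k) →ₗ[k] k))

/-- The Orlik-Solomon ideal, generated by the boundaries of the products `e_{i_1} ⋯ e_{i_m}` over
the minimally dependent sets of hyperplanes. -/
def osIdeal (k : Type*) [Field k] {V ι : Type*} [AddCommGroup V] [Module ℂ V]
    [Fintype ι] [DecidableEq ι] (α : ι → Module.Dual ℂ V) :
    TwoSidedIdeal (ExteriorAlgebra k (ι → k)) :=
  TwoSidedIdeal.span
    {x | ∃ l : List ι, IsArrCircuit α l ∧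
      x = osBoundary k (l.map fun i => ExteriorAlgebra.ι k (Pi.single i (1 : k))).prod}

/-- The Orlik-Solomon algebra with coefficients in `k`. -/
abbrev OSAlgebra (k : Type*) [Field k] {V ι : Type*} [AddCommGroup V] [Module ℂ V]
    [Fintype ι] [DecidableEq ι] (α : ι → Module.Dual ℂ V) : Type _ :=
  (osIdeal k α).ringCon.Quotient

/-- The projection from the exterior algebra to the Orlik-Solomon algebra. -/
def osMk (k : Type*) [Field k] {V ι : Type*} [AddCommGroup V] [Module ℂ V]
    [Fintype ι] [DecidableEq ι] (α : ι → Module.Dual ℂ V) :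
    ExteriorAlgebra k (ι → k) →ₐ[k] OSAlgebra k α :=
  RingCon.mkₐ k (osIdeal k α).ringCon

/-- The grading of the Orlik-Solomon algebra, induced from the exterior algebra. -/
def osGrading (k : Type*) [Field k] {V ι : Type*} [AddCommGroup V] [Module ℂ V]
    [Fintype ι] [DecidableEq ι] (α : ι → Module.Dual ℂ V) (p : ℕ) :
    Submodule k (OSAlgebra k α) :=
  (⋀[k]^p (ι → k)).map (osMk k α).toLinearMap

/-- The first resonance variety of an arrangement, in the coordinates `u ↦ ∑ u_i e_i` on the degree
one part of the Orlik-Solomon algebra. -/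
def arrResonance (k : Type*) [Field k] {V ι : Type*} [AddCommGroup V] [Module ℂ V]
    [Fintype ι] [DecidableEq ι] (α : ι → Module.Dual ℂ V) : Set (ι → k) :=
  {u | osMk k α (ExteriorAlgebra.ι k u) ∈ firstResonance (osGrading k α)}

/-! ### Components from partitions of subarrangements -/

/-- `X` is a rank two flat of the subarrangement `S`. -/
def IsRankTwoFlat {V ι : Type*} [AddCommGroup V] [Module ℂ V]
    (α : ι → Module.Dual ℂ V) (S : Set ι) (X : Submodule ℂ V) : Prop :=
  (∃ B ⊆ S, X = ⨅ i ∈ B, LinearMap.ker (α i)) ∧ Module.finrank ℂ (V ⧸ X) = 2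

/-- `X` is polychrome for the partition `P` of the subarrangement `⋃₀ P`: the hyperplanes of the
subarrangement that contain `X` do not all lie in one block. -/
def IsPolychrome {V ι : Type*} [AddCommGroup V] [Module ℂ V]
    (α : ι → Module.Dual ℂ V) (P : Set (Set ι)) (X : Submodule ℂ V) : Prop :=
  ¬ ∃ b ∈ P, ∀ i ∈ ⋃₀ P, X ≤ LinearMap.ker (α i) → i ∈ b

open Classical in
/-- The subspace `L_P` of a partition `P` (a set of blocks) of the subarrangement `⋃₀ P`: the
vectors `u` with coordinate sum zero, with `∑_{X ⊆ H_i} u_i = 0` for every polychrome rank two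
flat `X` of the subarrangement, and supported on the subarrangement. -/
def partitionComponent (k : Type*) [Field k] {V ι : Type*} [AddCommGroup V] [Module ℂ V]
    [Fintype ι] (α : ι → Module.Dual ℂ V) (P : Set (Set ι)) : Submodule k (ι → k) where
  carrier := {u | ∑ i, u i = 0 ∧
    (∀ X : Submodule ℂ V, IsRankTwoFlat α (⋃₀ P) X → IsPolychrome α P X →
      ∑ i with X ≤ LinearMap.ker (α i), u i = 0) ∧
    ∀ i ∉ ⋃₀ P, u i = 0}
  add_mem' := by
    rintro u v ⟨hu, hu', hu''⟩ ⟨hv, hv', hv''⟩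
    refine ⟨?_, fun X h1 h2 => ?_, fun i hi => ?_⟩
    · simp [Finset.sum_add_distrib, hu, hv]
    · simp [Finset.sum_add_distrib, hu' X h1 h2, hv' X h1 h2]
    · simp [hu'' i hi, hv'' i hi]
  zero_mem' := by simp
  smul_mem' := by
    rintro c u ⟨hu, hu', hu''⟩
    refine ⟨?_, fun X h1 h2 => ?_, fun i hi => ?_⟩
    · simp [← Finset.mul_sum, hu]
    · simp [← Finset.mul_sum, hu' X h1 h2]
    · simp [hu'' i hi]

/-! ### Irreducible components -/

/-- The Zariski topology on the affine space `k^σ`, with the sets `{p ≠ 0}` as basic opens. -/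
@[reducible] def zariskiTopology (σ k : Type*) [Field k] : TopologicalSpace (σ → k) :=
  TopologicalSpace.generateFrom
    {U | ∃ p : MvPolynomial σ k, U = {x | MvPolynomial.eval x p ≠ 0}}

/-- `C` is an irreducible component of `R ⊆ k^σ` in the Zariski topology. -/
def IsZariskiComponent {σ k : Type*} [Field k] (R C : Set (σ → k)) : Prop :=
  Maximal (fun T : Set (σ → k) => T ⊆ R ∧ @IsIrreducible _ (zariskiTopology σ k) T) C

/-! ### The Coxeter arrangements of types D and B -/

/-- Hyperplanes `ker (x_i + ε x_j)`, for `i < j` and `ε = ±1`. -/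
abbrev DIdx (n : ℕ) : Type := {p : Fin n × Fin n // p.1 < p.2} × ℤˣ

/-- Hyperplanes `ker x_i`, together with those of type D. -/
abbrev BIdx (n : ℕ) : Type := Fin n ⊕ DIdx n

/-- The type D Coxeter arrangement. -/
def arrD (n : ℕ) : DIdx n → Module.Dual ℂ (Fin n → ℂ) := fun h =>
  LinearMap.proj h.1.1.1 + ((h.2 : ℤ) : ℂ) • LinearMap.proj h.1.1.2

/-- The type B Coxeter arrangement. -/
def arrB (n : ℕ) : BIdx n → Module.Dual ℂ (Fin n → ℂ) :=
  Sum.elim (fun i => LinearMap.proj i) (arrD n)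

/-- The hyperplane `H_i = ker x_i`. -/
abbrev hC {n : ℕ} (i : Fin n) : BIdx n := Sum.inl i

/-- The hyperplane `H_{i,j}^- = ker (x_i - x_j)`. -/
abbrev hM {n : ℕ} {i j : Fin n} (h : i < j) : BIdx n := Sum.inr (⟨(i, j), h⟩, -1)

/-- The hyperplane `H_{i,j}^+ = ker (x_i + x_j)`. -/
abbrev hP {n : ℕ} {i j : Fin n} (h : i < j) : BIdx n := Sum.inr (⟨(i, j), h⟩, 1)

/-- Extension by zero of coefficient vectors from the type D to the type B arrangement. -/
def extendDB {k : Type*} [Field k] {n : ℕ} (u : DIdx n → k) : BIdx n → k :=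
  Sum.elim (fun _ => 0) u

/-- The component of the rank two flat `H_i ∩ H_j ∩ H_{i,j}^- ∩ H_{i,j}^+`. -/
def compL (k : Type*) [Field k] {n : ℕ} {i j : Fin n} (h : i < j) : Submodule k (BIdx n → k) :=
  partitionComponent k (arrB n) {{hC i}, {hC j}, {hM h}, {hP h}}

/-- The component of the `B_3` subarrangement on the indices `i < j < l`. -/
def compZ (k : Type*) [Field k] {n : ℕ} {i j l : Fin n} (hij : i < j) (hjl : j < l) :
    Submodule k (BIdx n → k) :=
  partitionComponent k (arrB n)
    {{hC i, hM hjl, hP hjl}, {hC j, hM (hij.trans hjl), hP (hij.trans hjl)},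
      {hC l, hM hij, hP hij}}

/-- The neighborly partitions of the ten braid subarrangements of the `B_3` subarrangement
on the indices `i < j < l` that contain a coordinate hyperplane. -/
def partY {n : ℕ} {i j l : Fin n} (hij : i < j) (hjl : j < l) : Fin 10 → Set (Set (BIdx n)) :=
  have hil : i < l := hij.trans hjl
  ![{{hC i, hM hjl}, {hC j, hM hil}, {hC l, hM hij}},
    {{hC i, hP hjl}, {hC j, hP hil}, {hC l, hM hij}},
    {{hC i, hP hjl}, {hC j, hM hil}, {hC l, hP hij}},
    {{hC i, hM hjl}, {hC j, hP hil}, {hC l, hP hij}},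
    {{hC i, hM hjl}, {hM hij, hP hil}, {hP hij, hM hil}},
    {{hC i, hP hjl}, {hM hij, hM hil}, {hP hij, hP hil}},
    {{hC j, hM hil}, {hM hij, hP hjl}, {hP hij, hM hjl}},
    {{hC j, hP hil}, {hM hij, hM hjl}, {hP hij, hP hjl}},
    {{hC l, hM hij}, {hM hil, hP hjl}, {hP hil, hM hjl}},
    {{hC l, hP hij}, {hM hil, hM hjl}, {hP hil, hP hjl}}]

/-- The components of these ten braid subarrangements. -/
def compY (k : Type*) [Field k] {n : ℕ} {i j l : Fin n} (hij : i < j) (hjl : j < l)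
    (q : Fin 10) : Submodule k (BIdx n → k) :=
  partitionComponent k (arrB n) (partY hij hjl q)

end

/-!
The resonance variety of a simple arrangement is governed by local conditions. A degree one element
`u` of the Orlik–Solomon algebra is resonant exactly when there is `b` outside the line `k u` such
that `b u = 0`; since the degree two part of the algebra splits along the rank two flats, this says
that on every rank two flat `F` the vectors `(u_h, b_h)` of the plane `k²`, for `h ∈ F`, are all
parallel to their sum (`mem_arrResonance_iff`). In other words, on every flat these vectors either
have sum zero or are pairwise parallel.

For type B the flats are the planes `x_i = x_j = 0` with four hyperplanes, the balanced triangles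
with three hyperplanes, and the generic pairs, so the condition becomes the finite list
`IsBParallel`. If the values of `v = (u, b)` are not all parallel, these conditions force `v` to be
supported on two, three or four coordinates (`exists_supportedOn_of_coord`,
`exists_supportedOn_of_coord_parallel`, `exists_supportedOn_of_coord_zero`, according to the values
on the coordinate hyperplanes). On two coordinates only the sum of the values is constrained, which
gives the subspaces `L_{i,j}`. On three and four coordinates the values are determined up to a
linear map of the plane by a partition into three blocks with values proportional to `x`, `y` and
`-(x + y)`; the possible partitions are listed in `coordBlocks`, `edgeBlocks` and `quadBlocks`. Each
of them gives the two-dimensional row space of an integer pencil (`rowSpace`), and for the eleven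
partitions that involve coordinate hyperplanes this row space is the subspace defined by the
partition (`partitionComponent_tripleParts`).

Hence the resonance variety is a finite union of linear subspaces (`arrResonance_arrB_eq_iUnion`).
The dimension, the coordinates that a subspace touches and its support distinguish them and show
that none contains another (`component_antichain`). Over an infinite field linear subspaces are
closed and irreducible in the Zariski topology, so these subspaces are the irreducible components
(`isZariskiComponent_iff_of_antichain`), and counting the indices gives the numbers: `11 + 5`
partitions on each triple and `1 + 8` on each quadruple of coordinates.
-/

/-! ### Zariski components of finite unions of linear subspaces -/

lemma isOpen_zariski_basic {σ k : Type*} [Field k] (p : MvPolynomial σ k) :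
    @IsOpen _ (zariskiTopology σ k) {x | MvPolynomial.eval x p ≠ 0} :=
  TopologicalSpace.isOpen_generateFrom_of_mem ⟨p, rfl⟩

lemma exists_basic_of_isOpen_zariski {σ k : Type*} [Field k] {U : Set (σ → k)}
    (hU : @IsOpen _ (zariskiTopology σ k) U) {x : σ → k} (hx : x ∈ U) :
    ∃ p : MvPolynomial σ k, MvPolynomial.eval x p ≠ 0 ∧
      {y | MvPolynomial.eval y p ≠ 0} ⊆ U := by
  induction hU generalizing x with
  | basic s hs =>
    obtain ⟨p, rfl⟩ := hs
    exact ⟨p, hx, subset_rfl⟩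
  | univ => exact ⟨1, by simp, Set.subset_univ _⟩
  | inter s t _ _ ihs iht =>
    obtain ⟨p, hp, hps⟩ := ihs hx.1
    obtain ⟨q, hq, hqt⟩ := iht hx.2
    refine ⟨p * q, by simp [hp, hq], fun y hy => ?_⟩
    simp only [map_mul, ne_eq, mul_eq_zero, not_or, Set.mem_ofPred_eq] at hy
    exact ⟨hps hy.1, hqt hy.2⟩
  | sUnion S _ ih =>
    obtain ⟨s, hs, hxs⟩ := hx
    obtain ⟨p, hp, hps⟩ := ih s hs hxs
    exact ⟨p, hp, hps.trans (Set.subset_sUnion_of_mem hs)⟩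

/-- A linear subspace over an infinite field is irreducible: two basic open sets that meet it at
`x` and `y` have a common point on the line through `x` and `y`. -/
lemma isIrreducible_zariski_submodule {σ k : Type*} [Field k] [Infinite k]
    (W : Submodule k (σ → k)) :
    @IsIrreducible _ (zariskiTopology σ k) (W : Set (σ → k)) := by
  let := zariskiTopology σ k
  refine ⟨⟨0, W.zero_mem⟩, fun U V hU hV => ?_⟩
  rintro ⟨x, hxW, hxU⟩ ⟨y, hyW, hyV⟩
  obtain ⟨p, hp, hpU⟩ := exists_basic_of_isOpen_zariski hU hxU
  obtain ⟨q, hq, hqV⟩ := exists_basic_of_isOpen_zariski hV hyV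
  let L : MvPolynomial σ k →ₐ[k] Polynomial k :=
    MvPolynomial.aeval fun i => Polynomial.C (x i) + Polynomial.X * Polynomial.C (y i - x i)
  have hL : ∀ (t : k) (r : MvPolynomial σ k),
      (L r).eval t = MvPolynomial.eval (x + t • (y - x)) r := by
    intro t r
    induction r using MvPolynomial.induction_on with
    | C a => simp [L]
    | add r s hr hs => simp [hr, hs]
    | mul_X r i hr => rw [map_mul, Polynomial.eval_mul, hr]; simp [L]
  have hp' : L p ≠ 0 := by
    intro h0
    have := hL 0 p
    simp [h0] at this
    exact hp this.symm
  have hq' : L q ≠ 0 := by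
    intro h0
    have := hL 1 q
    simp [h0] at this
    exact hq this.symm
  obtain ⟨t, ht⟩ : ∃ t, (L p * L q).eval t ≠ 0 := by
    by_contra! hcon
    exact mul_ne_zero hp' hq' (Polynomial.funext (by simpa using hcon))
  rw [Polynomial.eval_mul, hL, hL] at ht
  exact ⟨x + t • (y - x), W.add_mem hxW (W.smul_mem _ (W.sub_mem hyW hxW)),
    hpU (left_ne_zero_of_mul ht), hqV (right_ne_zero_of_mul ht)⟩

lemma isClosed_zariski_submodule {σ k : Type*} [Field k] [Fintype σ] (W : Submodule k (σ → k)) :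
    @IsClosed _ (zariskiTopology σ k) (W : Set (σ → k)) := by
  classical
  let := zariskiTopology σ k
  rw [← isOpen_compl_iff, isOpen_iff_forall_mem_open]
  intro x hx
  obtain ⟨ℓ, hℓx, hℓW⟩ := Submodule.exists_le_ker_of_notMem (show x ∉ W from hx)
  refine ⟨_, ?_, isOpen_zariski_basic (∑ i, MvPolynomial.C (ℓ fun j => if i = j then 1 else 0) *
    MvPolynomial.X i), ?_⟩
  · intro y hy hyW
    apply hy
    have h0 : ℓ y = 0 := hℓW hyW
    rw [LinearMap.pi_apply_eq_sum_univ ℓ y] at h0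
    simpa [mul_comm] using h0
  · have h1 := hℓx
    rw [LinearMap.pi_apply_eq_sum_univ ℓ x] at h1
    simpa [mul_comm] using h1

/-- The irreducible components of a finite union of pairwise incomparable linear subspaces are
these subspaces. -/
lemma isZariskiComponent_iff_of_antichain {σ k κ : Type*} [Field k] [Infinite k] [Fintype σ]
    [Finite κ] {R : Set (σ → k)} (W : κ → Submodule k (σ → k))
    (hR : R = ⋃ i, (W i : Set (σ → k))) (hW : ∀ i j, W i ≤ W j → i = j) (C : Set (σ → k)) :
    IsZariskiComponent R C ↔ ∃ i, C = W i := by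
  let := zariskiTopology σ k
  have key : ∀ T : Set (σ → k), T ⊆ R → IsIrreducible T → ∃ i, T ⊆ W i := by
    intro T hT hirr
    obtain ⟨s, hs, hTs⟩ := isIrreducible_iff_sUnion_isClosed.1 hirr
      (Set.finite_range fun i => (W i : Set (σ → k))).toFinset
      (by
        intro z hz
        simp only [Set.Finite.mem_toFinset, Set.mem_range] at hz
        obtain ⟨i, rfl⟩ := hz
        exact isClosed_zariski_submodule (W i))
      (by
        simpa [Set.sUnion_range, hR] using hT)
    simp only [Set.Finite.mem_toFinset, Set.mem_range] at hs
    obtain ⟨i, rfl⟩ := hs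
    exact ⟨i, hTs⟩
  have hsub : ∀ i, (W i : Set (σ → k)) ⊆ R := fun i =>
    hR ▸ Set.subset_iUnion (fun i => (W i : Set (σ → k))) i
  constructor
  · intro h
    obtain ⟨i, hi⟩ := key C h.prop.1 h.prop.2
    exact ⟨i, h.eq_of_le ⟨hsub i, isIrreducible_zariski_submodule _⟩ hi⟩
  · rintro ⟨i, rfl⟩
    refine ⟨⟨hsub i, isIrreducible_zariski_submodule _⟩, fun T hT hle => ?_⟩
    obtain ⟨j, hj⟩ := key T hT.1 hT.2
    obtain rfl := hW i j (SetLike.coe_subset_coe.1 (hle.trans hj))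
    exact hj

/-! ### Resonance as a condition on rank two flats -/

/-- The linear forms `α i` are nonzero and pairwise non-proportional. -/
def IsSimpleArr {V ι : Type*} [AddCommGroup V] [Module ℂ V] (α : ι → Module.Dual ℂ V) : Prop :=
  (∀ p, α p ≠ 0) ∧ ∀ p q, p ≠ q → LinearIndependent ℂ ![α p, α q]

open Classical in
/-- The hyperplanes that contain `ker (α p) ∩ ker (α q)`. -/
noncomputable def flatClosure {V ι : Type*} [AddCommGroup V] [Module ℂ V] [Fintype ι]
    (α : ι → Module.Dual ℂ V) (p q : ι) : Finset ι :=
  {h | α h ∈ Submodule.span ℂ {α p, α q}}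

/-- On every rank two flat `F`, either the pairs `(u h, b h)` with `h ∈ F` have sum zero, or they
are all proportional to this sum. -/
def IsLocallyParallel {k V ι : Type*} [Field k] [AddCommGroup V] [Module ℂ V] [Fintype ι]
    (α : ι → Module.Dual ℂ V) (u b : ι → k) : Prop :=
  ∀ p q, p ≠ q → ∀ h ∈ flatClosure α p q,
    b h * ∑ i ∈ flatClosure α p q, u i = u h * ∑ i ∈ flatClosure α p q, b i

section Closure

variable {V ι : Type*} [AddCommGroup V] [Module ℂ V] {α : ι → Module.Dual ℂ V}

lemma finrank_span_pair (hα : IsSimpleArr α) {p q : ι} (hpq : p ≠ q) :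
    Module.finrank ℂ (Submodule.span ℂ {α p, α q}) = 2 := by
  have := finrank_span_eq_card (hα.2 p q hpq)
  rwa [Matrix.range_cons_cons_empty, Fintype.card_fin] at this

variable [Fintype ι]

lemma mem_flatClosure {p q h : ι} :
    h ∈ flatClosure α p q ↔ α h ∈ Submodule.span ℂ {α p, α q} := by
  simp [flatClosure]

lemma left_mem_flatClosure (p q : ι) : p ∈ flatClosure α p q :=
  mem_flatClosure.2 (Submodule.subset_span (by simp))

lemma right_mem_flatClosure (p q : ι) : q ∈ flatClosure α p q :=
  mem_flatClosure.2 (Submodule.subset_span (by simp))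

/-- A rank two flat is determined by any two of its hyperplanes. -/
lemma flatClosure_eq_of_mem (hα : IsSimpleArr α) {p q r s : ι} (hrs : r ≠ s)
    (hr : r ∈ flatClosure α p q) (hs : s ∈ flatClosure α p q) :
    flatClosure α r s = flatClosure α p q := by
  rw [mem_flatClosure] at hr hs
  have hle : Submodule.span ℂ {α r, α s} ≤ Submodule.span ℂ {α p, α q} := by
    rw [Submodule.span_le]
    rintro x (rfl | rfl) <;> assumption
  have h2 := finrank_span_pair hα hrs
  have h1 : Module.finrank ℂ (Submodule.span ℂ {α p, α q}) ≤ 2 := by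
    classical
    refine (finrank_span_le_card ({α p, α q} : Set _)).trans ?_
    rw [Set.toFinset_insert, Set.toFinset_singleton]
    exact Finset.card_le_two
  have : FiniteDimensional ℂ (Submodule.span ℂ {α p, α q}) :=
    FiniteDimensional.span_of_finite ℂ (by simp)
  have heq := Submodule.eq_of_le_of_finrank_le hle (h1.trans h2.ge)
  ext h
  rw [mem_flatClosure, mem_flatClosure, heq]

end Closure

section Circuits

variable {V ι : Type*} [AddCommGroup V] [Module ℂ V] {α : ι → Module.Dual ℂ V}

lemma IsSimpleArr.linearIndepOn_pair (hα : IsSimpleArr α) (p q : ι) :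
    LinearIndepOn ℂ α {p, q} := by
  by_cases hpq : p = q
  · subst hpq
    simpa using hα.1 p
  · rw [LinearIndepOn.pair_iff _ hpq]
    exact LinearIndependent.pair_iff.1 (hα.2 p q hpq)

lemma IsArrCircuit.exists_eq_cons (hα : IsSimpleArr α) {l : List ι} (hl : IsArrCircuit α l) :
    ∃ a b c l', l = a :: b :: c :: l' := by
  match l, hl with
  | [], hl => exact absurd (by simp) hl.2.1
  | [a], hl => exact absurd (by simpa using hα.linearIndepOn_pair a a) hl.2.1
  | [a, b], hl =>
    refine absurd ((hα.linearIndepOn_pair a b).mono fun x hx => ?_) hl.2.1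
    simpa using hx
  | a :: b :: c :: l', _ => exact ⟨a, b, c, l', rfl⟩

lemma mem_span_of_not_linearIndepOn_triple (hα : IsSimpleArr α) {a b c : ι}
    (h : ¬ LinearIndepOn ℂ α {c, a, b}) : α c ∈ Submodule.span ℂ {α a, α b} := by
  by_contra hc
  apply h
  have := (hα.linearIndepOn_pair a b).insert (x := c) (by simpa [Set.image_pair] using hc)
  exact this

lemma isArrCircuit_triple (hα : IsSimpleArr α) {a b c : ι} (hab : a ≠ b) (hac : a ≠ c)
    (hbc : b ≠ c) (h : α c ∈ Submodule.span ℂ {α a, α b}) : IsArrCircuit α [a, b, c] := by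
  refine ⟨by simp [hab, hac, hbc], fun hind => ?_, fun T hT => ?_⟩
  · have hs : {i | i ∈ [a, b, c]} = insert c {a, b} := by ext; simp; tauto
    rw [hs] at hind
    have := hind.notMem_span_of_insert (by simp [hac.symm, hbc.symm])
    rw [Set.image_pair] at this
    exact this h
  · obtain ⟨hT1, hT2⟩ := Set.ssubset_iff_subset_ne.1 hT
    obtain ⟨x, hx, hxT⟩ := Set.exists_of_ssubset hT
    have hsub : ∀ y ∈ T, y = a ∨ y = b ∨ y = c := fun y hy => by simpa using hT1 hy
    have hne : ∀ y ∈ T, y ≠ x := fun y hy e => hxT (e ▸ hy)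
    have hx' : x = a ∨ x = b ∨ x = c := by simpa using hx
    rcases hx' with rfl | rfl | rfl
    · exact (hα.linearIndepOn_pair b c).mono fun y hy => by
        have := hsub y hy; have := hne y hy; simp; tauto
    · exact (hα.linearIndepOn_pair a c).mono fun y hy => by
        have := hsub y hy; have := hne y hy; simp; tauto
    · exact (hα.linearIndepOn_pair a b).mono fun y hy => by
        have := hsub y hy; have := hne y hy; simp; tauto

end Circuits

section OrlikSolomon

variable {k : Type*} [Field k] {ι : Type*}

/-- The generator `e_i` of the exterior algebra. -/
abbrev extGen (k : Type*) [Field k] {ι : Type*} [DecidableEq ι] (i : ι) :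
    ExteriorAlgebra k (ι → k) :=
  ExteriorAlgebra.ι k (Pi.single i (1 : k))

lemma osBoundary_ι_mul [Fintype ι] (x : ι → k) (y : ExteriorAlgebra k (ι → k)) :
    osBoundary k (ExteriorAlgebra.ι k x * y) =
      (∑ i, x i) • y - ExteriorAlgebra.ι k x * osBoundary k y := by
  have := CliffordAlgebra.contractLeft_ι_mul (Q := (0 : QuadraticForm k (ι → k)))
    (d := ∑ i, (LinearMap.proj i : (ι → k) →ₗ[k] k)) x y
  simpa [osBoundary] using this

/-- Since `e_a` squares to zero, multiples of `e_a` may be added to the other factors. -/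
lemma extGen_mul_prod [DecidableEq ι] (a : ι) (l : List ι) :
    extGen k a * (l.map fun b => extGen k b).prod =
      extGen k a * (l.map fun b => extGen k b - extGen k a).prod := by
  induction l with
  | nil => simp
  | cons b l ih =>
    have hsw : ∀ z, extGen k a * (extGen k b * z) = -(extGen k b * (extGen k a * z)) := by
      intro z
      rw [← mul_assoc, ← mul_assoc, ← neg_mul,
        eq_neg_of_add_eq_zero_left (ExteriorAlgebra.ι_add_mul_swap _ _)]
    rw [List.map_cons, List.prod_cons, hsw, ih, ← hsw, List.map_cons, List.prod_cons, sub_mul,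
      mul_sub, ← mul_assoc (extGen k a) (extGen k a), ExteriorAlgebra.ι_sq_zero, zero_mul, sub_zero]

variable [Fintype ι] [DecidableEq ι]

lemma osBoundary_prod_sub (a : ι) (l : List ι) :
    osBoundary k (l.map fun b => extGen k b - extGen k a).prod =
      if l = [] then osBoundary k 1 else 0 := by
  induction l with
  | nil => simp
  | cons b l ih =>
    rw [List.map_cons, List.prod_cons, ← map_sub, osBoundary_ι_mul, ih]
    rcases l with _ | ⟨c, l⟩ <;> simp [osBoundary, Finset.sum_sub_distrib]

/-- The generators of the Orlik-Solomon ideal are products of differences of generators. -/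
lemma osBoundary_cons (a : ι) (l : List ι) :
    osBoundary k ((a :: l).map fun b => extGen k b).prod =
      (l.map fun b => extGen k b - extGen k a).prod := by
  rw [List.map_cons, List.prod_cons, extGen_mul_prod, osBoundary_ι_mul, osBoundary_prod_sub]
  have h1 : osBoundary k (1 : ExteriorAlgebra k (ι → k)) = 0 := by
    simp [osBoundary]
  simp [h1]

variable {V : Type*} [AddCommGroup V] [Module ℂ V] {α : ι → Module.Dual ℂ V}

lemma osMk_eq_zero_iff {x : ExteriorAlgebra k (ι → k)} : osMk k α x = 0 ↔ x ∈ osIdeal k α := by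
  rw [TwoSidedIdeal.mem_iff, ← RingCon.eq]
  rfl

/-- A homomorphism that kills the products of differences over all circuits kills the Orlik–Solomon
ideal; circuits of a simple arrangement have at least three members. -/
lemma map_eq_zero_of_mem_osIdeal {A : Type*} [Ring A] [Algebra k A] (hα : IsSimpleArr α)
    (φ : ExteriorAlgebra k (ι → k) →ₐ[k] A)
    (hφ : ∀ a b c l, IsArrCircuit α (a :: b :: c :: l) →
      ((b :: c :: l).map fun i => φ (extGen k i) - φ (extGen k a)).prod = 0)
    {x : ExteriorAlgebra k (ι → k)} (hx : x ∈ osIdeal k α) : φ x = 0 := by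
  have hle : osIdeal k α ≤ TwoSidedIdeal.ker φ := by
    refine TwoSidedIdeal.span_le.2 ?_
    rintro _ ⟨l, hl, rfl⟩
    obtain ⟨a, b, c, l', rfl⟩ := hl.exists_eq_cons hα
    rw [SetLike.mem_coe, TwoSidedIdeal.mem_ker, osBoundary_cons, map_list_prod, List.map_map,
      ← hφ a b c l' hl]
    simp [Function.comp_def]
  exact (TwoSidedIdeal.mem_ker φ).1 (hle hx)

lemma osMk_ι_injective (hα : IsSimpleArr α) {x : ι → k}
    (hx : osMk k α (ExteriorAlgebra.ι k x) = 0) : x = 0 := by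
  have h := map_eq_zero_of_mem_osIdeal hα (ExteriorAlgebra.toTrivSqZeroExt (R := k) (M := ι → k))
    (fun a b c l _ => by
      simp only [List.map_cons, List.prod_cons, ExteriorAlgebra.toTrivSqZeroExt_ι, ← mul_assoc,
        ← TrivSqZeroExt.inr_sub, TrivSqZeroExt.inr_mul_inr, zero_mul]) (osMk_eq_zero_iff.1 hx)
  rw [ExteriorAlgebra.toTrivSqZeroExt_ι] at h
  exact TrivSqZeroExt.inr_injective h

/-- The coboundaries in degree one are the multiples of `u`. -/
lemma mem_arrResonance_iff_mul (hα : IsSimpleArr α) (u : ι → k) :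
    u ∈ arrResonance k α ↔ ∃ b, b ∉ Submodule.span k {u} ∧
      osMk k α (ExteriorAlgebra.ι k b * ExteriorAlgebra.ι k u) = 0 := by
  have hgr : ∀ x : ι → k, osMk k α (ExteriorAlgebra.ι k x) ∈ osGrading k α 1 := fun x =>
    ⟨ExteriorAlgebra.ι k x, by simp [ExteriorAlgebra.exteriorPower], rfl⟩
  have hgr1 : ∀ x ∈ osGrading k α 1, ∃ y, x = osMk k α (ExteriorAlgebra.ι k y) := by
    rintro _ ⟨z, hz, rfl⟩
    simp only [ExteriorAlgebra.exteriorPower, pow_one, SetLike.mem_coe, LinearMap.mem_range] at hz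
    obtain ⟨y, rfl⟩ := hz
    exact ⟨y, rfl⟩
  have hgr0 : ∀ x, x ∈ osGrading k α 0 ↔ ∃ c : k, x = algebraMap k _ c := by
    intro x
    constructor
    · rintro ⟨z, hz, rfl⟩
      simp only [ExteriorAlgebra.exteriorPower, pow_zero, SetLike.mem_coe, Submodule.mem_one] at hz
      obtain ⟨c, rfl⟩ := hz
      exact ⟨c, by simp⟩
    · rintro ⟨c, rfl⟩
      exact ⟨algebraMap k _ c, by simp [ExteriorAlgebra.exteriorPower], by simp⟩
  have hcob : ∀ x, x ∈ aomotoCoboundaries (osGrading k α) (osMk k α (ExteriorAlgebra.ι k u)) 1 ↔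
      ∃ c : k, x = osMk k α (ExteriorAlgebra.ι k (c • u)) := by
    intro x
    simp only [aomotoCoboundaries, Submodule.mem_map, hgr0, LinearMap.mulRight_apply]
    constructor
    · rintro ⟨_, ⟨c, rfl⟩, rfl⟩
      exact ⟨c, by rw [map_smul, map_smul, Algebra.smul_def]⟩
    · rintro ⟨c, rfl⟩
      exact ⟨_, ⟨c, rfl⟩, by rw [map_smul, map_smul, Algebra.smul_def]⟩
  change _ ∧ _ ↔ _
  rw [and_iff_right (hgr u), Submodule.Quotient.nontrivial_iff, Submodule.submoduleOf, ne_eq,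
    Submodule.comap_subtype_eq_top, SetLike.not_le_iff_exists]
  constructor
  · rintro ⟨x, hx, hxn⟩
    obtain ⟨b, rfl⟩ := hgr1 x hx.1
    refine ⟨b, fun hb => hxn ?_, ?_⟩
    · obtain ⟨c, rfl⟩ := Submodule.mem_span_singleton.1 hb
      exact (hcob _).2 ⟨c, rfl⟩
    · rw [map_mul]
      exact hx.2
  · rintro ⟨b, hb, hbu⟩
    refine ⟨_, ⟨hgr b, ?_⟩, fun h => hb ?_⟩
    · rw [map_mul] at hbu
      exact hbu
    · obtain ⟨c, hc⟩ := (hcob _).1 h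
      rw [← sub_eq_zero, ← map_sub, ← map_sub] at hc
      exact Submodule.mem_span_singleton.2 ⟨c, (sub_eq_zero.1 (osMk_ι_injective hα hc)).symm⟩

end OrlikSolomon

section PlaneExterior

variable {k : Type*} [Field k]

lemma ι_mul_ι_fin_two (x y : Fin 2 → k) :
    ExteriorAlgebra.ι k x * ExteriorAlgebra.ι k y =
      (x 0 * y 1 - x 1 * y 0) • (extGen k (0 : Fin 2) * extGen k 1) := by
  have hx : ∀ z : Fin 2 → k, ExteriorAlgebra.ι k z =
      z 0 • extGen k (0 : Fin 2) + z 1 • extGen k 1 := by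
    intro z
    rw [← map_smul, ← map_smul, ← map_add]
    congr 1
    ext i
    fin_cases i <;> simp
  have hsw : extGen k (1 : Fin 2) * extGen k 0 = -(extGen k 0 * extGen k 1) :=
    eq_neg_of_add_eq_zero_left (ExteriorAlgebra.ι_add_mul_swap _ _)
  rw [hx x, hx y]
  simp only [add_mul, mul_add, smul_mul_assoc, mul_smul_comm, ExteriorAlgebra.ι_sq_zero, hsw,
    smul_zero, zero_add, add_zero, smul_neg, smul_smul]
  rw [sub_smul, mul_comm (y 0), mul_comm (y 1)]
  abel

lemma ι_mul_ι_mul_ι_fin_two (x y z : Fin 2 → k) :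
    ExteriorAlgebra.ι k x * ExteriorAlgebra.ι k y * ExteriorAlgebra.ι k z = 0 := by
  rw [ι_mul_ι_fin_two, smul_mul_assoc, mul_assoc, ι_mul_ι_fin_two, mul_smul_comm, ← mul_assoc,
    ExteriorAlgebra.ι_sq_zero, zero_mul, smul_zero, smul_zero]

lemma ι_mul_ι_eq_zero_iff_fin_two (x y : Fin 2 → k) :
    ExteriorAlgebra.ι k x * ExteriorAlgebra.ι k y = 0 ↔ x 0 * y 1 - x 1 * y 0 = 0 := by
  refine ⟨fun h => ?_, fun h => by rw [ι_mul_ι_fin_two, h, zero_smul]⟩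
  have h1 : ExteriorAlgebra.ιMulti k 2 ![x, y] = 0 := by
    simpa [ExteriorAlgebra.ιMulti_apply] using h
  have h2 := ExteriorAlgebra.liftAlternating_apply_ιMulti
    (f := Pi.single (M := fun i => (Fin 2 → k) [⋀^Fin i]→ₗ[k] k) 2 Matrix.detRowAlternating)
    ![x, y]
  rw [h1, map_zero, Pi.single_eq_same] at h2
  have h3 : Matrix.det (Matrix.of ![x, y]) = 0 := h2.symm
  rw [Matrix.det_fin_two] at h3
  simp only [Matrix.of_apply, Matrix.cons_val_zero, Matrix.cons_val_one] at h3
  linear_combination h3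

end PlaneExterior

section ResonanceCriterion

/-- The map `x ↦ (x_i, ∑_{h ∈ S} x_h)`. For a rank two flat `S` and `i ∈ S` the induced map of
exterior algebras factors through the Orlik-Solomon algebra, and it detects the local condition
at `i`. -/
def flatTest (k : Type*) [Field k] {ι : Type*} (S : Finset ι) (i : ι) :
    (ι → k) →ₗ[k] (Fin 2 → k) :=
  LinearMap.pi ![LinearMap.proj i, ∑ h ∈ S, LinearMap.proj h]

lemma flatTest_zero {k ι : Type*} [Field k] (S : Finset ι) (i : ι) (x : ι → k) :
    flatTest k S i x 0 = x i := rfl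

lemma flatTest_one {k ι : Type*} [Field k] (S : Finset ι) (i : ι) (x : ι → k) :
    flatTest k S i x 1 = ∑ h ∈ S, x h := by
  simp [flatTest]

variable {k : Type*} [Field k] {V ι : Type*} [AddCommGroup V] [Module ℂ V] [Fintype ι]
  [DecidableEq ι] {α : ι → Module.Dual ℂ V}

lemma map_flatTest_eq_zero (hα : IsSimpleArr α) {p q i : ι}
    (hi : i ∈ flatClosure α p q) {x : ExteriorAlgebra k (ι → k)} (hx : x ∈ osIdeal k α) :
    ExteriorAlgebra.map (flatTest k (flatClosure α p q) i) x = 0 := by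
  refine map_eq_zero_of_mem_osIdeal hα _ (fun a b c l hl => ?_) hx
  set S := flatClosure α p q with hS
  simp only [ExteriorAlgebra.map_apply_ι, ← map_sub]
  rcases l with _ | ⟨d, l⟩
  · simp only [List.map_cons, List.prod_cons, List.map_nil, List.prod_nil, mul_one]
    rw [ι_mul_ι_eq_zero_iff_fin_two]
    simp only [flatTest_zero, flatTest_one, Pi.sub_apply, Finset.sum_sub_distrib]
    obtain ⟨hnd, hdep, -⟩ := hl
    simp only [List.nodup_cons, List.mem_cons, List.not_mem_nil, or_false, not_or,
      List.nodup_nil, not_false_eq_true, and_true] at hnd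
    obtain ⟨⟨hab, hac⟩, hbc⟩ := hnd
    -- two members of the circuit in the flat force the third one
    have hthird : ∀ r s t, r ≠ s → {i | i ∈ [a, b, c]} = ({t, r, s} : Set ι) →
        r ∈ S → s ∈ S → t ∈ S := by
      intro r s t hrs hset hr hs
      rw [hset] at hdep
      rw [hS, ← flatClosure_eq_of_mem hα hrs hr hs, mem_flatClosure]
      exact mem_span_of_not_linearIndepOn_triple hα hdep
    have h1 := hthird a b c hab (by ext; simp; tauto)
    have h2 := hthird a c b hac (by ext; simp; tauto)
    have h3 := hthird b c a hbc (by ext; simp)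
    have hne : ∀ x, x ∉ S → (Pi.single x (1 : k) : ι → k) i = 0 := fun x hx =>
      Pi.single_eq_of_ne (by rintro rfl; exact hx hi) _
    by_cases ha : a ∈ S <;> by_cases hb : b ∈ S <;> by_cases hc : c ∈ S <;>
      simp_all
  · simp only [List.map_cons, List.prod_cons, ← mul_assoc, ι_mul_ι_mul_ι_fin_two, zero_mul]

lemma osMk_extGen_sub_mul_sub (hα : IsSimpleArr α) {p q i j o : ι}
    (hi : i ∈ flatClosure α p q) (hj : j ∈ flatClosure α p q) (ho : o ∈ flatClosure α p q) :
    osMk k α ((extGen k i - extGen k o) * (extGen k j - extGen k o)) = 0 := by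
  by_cases hoi : o = i
  · simp [hoi]
  by_cases hoj : o = j
  · simp [hoj]
  by_cases hij : i = j
  · rw [hij, ← map_sub, ExteriorAlgebra.ι_sq_zero, map_zero]
  rw [osMk_eq_zero_iff]
  refine TwoSidedIdeal.subset_span ⟨[o, i, j], ?_, ?_⟩
  · apply isArrCircuit_triple hα hoi hoj hij
    rw [← mem_flatClosure, flatClosure_eq_of_mem hα hoi ho hi]
    exact hj
  · rw [osBoundary_cons]
    simp

/-- The product in degree two splits into contributions of the rank two flats, each of which is seen
by `flatTest`. -/
lemma osMk_mul_eq_zero_iff (hα : IsSimpleArr α) (u b : ι → k) :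
    osMk k α (ExteriorAlgebra.ι k b * ExteriorAlgebra.ι k u) = 0 ↔ IsLocallyParallel α u b := by
  constructor
  · intro h p q _ i hi
    have := map_flatTest_eq_zero hα hi (osMk_eq_zero_iff.1 h)
    rw [map_mul, ExteriorAlgebra.map_apply_ι, ExteriorAlgebra.map_apply_ι,
      ι_mul_ι_eq_zero_iff_fin_two, flatTest_zero, flatTest_zero, flatTest_one, flatTest_one] at this
    linear_combination this
  · intro h
    let e : ι → OSAlgebra k α := fun i => osMk k α (extGen k i)
    have he : ∀ i j, e i * e j = osMk k α (extGen k i * extGen k j) := fun i j => by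
      simp [e]
    have hsq : ∀ i, e i * e i = 0 := fun i => by rw [he, ExteriorAlgebra.ι_sq_zero, map_zero]
    have hι : ∀ x : ι → k, osMk k α (ExteriorAlgebra.ι k x) = ∑ i, x i • e i := by
      intro x
      have hx : x = ∑ i, x i • (Pi.single i (1 : k) : ι → k) := by
        ext j
        simp [Finset.sum_apply, Pi.single_apply]
      conv_lhs => rw [hx]
      simp [e]
    -- the part of the product that lives on one flat
    have hflat : ∀ p q, p ≠ q → ∑ i ∈ flatClosure α p q, ∑ j ∈ flatClosure α p q,
        (b i * u j) • (e i * e j) = 0 := by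
      intro p q hpq
      set S := flatClosure α p q
      have hp : p ∈ S := left_mem_flatClosure p q
      have hrel : ∀ i ∈ S, ∀ j ∈ S, e i * e j = e p * e j - e p * e i := by
        intro i hi j hj
        have h1 := osMk_extGen_sub_mul_sub (k := k) hα hi hj hp
        have h2 : e i * e p = - (e p * e i) := by
          rw [eq_neg_iff_add_eq_zero, he, he, ← map_add, ExteriorAlgebra.ι_add_mul_swap, map_zero]
        have h3 : (e i - e p) * (e j - e p) = 0 := by
          simpa [e] using h1
        rw [sub_mul, mul_sub, mul_sub, hsq, h2] at h3
        rw [← sub_eq_zero, ← h3]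
        abel
      have h1 : ∑ i ∈ S, ∑ j ∈ S, (b i * u j) • (e i * e j) =
          (∑ i ∈ S, b i) • (∑ j ∈ S, u j • (e p * e j)) -
            (∑ j ∈ S, u j) • (∑ i ∈ S, b i • (e p * e i)) := by
        rw [Finset.sum_smul, Finset.sum_smul]
        simp only [Finset.smul_sum, smul_smul]
        rw [Finset.sum_comm (s := S) (t := S) (f := fun i j => (u i * b j) • (e p * e j)),
          ← Finset.sum_sub_distrib]
        refine Finset.sum_congr rfl fun i hi => ?_
        rw [← Finset.sum_sub_distrib]
        refine Finset.sum_congr rfl fun j hj => ?_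
        rw [hrel i hi j hj, smul_sub, mul_comm (b i)]
      rw [h1, Finset.smul_sum, Finset.smul_sum, ← Finset.sum_sub_distrib]
      refine Finset.sum_eq_zero fun i hi => ?_
      rw [smul_smul, smul_smul, ← sub_smul]
      have := h p q hpq i hi
      rw [show (∑ i ∈ S, b i) * u i - (∑ i ∈ S, u i) * b i = 0 by linear_combination -this,
        zero_smul]
    rw [map_mul, hι, hι, Finset.sum_mul_sum, ← Finset.sum_product',
      Finset.univ_product_univ,
      ← Finset.sum_subset (Finset.subset_univ (Finset.univ : Finset ι).offDiag)]
    · -- every pair of distinct hyperplanes lies on exactly one rank two flat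
      rw [← Finset.sum_fiberwise_of_maps_to (t := Finset.univ.offDiag.image
        fun x : ι × ι => flatClosure α x.1 x.2) (g := fun x : ι × ι => flatClosure α x.1 x.2)
        (fun x hx => Finset.mem_image_of_mem _ hx)]
      refine Finset.sum_eq_zero fun S hS => ?_
      obtain ⟨⟨p, q⟩, hpq, rfl⟩ := Finset.mem_image.1 hS
      have hpq' : p ≠ q := by simpa using hpq
      rw [← hflat p q hpq', ← Finset.sum_product']
      have hfil : (Finset.univ.offDiag.filter fun x : ι × ι =>
          flatClosure α x.1 x.2 = flatClosure α p q) = (flatClosure α p q).offDiag := by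
        ext ⟨i, j⟩
        simp only [Finset.mem_filter, Finset.mem_offDiag, Finset.mem_univ, true_and]
        constructor
        · rintro ⟨hij, heq⟩
          rw [← heq]
          exact ⟨left_mem_flatClosure i j, right_mem_flatClosure i j, hij⟩
        · rintro ⟨hi, hj, hij⟩
          exact ⟨hij, flatClosure_eq_of_mem hα hij hi hj⟩
      rw [hfil]
      refine (Finset.sum_subset ?_ ?_).trans (Finset.sum_congr rfl fun x _ => ?_)
      · exact fun x hx => by
          rw [Finset.mem_offDiag] at hx
          exact Finset.mem_product.2 ⟨hx.1, hx.2.1⟩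
      · rintro ⟨i, j⟩ hx hx'
        simp only [Finset.mem_product] at hx
        have : i = j := by
          by_contra hne
          exact hx' (Finset.mem_offDiag.2 ⟨hx.1, hx.2, hne⟩)
        simp [this, hsq]
      · simp [smul_smul, mul_comm]
    · rintro ⟨i, j⟩ - hx
      have : i = j := by simpa using hx
      simp [this, hsq]

/-- `u` is resonant if and only if some `b` that is not a multiple of `u` satisfies, together with
`u`, the local condition at every rank two flat. -/
theorem mem_arrResonance_iff (hα : IsSimpleArr α) (u : ι → k) :
    u ∈ arrResonance k α ↔ ∃ b, b ∉ Submodule.span k {u} ∧ IsLocallyParallel α u b := by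
  simp only [mem_arrResonance_iff_mul hα, osMk_mul_eq_zero_iff hα]

end ResonanceCriterion

/-! ### Extension by zero from a subarrangement -/

section Extend

variable {k : Type*} [Field k] {V V' ι ι' : Type*} [AddCommGroup V] [Module ℂ V]
  [AddCommGroup V'] [Module ℂ V'] [Fintype ι] [Fintype ι']
  {α : ι → Module.Dual ℂ V} {α' : ι' → Module.Dual ℂ V'}

/-- The rank two flats of `α'` are the traces of the rank two flats of `α` along `f`. -/
def IsSubArr (α' : ι' → Module.Dual ℂ V') (α : ι → Module.Dual ℂ V) (f : ι' ↪ ι) : Prop :=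
  ∀ p q h, f h ∈ flatClosure α (f p) (f q) ↔ h ∈ flatClosure α' p q

lemma sum_flatClosure_extend {M : Type*} [AddCommMonoid M] {f : ι' ↪ ι} (hf : IsSubArr α' α f)
    (u : ι' → M) (p q : ι') :
    ∑ h ∈ flatClosure α (f p) (f q), Function.extend f u 0 h = ∑ h ∈ flatClosure α' p q, u h := by
  have h1 : ∑ h ∈ flatClosure α' p q, u h =
      ∑ h ∈ (flatClosure α' p q).map f, Function.extend f u 0 h := by
    rw [Finset.sum_map]
    exact Finset.sum_congr rfl fun h _ => (f.injective.extend_apply _ _ _).symm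
  rw [h1]
  symm
  apply Finset.sum_subset
  · intro h hh
    obtain ⟨h', hh', rfl⟩ := Finset.mem_map.1 hh
    exact (hf _ _ _).2 hh'
  · intro h hh hh'
    apply Function.extend_apply'
    rintro ⟨h', rfl⟩
    exact hh' (Finset.mem_map_of_mem _ ((hf _ _ _).1 hh))

lemma isLocallyParallel_extend_iff (hα : IsSimpleArr α) {f : ι' ↪ ι} (hf : IsSubArr α' α f)
    (u b : ι' → k) :
    IsLocallyParallel α (Function.extend f u 0) (Function.extend f b 0) ↔
      IsLocallyParallel α' u b := by
  constructor
  · intro h p q hpq i hi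
    have := h (f p) (f q) (f.injective.ne hpq) (f i) ((hf _ _ _).2 hi)
    rwa [sum_flatClosure_extend hf, sum_flatClosure_extend hf, f.injective.extend_apply,
      f.injective.extend_apply] at this
  · intro h P Q _ i hi
    by_cases hir : ∃ i', f i' = i
    swap
    · rw [Function.extend_apply' _ _ _ hir, Function.extend_apply' _ _ _ hir]
      simp
    obtain ⟨i, rfl⟩ := hir
    by_cases hex : ∃ j, j ≠ i ∧ f j ∈ flatClosure α P Q
    · obtain ⟨j, hji, hj⟩ := hex
      rw [← flatClosure_eq_of_mem hα (f.injective.ne hji) hj hi, sum_flatClosure_extend hf,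
        sum_flatClosure_extend hf, f.injective.extend_apply, f.injective.extend_apply]
      exact h j i hji i (right_mem_flatClosure _ _)
    · -- only one hyperplane of the flat belongs to the subarrangement
      push Not at hex
      have hsum : ∀ w : ι' → k, ∑ h ∈ flatClosure α P Q, Function.extend f w 0 h = w i := by
        intro w
        rw [Finset.sum_eq_single_of_mem (f i) hi, f.injective.extend_apply]
        intro h hh hne
        apply Function.extend_apply'
        rintro ⟨j, rfl⟩
        exact hex j (fun e => hne (e ▸ rfl)) hh
      rw [hsum, hsum, f.injective.extend_apply, f.injective.extend_apply, mul_comm]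

end Extend

/-! ### The rank two flats of the type B arrangement -/

section Edges

/-- The hyperplane `ker (x_i + ε x_j)`, for `i ≠ j` in either order; the value
for `i = j` is irrelevant. -/
def edge {n : ℕ} (i j : Fin n) (ε : ℤˣ) : BIdx n :=
  if h : i < j then Sum.inr (⟨(i, j), h⟩, ε)
  else if h : j < i then Sum.inr (⟨(j, i), h⟩, ε)
  else Sum.inl i

variable {n : ℕ}

lemma edge_of_lt {i j : Fin n} (h : i < j) (ε : ℤˣ) : edge i j ε = Sum.inr (⟨(i, j), h⟩, ε) := by
  simp [edge, h]

lemma edge_comm (i j : Fin n) (ε : ℤˣ) : edge i j ε = edge j i ε := by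
  rcases lt_trichotomy i j with h | rfl | h
  · simp [edge, h, h.not_gt]
  · rfl
  · simp [edge, h, h.not_gt]

lemma edge_ne_hC {i j : Fin n} (h : i ≠ j) (ε : ℤˣ) (m : Fin n) : edge i j ε ≠ hC m := by
  rcases h.lt_or_gt with h | h
  · simp [edge_of_lt h]
  · simp [edge_comm i j, edge_of_lt h]

lemma edge_inj {i j a b : Fin n} (h : i ≠ j) (h' : a ≠ b) {ε δ : ℤˣ} :
    edge i j ε = edge a b δ ↔ ε = δ ∧ ((i = a ∧ j = b) ∨ (i = b ∧ j = a)) := by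
  rcases h.lt_or_gt with h | h <;> rcases h'.lt_or_gt with h' | h'
  · rw [edge_of_lt h, edge_of_lt h']
    simp only [Sum.inr.injEq, Prod.mk.injEq, Subtype.mk.injEq]
    grind
  · rw [edge_of_lt h, edge_comm a b, edge_of_lt h']
    simp only [Sum.inr.injEq, Prod.mk.injEq, Subtype.mk.injEq]
    grind
  · rw [edge_comm i j, edge_of_lt h, edge_of_lt h']
    simp only [Sum.inr.injEq, Prod.mk.injEq, Subtype.mk.injEq]
    grind
  · rw [edge_comm i j, edge_of_lt h, edge_comm a b, edge_of_lt h']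
    simp only [Sum.inr.injEq, Prod.mk.injEq, Subtype.mk.injEq]
    grind

lemma BIdx.cases_edge {P : BIdx n → Prop} (h1 : ∀ i, P (hC i))
    (h2 : ∀ i j ε, i ≠ j → P (edge i j ε)) (h : BIdx n) : P h := by
  rcases h with i | ⟨⟨⟨i, j⟩, hij⟩, ε⟩
  · exact h1 i
  · rw [← edge_of_lt hij]
    exact h2 i j ε (ne_of_lt hij)

lemma units_mul_self_cast (ε : ℤˣ) : ((ε : ℤ) : ℂ) * ((ε : ℤ) : ℂ) = 1 := by
  rcases Int.units_eq_one_or ε with rfl | rfl <;> simp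

lemma units_cast_ne_zero (ε : ℤˣ) : ((ε : ℤ) : ℂ) ≠ 0 :=
  left_ne_zero_of_mul_eq_one (units_mul_self_cast ε)

lemma arrB_hC_single (i a : Fin n) :
    arrB n (hC i) (Pi.single a 1) = if i = a then 1 else 0 := by
  simp [arrB, Pi.single_apply]

/-- Up to a nonzero factor, `edge i j ε` is given by the form `x_i + ε x_j` in either order of `i`
and `j`. -/
lemma exists_arrB_edge {i j : Fin n} (h : i ≠ j) (ε : ℤˣ) : ∃ c : ℂ, c ≠ 0 ∧
    arrB n (edge i j ε) =
      c • (LinearMap.proj i + ((ε : ℤ) : ℂ) • LinearMap.proj j : Module.Dual ℂ (Fin n → ℂ)) := by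
  rcases h.lt_or_gt with h | h
  · exact ⟨1, one_ne_zero, by rw [edge_of_lt h, one_smul]; rfl⟩
  · refine ⟨(ε : ℤ), units_cast_ne_zero ε, ?_⟩
    rw [edge_comm i j, edge_of_lt h, smul_add, smul_smul, units_mul_self_cast, one_smul, add_comm]
    rfl

lemma arrB_edge_single_left {i j : Fin n} (h : i ≠ j) (ε : ℤˣ) :
    arrB n (edge i j ε) (Pi.single i 1) ≠ 0 := by
  obtain ⟨c, hc, he⟩ := exists_arrB_edge h ε
  simp [he, hc, h]

lemma arrB_edge_single_of_ne {i j a : Fin n} (h : i ≠ j) (ε : ℤˣ) (hi : a ≠ i) (hj : a ≠ j) :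
    arrB n (edge i j ε) (Pi.single a 1) = 0 := by
  obtain ⟨c, hc, he⟩ := exists_arrB_edge h ε
  simp [he, hi.symm, hj.symm]

lemma arrB_edge_single_right {i j : Fin n} (h : i ≠ j) (ε : ℤˣ) :
    arrB n (edge i j ε) (Pi.single j 1) =
      ((ε : ℤ) : ℂ) * arrB n (edge i j ε) (Pi.single i 1) := by
  obtain ⟨c, hc, he⟩ := exists_arrB_edge h ε
  simp [he, h, h.symm, mul_comm]

/-- A root of type B has at most two nonzero coordinates. -/
lemma arrB_single_eq_zero_of_three {i j l : Fin n} (hij : i ≠ j) (hil : i ≠ l) (hjl : j ≠ l)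
    (h : BIdx n) : arrB n h (Pi.single i 1) = 0 ∨ arrB n h (Pi.single j 1) = 0 ∨
      arrB n h (Pi.single l 1) = 0 := by
  induction h using BIdx.cases_edge with
  | h1 m =>
    simp only [arrB_hC_single]
    grind
  | h2 a b ε hab =>
    by_contra! hcon
    have key : ∀ x, arrB n (edge a b ε) (Pi.single x 1) ≠ 0 → x = a ∨ x = b := by
      intro x hx
      by_contra! hne
      exact hx (arrB_edge_single_of_ne hab ε hne.1 hne.2)
    have := key i hcon.1
    have := key j hcon.2.1
    have := key l hcon.2.2
    grind

lemma isSimpleArr_arrB (n : ℕ) : IsSimpleArr (arrB n) := by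
  constructor
  · intro p hp
    induction p using BIdx.cases_edge with
    | h1 i => simpa [arrB_hC_single] using congrArg (fun φ => φ (Pi.single i 1)) hp
    | h2 i j ε hij =>
      exact arrB_edge_single_left hij ε (by rw [hp]; rfl)
  · intro p q hpq
    rw [LinearIndependent.pair_iff]
    intro s t hst
    have hev : ∀ a, s * arrB n p (Pi.single a 1) + t * arrB n q (Pi.single a 1) = 0 := fun a => by
      simpa using congrArg (fun φ => φ (Pi.single a 1)) hst
    clear hst
    induction p using BIdx.cases_edge with
    | h1 i =>
      induction q using BIdx.cases_edge with
      | h1 j =>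
        have hij : i ≠ j := fun e => hpq (e ▸ rfl)
        have h1 := hev i
        have h2 := hev j
        simp only [arrB_hC_single] at h1 h2
        simp_all
      | h2 a b ε hab =>
        have ht : t = 0 := by
          by_cases hia : i = a
          · have h1 := hev b
            rw [arrB_hC_single, if_neg (by rw [hia]; exact hab), arrB_edge_single_right hab] at h1
            simpa [units_cast_ne_zero, arrB_edge_single_left hab] using h1
          · have h1 := hev a
            rw [arrB_hC_single, if_neg hia] at h1
            simpa [arrB_edge_single_left hab] using h1
        refine ⟨?_, ht⟩
        simpa [ht, arrB_hC_single] using hev i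
    | h2 i j ε hij =>
      induction q using BIdx.cases_edge with
      | h1 m =>
        have ht : s = 0 := by
          by_cases hia : m = i
          · have h1 := hev j
            rw [arrB_hC_single, if_neg (by rw [hia]; exact hij), arrB_edge_single_right hij] at h1
            simpa [units_cast_ne_zero, arrB_edge_single_left hij] using h1
          · have h1 := hev i
            rw [arrB_hC_single, if_neg hia] at h1
            simpa [arrB_edge_single_left hij] using h1
        refine ⟨ht, ?_⟩
        simpa [ht, arrB_hC_single] using hev m
      | h2 a b δ hab =>
        have hs : s = 0 → t = 0 := fun hs => by
          simpa [hs, arrB_edge_single_left hab] using hev a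
        suffices s = 0 from ⟨this, hs this⟩
        by_cases hi : i = a ∨ i = b
        · by_cases hj : j = a ∨ j = b
          · -- the same pair of coordinates with opposite signs
            wlog hia : i = a generalizing a b
            · have hba : i = b := hi.resolve_left hia
              refine this b a hab.symm ?_ ?_ hi.symm hj.symm hba <;> rwa [edge_comm b a]
            obtain rfl : j = b := hj.resolve_left (fun e => hij (hia.trans e.symm))
            subst hia
            have hεδ : ε ≠ δ := fun e => hpq (e ▸ rfl)
            have h1 := hev i
            have h2 := hev j
            rw [arrB_edge_single_right hij, arrB_edge_single_right hij] at h2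
            have hx := arrB_edge_single_left hij ε
            have h3 : s * arrB n (edge i j ε) (Pi.single i 1) *
                (((ε : ℤ) : ℂ) - ((δ : ℤ) : ℂ)) = 0 := by
              linear_combination h2 - ((δ : ℤ) : ℂ) * h1
            have h4 : ((ε : ℤ) : ℂ) - ((δ : ℤ) : ℂ) ≠ 0 := by
              rw [sub_ne_zero]
              intro e
              exact hεδ (Units.ext (Int.cast_injective e))
            simpa [h4, hx] using h3
          · push Not at hj
            have h1 := hev j
            rw [arrB_edge_single_of_ne hab δ hj.1 hj.2, arrB_edge_single_right hij] at h1
            simpa [units_cast_ne_zero, arrB_edge_single_left hij] using h1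
        · push Not at hi
          have h1 := hev i
          rw [arrB_edge_single_of_ne hab δ hi.1 hi.2] at h1
          simpa [arrB_edge_single_left hij] using h1

lemma eq_of_arrB_eq_smul {p q : BIdx n} {c : ℂ} (h : arrB n p = c • arrB n q) : p = q := by
  by_contra hpq
  have := LinearIndependent.pair_iff.1 ((isSimpleArr_arrB n).2 p q hpq) 1 (-c) (by simp [h])
  simp at this

lemma mem_flatClosure_hC_hC {i j : Fin n} (hij : i ≠ j) (h : BIdx n) :
    h ∈ flatClosure (arrB n) (hC i) (hC j) ↔
      h = hC i ∨ h = hC j ∨ h = edge i j 1 ∨ h = edge i j (-1) := by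
  constructor
  · intro hh
    obtain ⟨c, d, hcd⟩ := Submodule.mem_span_pair.1 (mem_flatClosure.1 hh)
    have hev : ∀ a, a ≠ i → a ≠ j → arrB n h (Pi.single a 1) = 0 := fun a hi hj => by
      rw [← hcd, LinearMap.add_apply, LinearMap.smul_apply, LinearMap.smul_apply, arrB_hC_single,
        arrB_hC_single, if_neg hi.symm, if_neg hj.symm]
      simp
    induction h using BIdx.cases_edge with
    | h1 m =>
      have := hev m
      simp only [arrB_hC_single, if_true, one_ne_zero] at this
      have : m = i ∨ m = j := by tauto
      rcases this with rfl | rfl <;> simp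
    | h2 a b ε hab =>
      have ha : a = i ∨ a = j := by
        by_contra! hne
        exact arrB_edge_single_left hab ε (hev a hne.1 hne.2)
      have hb : b = i ∨ b = j := by
        by_contra! hne
        rw [edge_comm] at hev
        exact arrB_edge_single_left hab.symm ε (hev b hne.1 hne.2)
      have : edge a b ε = edge i j ε := by
        rw [edge_inj hab hij]
        grind
      rw [this]
      rcases Int.units_eq_one_or ε with rfl | rfl <;> simp
  · have key : ∀ ε, edge i j ε ∈ flatClosure (arrB n) (hC i) (hC j) := fun ε => by
      obtain ⟨c, -, he⟩ := exists_arrB_edge hij ε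
      rw [mem_flatClosure, Submodule.mem_span_pair]
      exact ⟨c, c * (ε : ℤ), by rw [he, smul_add, smul_smul]; rfl⟩
    rintro (rfl | rfl | rfl | rfl)
    · exact left_mem_flatClosure _ _
    · exact right_mem_flatClosure _ _
    · exact key 1
    · exact key (-1)

lemma mem_flatClosure_hC_edge {i a b : Fin n} {ε : ℤˣ} (hia : i ≠ a) (hib : i ≠ b) (hab : a ≠ b)
    (h : BIdx n) :
    h ∈ flatClosure (arrB n) (hC i) (edge a b ε) ↔ h = hC i ∨ h = edge a b ε := by
  constructor
  · intro hh
    obtain ⟨c, d, hcd⟩ := Submodule.mem_span_pair.1 (mem_flatClosure.1 hh)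
    have hev : ∀ x, arrB n h (Pi.single x 1) =
        c * arrB n (hC i) (Pi.single x 1) + d * arrB n (edge a b ε) (Pi.single x 1) := fun x => by
      rw [← hcd]; rfl
    have h0 : c = 0 ∨ d = 0 := by
      have h3 := arrB_single_eq_zero_of_three hia hib hab h
      rw [hev, hev, hev, arrB_edge_single_right hab, arrB_edge_single_of_ne hab ε hia hib] at h3
      simpa [arrB_hC_single, hia, hib, units_cast_ne_zero, arrB_edge_single_left hab] using h3
    rcases h0 with rfl | rfl
    · exact Or.inr (eq_of_arrB_eq_smul (c := d) (by rw [← hcd]; simp))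
    · exact Or.inl (eq_of_arrB_eq_smul (c := c) (by rw [← hcd]; simp))
  · rintro (rfl | rfl)
    · exact left_mem_flatClosure _ _
    · exact right_mem_flatClosure _ _

lemma mem_flatClosure_edge_edge {i j a b : Fin n} {ε δ : ℤˣ} (hij : i ≠ j) (hab : a ≠ b)
    (hia : i ≠ a) (hib : i ≠ b) (hja : j ≠ a) (hjb : j ≠ b) (h : BIdx n) :
    h ∈ flatClosure (arrB n) (edge i j ε) (edge a b δ) ↔ h = edge i j ε ∨ h = edge a b δ := by
  constructor
  · intro hh
    obtain ⟨c, d, hcd⟩ := Submodule.mem_span_pair.1 (mem_flatClosure.1 hh)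
    have hev : ∀ x, arrB n h (Pi.single x 1) = c * arrB n (edge i j ε) (Pi.single x 1) +
        d * arrB n (edge a b δ) (Pi.single x 1) := fun x => by
      rw [← hcd]; rfl
    have h0 : c = 0 ∨ d = 0 := by
      have h3 := arrB_single_eq_zero_of_three hia hib hab h
      rw [hev, hev, hev, arrB_edge_single_right hab, arrB_edge_single_of_ne hab δ hia hib,
        arrB_edge_single_of_ne hij ε hia.symm hja.symm,
        arrB_edge_single_of_ne hij ε hib.symm hjb.symm] at h3
      simpa [units_cast_ne_zero, arrB_edge_single_left hab, arrB_edge_single_left hij] using h3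
    rcases h0 with rfl | rfl
    · exact Or.inr (eq_of_arrB_eq_smul (c := d) (by rw [← hcd]; simp))
    · exact Or.inl (eq_of_arrB_eq_smul (c := c) (by rw [← hcd]; simp))
  · rintro (rfl | rfl)
    · exact left_mem_flatClosure _ _
    · exact right_mem_flatClosure _ _

lemma mem_flatClosure_triangle {i j l : Fin n} {ε δ : ℤˣ} (hij : i ≠ j) (hil : i ≠ l)
    (hjl : j ≠ l) (h : BIdx n) :
    h ∈ flatClosure (arrB n) (edge i j ε) (edge j l δ) ↔
      h = edge i j ε ∨ h = edge j l δ ∨ h = edge i l (-(ε * δ)) := by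
  obtain ⟨s, hs, hse⟩ := exists_arrB_edge hij ε
  obtain ⟨t, ht, hte⟩ := exists_arrB_edge hjl δ
  obtain ⟨r, hr, hre⟩ := exists_arrB_edge hil (-(ε * δ))
  have hεε := units_mul_self_cast ε
  constructor
  · intro hh
    obtain ⟨c, d, hcd⟩ := Submodule.mem_span_pair.1 (mem_flatClosure.1 hh)
    have h0 : c = 0 ∨ d = 0 ∨ c * s * (ε : ℤ) + d * t = 0 := by
      have h3 := arrB_single_eq_zero_of_three hij hil hjl h
      rw [← hcd, hse, hte] at h3
      simp [hij, hil, hjl, hij.symm, hil.symm, hjl.symm, hs, ht] at h3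
      rcases h3 with h3 | h3 | h3
      · exact Or.inl h3
      · exact Or.inr (Or.inr (by linear_combination h3))
      · exact Or.inr (Or.inl h3)
    rcases h0 with rfl | rfl | h0
    · exact Or.inr (Or.inl (eq_of_arrB_eq_smul (c := d) (by rw [← hcd]; simp)))
    · exact Or.inl (eq_of_arrB_eq_smul (c := c) (by rw [← hcd]; simp))
    · refine Or.inr (Or.inr (eq_of_arrB_eq_smul (c := c * s * r⁻¹) ?_))
      rw [← hcd, hse, hte, hre, smul_smul, smul_smul, smul_smul, inv_mul_cancel_right₀ hr]
      have h0' : d * t = - (c * s * (ε : ℤ)) := by linear_combination h0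
      rw [h0']
      ext x
      simp
      ring
  · rintro (rfl | rfl | rfl)
    · exact left_mem_flatClosure _ _
    · exact right_mem_flatClosure _ _
    · rw [mem_flatClosure, Submodule.mem_span_pair, hse, hte, hre]
      refine ⟨r * s⁻¹, - (r * (ε : ℤ) * t⁻¹), ?_⟩
      rw [smul_smul, smul_smul, inv_mul_cancel_right₀ hs, neg_mul, inv_mul_cancel_right₀ ht]
      ext x
      simp
      ring

end Edges

/-! ### Local conditions for the type B arrangement -/

section Pdet

/-- The determinant of two vectors in the plane. -/
def pdet {R : Type*} [CommRing R] (x y : R × R) : R := x.1 * y.2 - x.2 * y.1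

variable {R : Type*} [CommRing R]

@[simp] lemma pdet_self (x : R × R) : pdet x x = 0 := by simp [pdet]; ring
@[simp] lemma pdet_zero_left (x : R × R) : pdet 0 x = 0 := by simp [pdet]
@[simp] lemma pdet_zero_right (x : R × R) : pdet x 0 = 0 := by simp [pdet]
@[simp] lemma pdet_add_right (x y z : R × R) : pdet x (y + z) = pdet x y + pdet x z := by
  simp [pdet]; ring
@[simp] lemma pdet_add_left (x y z : R × R) : pdet (x + y) z = pdet x z + pdet y z := by
  simp [pdet]; ring
@[simp] lemma pdet_neg_right (x y : R × R) : pdet x (-y) = -pdet x y := by simp [pdet]; ring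
@[simp] lemma pdet_neg_left (x y : R × R) : pdet (-x) y = -pdet x y := by simp [pdet]; ring
@[simp] lemma pdet_smul_right (c : R) (x y : R × R) : pdet x (c • y) = c * pdet x y := by
  simp [pdet]; ring
@[simp] lemma pdet_smul_left (c : R) (x y : R × R) : pdet (c • x) y = c * pdet x y := by
  simp [pdet]; ring

lemma pdet_swap (x y : R × R) : pdet y x = -pdet x y := by simp [pdet]; ring

lemma pdet_eq_zero_comm {x y : R × R} : pdet x y = 0 ↔ pdet y x = 0 := by
  rw [pdet_swap x y, neg_eq_zero]

lemma pdet_ne_zero_comm {x y : R × R} : pdet x y ≠ 0 ↔ pdet y x ≠ 0 :=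
  pdet_eq_zero_comm.not

variable {k : Type*} [Field k]

lemma pdet_eq_zero_trans {x y z : k × k} (hx : x ≠ 0) (hy : pdet x y = 0) (hz : pdet x z = 0) :
    pdet y z = 0 := by
  have h : x.1 ≠ 0 ∨ x.2 ≠ 0 := by
    by_contra! hcon
    exact hx (Prod.ext hcon.1 hcon.2)
  simp only [pdet] at *
  rcases h with h | h
  · apply mul_left_cancel₀ h
    linear_combination y.1 * hz - z.1 * hy
  · apply mul_left_cancel₀ h
    linear_combination y.2 * hz - z.2 * hy

/-- A plane vector that is parallel to two independent vectors is zero. -/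
lemma eq_zero_of_pdet {x y z : k × k} (hxy : pdet x y ≠ 0) (hx : pdet x z = 0)
    (hy : pdet y z = 0) : z = 0 := by
  simp only [pdet] at *
  ext
  · apply mul_left_cancel₀ hxy
    simp only [Prod.fst_zero]
    linear_combination y.1 * hx - x.1 * hy
  · apply mul_left_cancel₀ hxy
    simp only [Prod.snd_zero]
    linear_combination y.2 * hx - x.2 * hy

lemma exists_smul_of_pdet_eq_zero {x y : k × k} (hx : x ≠ 0) (h : pdet x y = 0) :
    ∃ c : k, y = c • x := by
  have h' : x.1 ≠ 0 ∨ x.2 ≠ 0 := by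
    by_contra! hcon
    exact hx (Prod.ext hcon.1 hcon.2)
  simp only [pdet] at h
  rcases h' with h' | h'
  · refine ⟨y.1 / x.1, ?_⟩
    ext
    · simp [h']
    · simp only [Prod.smul_snd, smul_eq_mul]
      field_simp
      linear_combination h
  · refine ⟨y.2 / x.2, ?_⟩
    ext
    · simp only [Prod.smul_fst, smul_eq_mul]
      field_simp
      linear_combination -h
    · simp [h']

lemma left_ne_zero_of_pdet {x y : R × R} (h : pdet x y ≠ 0) : x ≠ 0 := by
  rintro rfl
  simp at h

end Pdet

/-- The local conditions at the rank two flats of the type B arrangement, on a family of plane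
vectors: on every flat the vectors have sum zero or are all proportional. -/
structure IsBParallel {R : Type*} [CommRing R] {n : ℕ} (v : BIdx n → R × R) : Prop where
  coord_edge : ∀ i a b ε, i ≠ a → i ≠ b → a ≠ b → pdet (v (hC i)) (v (edge a b ε)) = 0
  edge_edge : ∀ i j a b ε δ, i ≠ j → a ≠ b → i ≠ a → i ≠ b → j ≠ a → j ≠ b →
    pdet (v (edge i j ε)) (v (edge a b δ)) = 0
  plane_coord : ∀ i j, i ≠ j → pdet (v (hC i))
    (v (hC i) + v (hC j) + v (edge i j 1) + v (edge i j (-1))) = 0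
  plane_edge : ∀ i j ε, i ≠ j → pdet (v (edge i j ε))
    (v (hC i) + v (hC j) + v (edge i j 1) + v (edge i j (-1))) = 0
  triangle : ∀ i j l ε δ, i ≠ j → i ≠ l → j ≠ l → pdet (v (edge i j ε))
    (v (edge i j ε) + v (edge j l δ) + v (edge i l (-(ε * δ)))) = 0

section LocalConditions

variable {k : Type*} [Field k] {n : ℕ}

lemma neg_mul_neg_mul_self (ε δ : ℤˣ) : -(-(ε * δ) * δ) = ε := by
  simp [mul_assoc, Int.units_mul_self]

lemma neg_mul_self_neg_mul (ε δ : ℤˣ) : -(ε * -(ε * δ)) = δ := by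
  simp [← mul_assoc, Int.units_mul_self]

lemma flatClosure_hC_hC {i j : Fin n} (hij : i ≠ j) :
    flatClosure (arrB n) (hC i) (hC j) = {hC i, hC j, edge i j 1, edge i j (-1)} := by
  ext h
  simp [mem_flatClosure_hC_hC hij]

lemma flatClosure_hC_edge {i a b : Fin n} (ε : ℤˣ) (hia : i ≠ a) (hib : i ≠ b) (hab : a ≠ b) :
    flatClosure (arrB n) (hC i) (edge a b ε) = {hC i, edge a b ε} := by
  ext h
  simp [mem_flatClosure_hC_edge hia hib hab]

lemma flatClosure_edge_edge {i j a b : Fin n} (ε δ : ℤˣ) (hij : i ≠ j) (hab : a ≠ b)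
    (hia : i ≠ a) (hib : i ≠ b) (hja : j ≠ a) (hjb : j ≠ b) :
    flatClosure (arrB n) (edge i j ε) (edge a b δ) = {edge i j ε, edge a b δ} := by
  ext h
  simp [mem_flatClosure_edge_edge hij hab hia hib hja hjb]

lemma flatClosure_triangle {i j l : Fin n} (ε δ : ℤˣ) (hij : i ≠ j) (hil : i ≠ l)
    (hjl : j ≠ l) : flatClosure (arrB n) (edge i j ε) (edge j l δ) =
      {edge i j ε, edge j l δ, edge i l (-(ε * δ))} := by
  ext h
  simp [mem_flatClosure_triangle hij hil hjl]

lemma sum_plane {M : Type*} [AddCommMonoid M] (w : BIdx n → M) {i j : Fin n} (hij : i ≠ j) :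
    ∑ h ∈ ({hC i, hC j, edge i j 1, edge i j (-1)} : Finset (BIdx n)), w h =
      w (hC i) + w (hC j) + w (edge i j 1) + w (edge i j (-1)) := by
  have h1 : edge i j 1 ≠ edge i j (-1) := by simp [edge_inj hij hij]
  rw [Finset.sum_insert, Finset.sum_insert, Finset.sum_pair h1, ← add_assoc, ← add_assoc]
  · simp [(edge_ne_hC hij _ _).symm]
  · simp [(edge_ne_hC hij _ _).symm, hij]

lemma sum_triangle {M : Type*} [AddCommMonoid M] (w : BIdx n → M) {i j l : Fin n} (ε δ : ℤˣ)
    (hij : i ≠ j) (hil : i ≠ l) (hjl : j ≠ l) :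
    ∑ h ∈ ({edge i j ε, edge j l δ, edge i l (-(ε * δ))} : Finset (BIdx n)), w h =
      w (edge i j ε) + w (edge j l δ) + w (edge i l (-(ε * δ))) := by
  have h1 : edge j l δ ≠ edge i l (-(ε * δ)) := by
    rw [ne_eq, edge_inj hjl hil]; grind
  rw [Finset.sum_insert, Finset.sum_pair h1, ← add_assoc]
  simp only [Finset.mem_insert, Finset.mem_singleton, edge_inj hij hjl, edge_inj hij hil]
  grind

lemma pdet_sum_iff (u b : BIdx n → k) (F : Finset (BIdx n)) (h : BIdx n) :
    pdet (u h, b h) (∑ i ∈ F, (u i, b i)) = 0 ↔ b h * ∑ i ∈ F, u i = u h * ∑ i ∈ F, b i := by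
  simp only [pdet, Prod.fst_sum, Prod.snd_sum]
  rw [sub_eq_zero, eq_comm]

/-- Two hyperplanes of type B span a generic pair, a balanced triangle or a plane
`x_i = x_j = 0`, so the local conditions are those listed in `IsBParallel`. -/
lemma isLocallyParallel_arrB_iff (u b : BIdx n → k) :
    IsLocallyParallel (arrB n) u b ↔ IsBParallel (fun h => (u h, b h)) := by
  have hred : IsLocallyParallel (arrB n) u b ↔ ∀ p q, p ≠ q → ∀ h ∈ flatClosure (arrB n) p q,
      pdet (u h, b h) (∑ i ∈ flatClosure (arrB n) p q, (u i, b i)) = 0 := by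
    simp only [pdet_sum_iff]
    rfl
  rw [hred]
  constructor
  · intro h
    refine ⟨?_, ?_, ?_, ?_, ?_⟩
    · intro i a c ε hia hic hac
      have := h (hC i) (edge a c ε) (edge_ne_hC hac _ _).symm (hC i) (left_mem_flatClosure _ _)
      rw [flatClosure_hC_edge ε hia hic hac, Finset.sum_pair (edge_ne_hC hac _ _).symm,
        pdet_add_right, pdet_self, zero_add] at this
      exact this
    · intro i j a c ε δ hij hac hia hic hja hjc
      have hne : edge i j ε ≠ edge a c δ := by rw [ne_eq, edge_inj hij hac]; grind
      have := h _ _ hne _ (left_mem_flatClosure _ _)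
      rw [flatClosure_edge_edge ε δ hij hac hia hic hja hjc, Finset.sum_pair hne, pdet_add_right,
        pdet_self, zero_add] at this
      exact this
    · intro i j hij
      have := h (hC i) (hC j) (by simpa using hij) _ (left_mem_flatClosure _ _)
      rwa [flatClosure_hC_hC hij, sum_plane _ hij] at this
    · intro i j ε hij
      have := h (hC i) (hC j) (by simpa using hij) (edge i j ε)
        ((mem_flatClosure_hC_hC hij _).2 (by
          rcases Int.units_eq_one_or ε with rfl | rfl <;> simp))
      rwa [flatClosure_hC_hC hij, sum_plane _ hij] at this
    · intro i j l ε δ hij hil hjl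
      have hne : edge i j ε ≠ edge j l δ := by rw [ne_eq, edge_inj hij hjl]; grind
      have := h _ _ hne _ (left_mem_flatClosure _ _)
      rwa [flatClosure_triangle ε δ hij hil hjl, sum_triangle _ ε δ hij hil hjl] at this
  · intro hv
    have hplane : ∀ i j, i ≠ j → ∀ h ∈ flatClosure (arrB n) (hC i) (hC j),
        pdet (u h, b h) (∑ i ∈ flatClosure (arrB n) (hC i) (hC j), (u i, b i)) = 0 := by
      intro i j hij h hh
      rw [flatClosure_hC_hC hij, sum_plane _ hij]
      rcases (mem_flatClosure_hC_hC hij h).1 hh with rfl | rfl | rfl | rfl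
      · exact hv.plane_coord i j hij
      · have := hv.plane_coord j i hij.symm
        rwa [edge_comm j i, edge_comm j i, add_comm (u (hC j), b (hC j))] at this
      · exact hv.plane_edge i j 1 hij
      · exact hv.plane_edge i j (-1) hij
    have htri : ∀ i j l ε δ, i ≠ j → i ≠ l → j ≠ l →
        ∀ h ∈ flatClosure (arrB n) (edge i j ε) (edge j l δ), pdet (u h, b h)
          (∑ i ∈ flatClosure (arrB n) (edge i j ε) (edge j l δ), (u i, b i)) = 0 := by
      intro i j l ε δ hij hil hjl h hh
      rw [flatClosure_triangle ε δ hij hil hjl, sum_triangle _ ε δ hij hil hjl]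
      rcases (mem_flatClosure_triangle hij hil hjl h).1 hh with rfl | rfl | rfl
      · exact hv.triangle i j l ε δ hij hil hjl
      · have := hv.triangle l j i δ ε hjl.symm hil.symm hij.symm
        rwa [edge_comm l j, edge_comm j i, edge_comm l i, mul_comm δ,
          add_comm (u (edge j l δ), b (edge j l δ))] at this
      · have := hv.triangle i l j (-(ε * δ)) δ hil hij hjl.symm
        rw [edge_comm l j, neg_mul_neg_mul_self] at this
        convert this using 2
        abel
    have hpair : ∀ p q : BIdx n, p ≠ q → flatClosure (arrB n) p q = {p, q} →
        pdet (u p, b p) (u q, b q) = 0 → ∀ h ∈ flatClosure (arrB n) p q,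
        pdet (u h, b h) (∑ i ∈ flatClosure (arrB n) p q, (u i, b i)) = 0 := by
      intro p q hpq hF h0 h hh
      rw [hF, Finset.sum_pair hpq]
      rw [hF, Finset.mem_insert, Finset.mem_singleton] at hh
      rcases hh with rfl | rfl
      · rw [pdet_add_right, h0, pdet_self, add_zero]
      · rw [pdet_add_right, pdet_eq_zero_comm.1 h0, pdet_self, add_zero]
    have hce : ∀ i a c ε, a ≠ c → ∀ h ∈ flatClosure (arrB n) (hC i) (edge a c ε), pdet (u h, b h)
        (∑ x ∈ flatClosure (arrB n) (hC i) (edge a c ε), (u x, b x)) = 0 := by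
      intro i a c ε hac
      have hin : ∀ i j : Fin n, ∀ ε, i ≠ j →
          flatClosure (arrB n) (hC i) (edge i j ε) = flatClosure (arrB n) (hC i) (hC j) := by
        intro i j ε hij
        apply flatClosure_eq_of_mem (isSimpleArr_arrB n) (edge_ne_hC hij _ _).symm
          (left_mem_flatClosure _ _)
        rw [mem_flatClosure_hC_hC hij]
        rcases Int.units_eq_one_or ε with rfl | rfl <;> simp
      by_cases hia : i = a
      · subst hia
        rw [hin _ _ _ hac]
        exact hplane _ _ hac
      by_cases hic : i = c
      · subst hic
        rw [edge_comm, hin _ _ _ hac.symm]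
        exact hplane _ _ hac.symm
      exact hpair _ _ (edge_ne_hC hac _ _).symm (flatClosure_hC_edge ε hia hic hac)
        (hv.coord_edge i a c ε hia hic hac)
    have hcomm : ∀ p q, flatClosure (arrB n) p q = flatClosure (arrB n) q p := by
      intro p q
      ext h
      rw [mem_flatClosure, mem_flatClosure, Set.pair_comm]
    intro p q hpq
    induction p using BIdx.cases_edge with
    | h1 i =>
      induction q using BIdx.cases_edge with
      | h1 j => exact hplane i j (fun e => hpq (e ▸ rfl))
      | h2 a c ε hac => exact hce i a c ε hac
    | h2 i j ε hij =>
      induction q using BIdx.cases_edge with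
      | h1 m =>
        rw [hcomm]
        exact hce m i j ε hij
      | h2 a c δ hac =>
        by_cases hja : j = a
        · subst hja
          by_cases hic : i = c
          · subst hic
            have hεδ : ε ≠ δ := fun e => hpq (by rw [e, edge_comm])
            have hF : flatClosure (arrB n) (edge i j ε) (edge j i δ) =
                flatClosure (arrB n) (hC i) (hC j) := by
              have hmem : ∀ ε, edge i j ε ∈ flatClosure (arrB n) (hC i) (hC j) := fun ε => by
                rw [mem_flatClosure_hC_hC hij]
                rcases Int.units_eq_one_or ε with rfl | rfl <;> simp
              rw [edge_comm j i] at hpq ⊢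
              exact flatClosure_eq_of_mem (isSimpleArr_arrB n) hpq (hmem ε) (hmem δ)
            rw [hF]
            exact hplane i j hij
          · exact htri i j c ε δ hij hic hac
        by_cases hjc : j = c
        · subst hjc
          rw [edge_comm a j]
          by_cases hia : i = a
          · subst hia
            have hF : flatClosure (arrB n) (edge i j ε) (edge j i δ) =
                flatClosure (arrB n) (hC i) (hC j) := by
              have hmem : ∀ ε, edge i j ε ∈ flatClosure (arrB n) (hC i) (hC j) := fun ε => by
                rw [mem_flatClosure_hC_hC hij]
                rcases Int.units_eq_one_or ε with rfl | rfl <;> simp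
              rw [edge_comm j i]
              exact flatClosure_eq_of_mem (isSimpleArr_arrB n) hpq (hmem ε) (hmem δ)
            rw [hF]
            exact hplane i j hij
          · exact htri i j a ε δ hij hia hja
        by_cases hia : i = a
        · subst hia
          rw [edge_comm i j]
          exact htri j i c ε δ hij.symm hjc hac
        by_cases hic : i = c
        · subst hic
          rw [edge_comm i j, edge_comm a i]
          exact htri j i a ε δ hij.symm hja hia
        exact hpair _ _ hpq (flatClosure_edge_edge ε δ hij hac hia hic hja hjc)
          (hv.edge_edge i j a c ε δ hij hac hia hic hja hjc)

end LocalConditions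

/-! ### The support of a pencil of resonant vectors -/

section Support

variable {k : Type*} [Field k] {n : ℕ} {v : BIdx n → k × k}

namespace IsBParallel

lemma plane_dichotomy (hv : IsBParallel v) {i j : Fin n} (hij : i ≠ j) :
    v (hC i) + v (hC j) + v (edge i j 1) + v (edge i j (-1)) = 0 ∨
      (pdet (v (hC i)) (v (hC j)) = 0 ∧ (∀ ε, pdet (v (hC i)) (v (edge i j ε)) = 0) ∧
        (∀ ε, pdet (v (hC j)) (v (edge i j ε)) = 0) ∧
        pdet (v (edge i j 1)) (v (edge i j (-1))) = 0) := by
  refine or_iff_not_imp_left.2 fun hs => ?_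
  have h1 := pdet_eq_zero_comm.1 (hv.plane_coord i j hij)
  have h2 := pdet_eq_zero_comm.1 (hv.plane_coord j i hij.symm)
  rw [edge_comm j i, edge_comm j i, add_comm (v (hC j))] at h2
  have h3 := fun ε => pdet_eq_zero_comm.1 (hv.plane_edge i j ε hij)
  exact ⟨pdet_eq_zero_trans hs h1 h2, fun ε => pdet_eq_zero_trans hs h1 (h3 ε),
    fun ε => pdet_eq_zero_trans hs h2 (h3 ε), pdet_eq_zero_trans hs (h3 _) (h3 _)⟩

lemma triangle_dichotomy (hv : IsBParallel v) {i j l : Fin n} (ε δ : ℤˣ) (hij : i ≠ j)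
    (hil : i ≠ l) (hjl : j ≠ l) :
    v (edge i j ε) + v (edge j l δ) + v (edge i l (-(ε * δ))) = 0 ∨
      (pdet (v (edge i j ε)) (v (edge j l δ)) = 0 ∧
        pdet (v (edge i j ε)) (v (edge i l (-(ε * δ)))) = 0 ∧
        pdet (v (edge j l δ)) (v (edge i l (-(ε * δ)))) = 0) := by
  refine or_iff_not_imp_left.2 fun hs => ?_
  have h1 := pdet_eq_zero_comm.1 (hv.triangle i j l ε δ hij hil hjl)
  have h2 := pdet_eq_zero_comm.1 (hv.triangle l j i δ ε hjl.symm hil.symm hij.symm)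
  have h3 := pdet_eq_zero_comm.1 (hv.triangle i l j (-(ε * δ)) δ hil hij hjl.symm)
  rw [edge_comm l j, edge_comm j i, edge_comm l i, mul_comm δ, add_comm (v (edge j l δ))] at h2
  rw [edge_comm l j, neg_mul_neg_mul_self, add_right_comm, add_comm (v (edge i l _)),
    add_right_comm] at h3
  rw [add_right_comm] at h3
  have h3' : pdet (v (edge i j ε) + v (edge j l δ) + v (edge i l (-(ε * δ))))
      (v (edge i l (-(ε * δ)))) = 0 := by
    rw [← h3]; congr 1; abel
  exact ⟨pdet_eq_zero_trans hs h1 h2, pdet_eq_zero_trans hs h1 h3', pdet_eq_zero_trans hs h2 h3'⟩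

end IsBParallel

/-- The vectors `v` vanish on all hyperplanes whose equation involves a coordinate outside `S`. -/
def SupportedOn {M : Type*} [Zero M] (v : BIdx n → M) (S : Finset (Fin n)) : Prop :=
  (∀ m ∉ S, v (hC m) = 0) ∧ ∀ a b ε, a ≠ b → a ∉ S → v (edge a b ε) = 0

/-- If the pencil is not parallel on the coordinate hyperplanes, it is supported on two or three
coordinates. -/
lemma exists_supportedOn_of_coord (hv : IsBParallel v) {i j : Fin n}
    (h : pdet (v (hC i)) (v (hC j)) ≠ 0) :
    ∃ S : Finset (Fin n), SupportedOn v S ∧ (S.card = 2 ∨ S.card = 3 ∧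
      ∀ a ∈ S, ∀ b ∈ S, a ≠ b → pdet (v (hC a)) (v (hC b)) ≠ 0) := by
  have hij : i ≠ j := by
    rintro rfl
    simp at h
  have hout : ∀ a b ε, a ≠ b → a ≠ i → a ≠ j → b ≠ i → b ≠ j → v (edge a b ε) = 0 :=
    fun a b ε hab hai haj hbi hbj => eq_zero_of_pdet h
      (hv.coord_edge i a b ε hai.symm hbi.symm hab) (hv.coord_edge j a b ε haj.symm hbj.symm hab)
  have hzero : ∀ a b, pdet (v (hC a)) (v (hC b)) ≠ 0 → ∀ l, l ≠ a → l ≠ b → v (hC l) = 0 →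
      ∀ ε, v (edge a l ε) = 0 := by
    intro a b hab l hla hlb hl ε
    have hne : b ≠ a := by
      rintro rfl
      simp at hab
    have hb : ∀ ε, pdet (v (hC b)) (v (edge a l ε)) = 0 := fun ε =>
      hv.coord_edge b a l ε hne hlb.symm hla.symm
    rcases hv.plane_dichotomy hla.symm with hs | hs
    · exfalso
      have := congrArg (pdet (v (hC b))) hs
      simp only [pdet_add_right, hl, hb, pdet_zero_right, add_zero] at this
      exact pdet_ne_zero_comm.1 hab this
    · exact eq_zero_of_pdet hab (hs.2.1 ε) (hb ε)
  have hthird : ∀ a b d, d ≠ a → d ≠ b → pdet (v (hC a)) (v (hC b)) ≠ 0 → v (hC d) ≠ 0 →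
      pdet (v (hC d)) (v (hC a)) ≠ 0 := by
    intro a b d hda hdb hab hd hcon
    have hne : a ≠ b := by
      rintro rfl
      simp at hab
    have he : ∀ ε, pdet (v (hC a)) (v (edge a b ε)) = 0 := fun ε =>
      pdet_eq_zero_trans hd hcon (hv.coord_edge d a b ε hda hdb hne)
    rcases hv.plane_dichotomy hne with hs | hs
    · have := congrArg (pdet (v (hC a))) hs
      simp only [pdet_add_right, he, pdet_zero_right, add_zero, pdet_self, zero_add] at this
      exact hab this
    · exact hab hs.1
  have h' := pdet_ne_zero_comm.1 h
  by_cases hk : ∃ l, l ≠ i ∧ l ≠ j ∧ v (hC l) ≠ 0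
  swap
  · push Not at hk
    refine ⟨{i, j}, ⟨fun m hm => ?_, fun a b ε hab ha => ?_⟩, Or.inl (Finset.card_pair hij)⟩
    · simp only [Finset.mem_insert, Finset.mem_singleton, not_or] at hm
      exact hk m hm.1 hm.2
    · simp only [Finset.mem_insert, Finset.mem_singleton, not_or] at ha
      by_cases hbi : b = i
      · rw [hbi, edge_comm]
        exact hzero i j h a ha.1 ha.2 (hk a ha.1 ha.2) ε
      by_cases hbj : b = j
      · rw [hbj, edge_comm]
        exact hzero j i h' a ha.2 ha.1 (hk a ha.1 ha.2) ε
      exact hout a b ε hab ha.1 ha.2 hbi hbj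
  obtain ⟨l, hli, hlj, hl⟩ := hk
  have h1 := hthird i j l hli hlj h hl
  have h2 := hthird j i l hlj hli h' hl
  have h1' := pdet_ne_zero_comm.1 h1
  have h2' := pdet_ne_zero_comm.1 h2
  have hm : ∀ m, m ≠ i → m ≠ j → m ≠ l → v (hC m) = 0 := by
    intro m hmi hmj hml
    by_contra hm
    have h3 := hthird l i m hml hmi h1 hm
    have he : ∀ ε, v (edge i j ε) = 0 := fun ε => eq_zero_of_pdet h3
      (hv.coord_edge m i j ε hmi hmj hij) (hv.coord_edge l i j ε hli hlj hij)
    rcases hv.plane_dichotomy hij with hs | hs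
    · have := congrArg (pdet (v (hC i))) hs
      simp only [pdet_add_right, he, pdet_zero_right, add_zero, pdet_self, zero_add] at this
      exact h this
    · exact h hs.1
  refine ⟨{i, j, l}, ⟨fun m hm' => ?_, fun a b ε hab ha => ?_⟩, Or.inr ⟨?_, ?_⟩⟩
  · simp only [Finset.mem_insert, Finset.mem_singleton, not_or] at hm'
    exact hm m hm'.1 hm'.2.1 hm'.2.2
  · simp only [Finset.mem_insert, Finset.mem_singleton, not_or] at ha
    obtain ⟨hai, haj, hal⟩ := ha
    by_cases hbi : b = i
    · rw [hbi, edge_comm]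
      exact hzero i j h a hai haj (hm a hai haj hal) ε
    by_cases hbj : b = j
    · rw [hbj, edge_comm]
      exact hzero j i h' a haj hai (hm a hai haj hal) ε
    exact hout a b ε hab hai haj hbi hbj
  · exact Finset.card_eq_three.2 ⟨i, j, l, hij, hli.symm, hlj.symm, rfl⟩
  · simp only [Finset.mem_insert, Finset.mem_singleton]
    rintro a (rfl | rfl | rfl) b (rfl | rfl | rfl) hab
    all_goals first | assumption | exact absurd rfl hab

/-- The case of a pencil that is parallel, but not zero, on the coordinate hyperplanes. -/
lemma exists_supportedOn_of_coord_parallel (hv : IsBParallel v)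
    (hnd : ∃ p q, pdet (v p) (v q) ≠ 0) (hpar : ∀ a b, pdet (v (hC a)) (v (hC b)) = 0)
    {i : Fin n} (hi : v (hC i) ≠ 0) :
    ∃ S : Finset (Fin n), SupportedOn v S ∧ (S.card = 2 ∨ S.card = 3 ∧
      ∃ i ∈ S, ∀ a ∈ S, a ≠ i →
        v (hC a) = 0 ∧ ∃ ε, pdet (v (hC i)) (v (edge i a ε)) ≠ 0) := by
  obtain ⟨j, hij, ε, hE⟩ : ∃ j, i ≠ j ∧ ∃ ε, pdet (v (hC i)) (v (edge i j ε)) ≠ 0 := by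
    by_contra! hcon
    have hall : ∀ p, pdet (v (hC i)) (v p) = 0 := by
      intro p
      induction p using BIdx.cases_edge with
      | h1 m => exact hpar i m
      | h2 a b ε hab =>
        by_cases hia : i = a
        · subst hia
          exact hcon b hab ε
        by_cases hib : i = b
        · subst hib
          rw [edge_comm]
          exact hcon a hia ε
        exact hv.coord_edge i a b ε hia hib hab
    obtain ⟨p, q, hpq⟩ := hnd
    exact hpq (pdet_eq_zero_trans hi (hall p) (hall q))
  -- vanishing far away from an edge at `i` that is not parallel to `v (hC i)`
  have hcoord : ∀ j ε, i ≠ j → pdet (v (hC i)) (v (edge i j ε)) ≠ 0 →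
      ∀ m, m ≠ i → m ≠ j → v (hC m) = 0 := fun j ε hij hE m hmi hmj =>
    eq_zero_of_pdet hE (hpar i m) (pdet_eq_zero_comm.1 (hv.coord_edge m i j ε hmi hmj hij))
  have hfar : ∀ a b δ, a ≠ b → a ≠ i → a ≠ j → b ≠ i → b ≠ j → v (edge a b δ) = 0 :=
    fun a b δ hab hai haj hbi hbj => eq_zero_of_pdet hE
      (hv.coord_edge i a b δ hai.symm hbi.symm hab)
      (hv.edge_edge i j a b ε δ hij hab hai.symm hbi.symm haj.symm hbj.symm)
  have hnear : ∀ l, l ≠ i → l ≠ j → (∀ δ, pdet (v (hC i)) (v (edge i l δ)) = 0) →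
      ∀ δ, v (edge i l δ) = 0 ∧ v (edge j l δ) = 0 := by
    intro l hli hlj hl
    have hz : ∀ δ, pdet (v (hC i)) (v (edge j l δ)) = 0 := fun δ =>
      hv.coord_edge i j l δ hij hli.symm hlj.symm
    have hboth : ∀ δ, v (edge i l δ) = 0 ∧ v (edge j l (-(ε * δ))) = 0 := by
      intro δ
      rcases hv.triangle_dichotomy ε δ hij.symm hlj.symm hli.symm with hs | hs
      · have := congrArg (pdet (v (hC i))) hs
        simp only [pdet_add_right, hl, hz, pdet_zero_right, add_zero, edge_comm j i] at this
        exact absurd this hE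
      · rw [edge_comm j i] at hs
        exact ⟨eq_zero_of_pdet hE (hl δ) hs.1, eq_zero_of_pdet hE (hz _) hs.2.1⟩
    intro δ
    refine ⟨(hboth δ).1, ?_⟩
    have := (hboth (-(ε * δ))).2
    rwa [neg_mul_self_neg_mul] at this
  by_cases hl : ∃ l, l ≠ i ∧ l ≠ j ∧ ∃ δ, pdet (v (hC i)) (v (edge i l δ)) ≠ 0
  swap
  · push Not at hl
    refine ⟨{i, j}, ⟨fun m hm => ?_, fun a b δ hab ha => ?_⟩, Or.inl (Finset.card_pair hij)⟩
    · simp only [Finset.mem_insert, Finset.mem_singleton, not_or] at hm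
      exact hcoord j ε hij hE m hm.1 hm.2
    · simp only [Finset.mem_insert, Finset.mem_singleton, not_or] at ha
      have h0 := hnear a ha.1 ha.2 (hl a ha.1 ha.2) δ
      by_cases hbi : b = i
      · rw [hbi, edge_comm]
        exact h0.1
      by_cases hbj : b = j
      · rw [hbj, edge_comm]
        exact h0.2
      exact hfar a b δ hab ha.1 ha.2 hbi hbj
  obtain ⟨l, hli, hlj, δ, hD⟩ := hl
  have hj0 : v (hC j) = 0 := hcoord l δ hli.symm hD j hij.symm hlj.symm
  have hl0 : v (hC l) = 0 := hcoord j ε hij hE l hli hlj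
  have hjm : ∀ m γ, m ≠ i → m ≠ j → m ≠ l → v (edge j m γ) = 0 := fun m γ hmi hmj hml =>
    eq_zero_of_pdet hD (hv.coord_edge i j m γ hij hmi.symm hmj.symm)
      (hv.edge_edge i l j m δ γ hli.symm hmj.symm hij hmi.symm hlj hml.symm)
  have him : ∀ m γ, m ≠ i → m ≠ j → m ≠ l → v (edge i m γ) = 0 := by
    intro m γ hmi hmj hml
    have hpar' : ∀ β, pdet (v (edge i j β)) (v (edge i m γ)) = 0 := by
      intro β
      rcases hv.triangle_dichotomy β γ hij.symm hmj.symm hmi.symm with hs | hs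
      · rw [hjm m _ hmi hmj hml, add_zero, edge_comm j i] at hs
        rw [eq_neg_of_add_eq_zero_left hs]
        simp
      · rw [edge_comm j i] at hs
        exact hs.1
    rcases hv.plane_dichotomy hij with hs | hs
    · have := congrArg (fun x => pdet x (v (edge i m γ))) hs
      simp only [pdet_add_left, hj0, hpar', pdet_zero_left, add_zero] at this
      exact eq_zero_of_pdet hE this (hpar' ε)
    · exact absurd (hs.2.1 ε) hE
  refine ⟨{i, j, l}, ⟨fun m hm => ?_, fun a b γ hab ha => ?_⟩, Or.inr ⟨?_, i, by simp, ?_⟩⟩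
  · simp only [Finset.mem_insert, Finset.mem_singleton, not_or] at hm
    exact hcoord j ε hij hE m hm.1 hm.2.1
  · simp only [Finset.mem_insert, Finset.mem_singleton, not_or] at ha
    obtain ⟨hai, haj, hal⟩ := ha
    by_cases hbi : b = i
    · rw [hbi, edge_comm]
      exact him a γ hai haj hal
    by_cases hbj : b = j
    · rw [hbj, edge_comm]
      exact hjm a γ hai haj hal
    exact hfar a b γ hab hai haj hbi hbj
  · exact Finset.card_eq_three.2 ⟨i, j, l, hij, hli.symm, hlj.symm, rfl⟩
  · simp only [Finset.mem_insert, Finset.mem_singleton]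
    rintro a (rfl | rfl | rfl) hai
    · exact absurd rfl hai
    · exact ⟨hj0, ε, hE⟩
    · exact ⟨hl0, δ, hD⟩

/-- Some edges `i j` and `i l` carry non-parallel vectors. -/
def Spread (v : BIdx n → k × k) (i j l : Fin n) : Prop :=
  ∃ ε δ, pdet (v (edge i j ε)) (v (edge i l δ)) ≠ 0

lemma Spread.symm {i j l : Fin n} (h : Spread v i j l) : Spread v i l j := by
  obtain ⟨ε, δ, h⟩ := h
  exact ⟨δ, ε, pdet_ne_zero_comm.1 h⟩

/-- The edge closing a balanced triangle with two non-parallel edges is minus their sum. -/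
lemma closing_edge (hv : IsBParallel v) {i j l : Fin n} (hij : i ≠ j) (hil : i ≠ l) (hjl : j ≠ l)
    {ε δ : ℤˣ} (h : pdet (v (edge i j ε)) (v (edge i l δ)) ≠ 0) :
    v (edge j l (-(ε * δ))) = -(v (edge i j ε) + v (edge i l δ)) := by
  rcases hv.triangle_dichotomy ε δ hij.symm hjl hil with hs | hs
  · rw [edge_comm j i] at hs
    exact eq_neg_of_add_eq_zero_right hs
  · rw [edge_comm j i] at hs
    exact absurd hs.1 h

lemma Spread.rotate (hv : IsBParallel v) {i j l : Fin n} (hij : i ≠ j) (hil : i ≠ l)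
    (hjl : j ≠ l) (h : Spread v i j l) : Spread v j i l := by
  obtain ⟨ε, δ, h⟩ := h
  refine ⟨ε, -(ε * δ), ?_⟩
  rw [closing_edge hv hij hil hjl h, edge_comm j i]
  simpa using h

lemma Spread.all (hv : IsBParallel v) {i j l : Fin n} (hij : i ≠ j) (hil : i ≠ l)
    (hjl : j ≠ l) (h : Spread v i j l) : Spread v i j l ∧ Spread v i l j ∧ Spread v j i l ∧
      Spread v j l i ∧ Spread v l i j ∧ Spread v l j i := by
  have h1 := h.rotate hv hij hil hjl
  have h2 := h.symm.rotate hv hil hij hjl.symm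
  exact ⟨h, h.symm, h1, h1.symm, h2, h2.symm⟩

lemma Spread.extend (hv : IsBParallel v) {i j l m : Fin n} (hij : i ≠ j) (hil : i ≠ l)
    (hjl : j ≠ l) (hmi : m ≠ i) (hmj : m ≠ j) (hml : m ≠ l) (h : Spread v i j l)
    {γ : ℤˣ} (hm : v (edge i m γ) ≠ 0) : Spread v i j m := by
  obtain ⟨ε, δ, h⟩ := h.rotate hv hij hil hjl
  refine ⟨ε, γ, fun hcon => h ?_⟩
  rw [edge_comm j i]
  exact pdet_eq_zero_trans hm (pdet_eq_zero_comm.1 hcon)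
    (hv.edge_edge i m j l γ δ hmi.symm hjl hij hil hmj hml)

/-- On four coordinates the pencil is spread on every triple as soon as this holds for one triple
and one edge to the fourth coordinate is nonzero. -/
lemma Spread.extend_all (hv : IsBParallel v) {i j l m : Fin n} (hij : i ≠ j) (hil : i ≠ l)
    (hjl : j ≠ l) (hmi : m ≠ i) (hmj : m ≠ j) (hml : m ≠ l) (h : Spread v i j l)
    {γ : ℤˣ} (hm : v (edge i m γ) ≠ 0) :
    Spread v i j m ∧ Spread v i l m ∧ Spread v j l m := by
  have h1 := h.extend hv hij hil hjl hmi hmj hml hm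
  refine ⟨h1, h.symm.extend hv hil hij hjl.symm hmi hml hmj hm, ?_⟩
  obtain ⟨ε, δ, hne⟩ := (h1.rotate hv hij hmi.symm hmj.symm).symm
  exact (h.rotate hv hij hil hjl).symm.extend hv hjl hij.symm hil.symm hmj hml hmi
    (left_ne_zero_of_pdet hne)

/-- The case of a pencil that vanishes on the coordinate hyperplanes. -/
lemma exists_supportedOn_of_coord_zero (hv : IsBParallel v)
    (hnd : ∃ p q, pdet (v p) (v q) ≠ 0) (h0 : ∀ m, v (hC m) = 0) :
    ∃ S : Finset (Fin n), SupportedOn v S ∧ (S.card = 3 ∨ S.card = 4) ∧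
      ∀ a ∈ S, ∀ b ∈ S, ∀ d ∈ S, a ≠ b → a ≠ d → b ≠ d → Spread v a b d := by
  have hself : ∀ i j ε δ, i ≠ j → pdet (v (edge i j ε)) (v (edge i j δ)) = 0 := by
    intro i j ε δ hij
    have h1 : pdet (v (edge i j 1)) (v (edge i j (-1))) = 0 := by
      have := hv.plane_edge i j 1 hij
      simpa [h0] using this
    rcases Int.units_eq_one_or ε with rfl | rfl <;> rcases Int.units_eq_one_or δ with rfl | rfl
    · simp
    · exact h1
    · exact pdet_eq_zero_comm.1 h1
    · simp
  obtain ⟨i, j, l, hij, hil, hjl, hT⟩ :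
      ∃ i j l, i ≠ j ∧ i ≠ l ∧ j ≠ l ∧ Spread v i j l := by
    obtain ⟨p, q, hpq⟩ := hnd
    induction p using BIdx.cases_edge with
    | h1 m => simp [h0] at hpq
    | h2 a b ε hab =>
      induction q using BIdx.cases_edge with
      | h1 m => simp [h0] at hpq
      | h2 c d δ hcd =>
        by_cases hac : a = c
        · subst hac
          refine ⟨a, b, d, hab, hcd, ?_, ε, δ, hpq⟩
          rintro rfl
          exact hpq (hself _ _ _ _ hab)
        by_cases had : a = d
        · subst had
          rw [edge_comm c a] at hpq
          refine ⟨a, b, c, hab, hcd.symm, ?_, ε, δ, hpq⟩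
          rintro rfl
          exact hpq (hself _ _ _ _ hab)
        by_cases hbc : b = c
        · subst hbc
          rw [edge_comm a b] at hpq
          exact ⟨b, a, d, hab.symm, hcd, had, ε, δ, hpq⟩
        by_cases hbd : b = d
        · subst hbd
          rw [edge_comm a b, edge_comm c b] at hpq
          exact ⟨b, a, c, hab.symm, hcd.symm, hac, ε, δ, hpq⟩
        exact absurd (hv.edge_edge a b c d ε δ hab hcd hac had hbc hbd) hpq
  have hfar : ∀ i j l, i ≠ j → i ≠ l → Spread v i j l → ∀ a b γ, a ≠ b → a ≠ i → a ≠ j →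
      a ≠ l → b ≠ i → b ≠ j → b ≠ l → v (edge a b γ) = 0 := by
    rintro i j l hij hil ⟨ε, δ, h⟩ a b γ hab hai haj hal hbi hbj hbl
    exact eq_zero_of_pdet h
      (hv.edge_edge i j a b ε γ hij hab hai.symm hbi.symm haj.symm hbj.symm)
      (hv.edge_edge i l a b δ γ hil hab hai.symm hbi.symm hal.symm hbl.symm)
  have hTall := hT.all hv hij hil hjl
  by_cases hm : ∃ m, m ≠ i ∧ m ≠ j ∧ m ≠ l ∧
      ∃ γ, v (edge i m γ) ≠ 0 ∨ v (edge j m γ) ≠ 0 ∨ v (edge l m γ) ≠ 0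
  swap
  · push Not at hm
    refine ⟨{i, j, l}, ⟨fun m _ => h0 m, fun a b γ hab ha => ?_⟩, Or.inl ?_, ?_⟩
    · simp only [Finset.mem_insert, Finset.mem_singleton, not_or] at ha
      obtain ⟨hai, haj, hal⟩ := ha
      have h3 := hm a hai haj hal γ
      rw [edge_comm i, edge_comm j, edge_comm l] at h3
      by_cases hbi : b = i
      · rw [hbi]; exact h3.1
      by_cases hbj : b = j
      · rw [hbj]; exact h3.2.1
      by_cases hbl : b = l
      · rw [hbl]; exact h3.2.2
      exact hfar i j l hij hil hT a b γ hab hai haj hal hbi hbj hbl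
    · exact Finset.card_eq_three.2 ⟨i, j, l, hij, hil, hjl, rfl⟩
    · simp only [Finset.mem_insert, Finset.mem_singleton]
      obtain ⟨t1, t2, t3, t4, t5, t6⟩ := hTall
      rintro a (rfl | rfl | rfl) b (rfl | rfl | rfl) d (rfl | rfl | rfl) hab had hbd
      all_goals first | assumption | contradiction
  obtain ⟨m, hmi, hmj, hml, γ, hγ⟩ := hm
  obtain ⟨e1, e2, e3⟩ : Spread v i j m ∧ Spread v i l m ∧ Spread v j l m := by
    rcases hγ with hγ | hγ | hγ
    · exact hT.extend_all hv hij hil hjl hmi hmj hml hγ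
    · obtain ⟨e1, e2, e3⟩ :=
        hTall.2.2.1.extend_all hv hij.symm hjl hil hmj hmi hml hγ
      exact ⟨e1.rotate hv hij.symm hmj.symm hmi.symm, e3, e2⟩
    · obtain ⟨e1, e2, e3⟩ :=
        hTall.2.2.2.2.1.extend_all hv hil.symm hjl.symm hij hml hmi hmj hγ
      exact ⟨e3, e1.rotate hv hil.symm hml.symm hmi.symm, e2.rotate hv hjl.symm hml.symm hmj.symm⟩
  refine ⟨{i, j, l, m}, ⟨fun m _ => h0 m, fun a b γ hab ha => ?_⟩, Or.inr ?_, ?_⟩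
  · simp only [Finset.mem_insert, Finset.mem_singleton, not_or] at ha
    obtain ⟨hai, haj, hal, ham⟩ := ha
    by_cases hbi : b = i
    · subst hbi
      exact hfar j l m hjl hmj.symm e3 a b γ hab haj hal ham hij hil hmi.symm
    by_cases hbj : b = j
    · subst hbj
      exact hfar i l m hil hmi.symm e2 a b γ hab hai hal ham hbi hjl hmj.symm
    by_cases hbl : b = l
    · subst hbl
      exact hfar i j m hij hmi.symm e1 a b γ hab hai haj ham hbi hbj hml.symm
    exact hfar i j l hij hil hT a b γ hab hai haj hal hbi hbj hbl
  · rw [Finset.card_insert_of_notMem,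
      Finset.card_eq_three.2 ⟨j, l, m, hjl, hmj.symm, hml.symm, rfl⟩]
    simp [hij, hil, hmi.symm]
  · simp only [Finset.mem_insert, Finset.mem_singleton]
    obtain ⟨t1, t2, t3, t4, t5, t6⟩ := hTall
    obtain ⟨t11, t12, t13, t14, t15, t16⟩ := e1.all hv hij hmi.symm hmj.symm
    obtain ⟨t21, t22, t23, t24, t25, t26⟩ := e2.all hv hil hmi.symm hml.symm
    obtain ⟨t31, t32, t33, t34, t35, t36⟩ := e3.all hv hjl hmj.symm hml.symm
    rintro a (rfl | rfl | rfl | rfl) b (rfl | rfl | rfl | rfl) d (rfl | rfl | rfl | rfl) hab had hbd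
    all_goals first | assumption | contradiction

end Support

/-! ### The vectors of a pencil supported on three or four coordinates -/

section Values

variable {k : Type*} [Field k] {n : ℕ} {v : BIdx n → k × k}

/-- Coefficients of a balanced triangle on three vectors with sum zero. -/
lemma triangle_coeff {x y : k × k} (hxy : pdet x y ≠ 0) {a b c : k}
    (h : a • x + b • y + c • (-(x + y)) = 0 ∨
      (pdet (a • x) (b • y) = 0 ∧ pdet (a • x) (c • (-(x + y))) = 0 ∧
        pdet (b • y) (c • (-(x + y))) = 0)) :
    (a = b ∧ b = c) ∨ (a = 0 ∧ b = 0) ∨ (a = 0 ∧ c = 0) ∨ (b = 0 ∧ c = 0) := by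
  rcases h with h | ⟨h1, h2, h3⟩
  · have h1 := congrArg (pdet x) h
    have h2 := congrArg (fun z => pdet z y) h
    simp only [pdet_add_left, pdet_add_right, pdet_smul_left, pdet_smul_right, pdet_self,
      pdet_neg_left, pdet_neg_right, pdet_zero_left, pdet_zero_right] at h1 h2
    left
    constructor
    · have : (a - b) * pdet x y = 0 := by linear_combination h2 - h1
      simpa [hxy, sub_eq_zero] using this
    · have : (b - c) * pdet x y = 0 := by linear_combination h1
      simpa [hxy, sub_eq_zero] using this
  · have hyx := pdet_ne_zero_comm.1 hxy
    simp [hxy, hyx] at h1 h2 h3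
    tauto

/-- The coefficients of the edges of a three-coordinate pencil: each pair of opposite edges has
total coefficient one, and each of the four balanced triangles is constant or has at most one
nonzero coefficient. -/
lemma balanced_coeff [CharZero k] {x1 x2 y1 y2 z1 z2 : k} (hx : x1 + x2 = 1) (hy : y1 + y2 = 1)
    (hz : z1 + z2 = 1)
    (t1 : (z2 = y1 ∧ y1 = x1) ∨ (z2 = 0 ∧ y1 = 0) ∨ (z2 = 0 ∧ x1 = 0) ∨ (y1 = 0 ∧ x1 = 0))
    (t2 : (z1 = y2 ∧ y2 = x1) ∨ (z1 = 0 ∧ y2 = 0) ∨ (z1 = 0 ∧ x1 = 0) ∨ (y2 = 0 ∧ x1 = 0))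
    (t3 : (z1 = y1 ∧ y1 = x2) ∨ (z1 = 0 ∧ y1 = 0) ∨ (z1 = 0 ∧ x2 = 0) ∨ (y1 = 0 ∧ x2 = 0))
    (t4 : (z2 = y2 ∧ y2 = x2) ∨ (z2 = 0 ∧ y2 = 0) ∨ (z2 = 0 ∧ x2 = 0) ∨ (y2 = 0 ∧ x2 = 0)) :
    (x1 = 2⁻¹ ∧ x2 = 2⁻¹ ∧ y1 = 2⁻¹ ∧ y2 = 2⁻¹ ∧ z1 = 2⁻¹ ∧ z2 = 2⁻¹) ∨
      (x1 = 1 ∧ y1 = 1 ∧ z2 = 1 ∧ x2 = 0 ∧ y2 = 0 ∧ z1 = 0) ∨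
      (x1 = 1 ∧ y2 = 1 ∧ z1 = 1 ∧ x2 = 0 ∧ y1 = 0 ∧ z2 = 0) ∨
      (x2 = 1 ∧ y1 = 1 ∧ z1 = 1 ∧ x1 = 0 ∧ y2 = 0 ∧ z2 = 0) ∨
      (x2 = 1 ∧ y2 = 1 ∧ z2 = 1 ∧ x1 = 0 ∧ y1 = 0 ∧ z1 = 0) := by
  have h01 : (0 : k) ≠ 1 := zero_ne_one
  obtain rfl : x2 = 1 - x1 := by linear_combination hx
  obtain rfl : y2 = 1 - y1 := by linear_combination hy
  obtain rfl : z2 = 1 - z1 := by linear_combination hz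
  clear hx hy hz
  by_cases h1 : x1 = 0
  · subst h1
    grind
  by_cases h2 : 1 - x1 = 0
  · obtain rfl : x1 = 1 := by linear_combination -h2
    grind
  simp only [h1, h2, and_false, or_false] at t1 t2 t3 t4
  have hy1 : y1 ≠ 0 := by
    rintro rfl
    grind
  have hz1 : z1 ≠ 0 := by
    rintro rfl
    grind
  have e1 : y1 = x1 := by grind
  have e2 : z1 = y1 := by grind
  have e3 : y1 = 1 - x1 := by grind
  have e4 : x1 = 2⁻¹ := by
    refine eq_inv_of_mul_eq_one_left ?_
    linear_combination e3 - e1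
  subst e2
  subst e1
  left
  refine ⟨e4, ?_, e4, ?_, e4, ?_⟩ <;> rw [← e3, e4]

/-- On three coordinates that carry pairwise non-parallel vectors, the vectors on the coordinate
hyperplanes have sum zero, and the edges are either all halves of the opposite coordinate vector,
or carry this vector on one balanced triangle and vanish otherwise. -/
lemma values_of_coord [CharZero k] (hv : IsBParallel v) {i j l : Fin n} (hij : i ≠ j)
    (hil : i ≠ l) (hjl : j ≠ l) (h1 : pdet (v (hC i)) (v (hC j)) ≠ 0)
    (h2 : pdet (v (hC i)) (v (hC l)) ≠ 0) (h3 : pdet (v (hC j)) (v (hC l)) ≠ 0) :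
    v (hC l) = -(v (hC i) + v (hC j)) ∧
      ((∀ ε, v (edge i j ε) = (2⁻¹ : k) • v (hC l) ∧ v (edge i l ε) = (2⁻¹ : k) • v (hC j) ∧
          v (edge j l ε) = (2⁻¹ : k) • v (hC i)) ∨
        ∃ ε δ, v (edge i j ε) = v (hC l) ∧ v (edge i l δ) = v (hC j) ∧
          v (edge j l (-(ε * δ))) = v (hC i) ∧ v (edge i j (-ε)) = 0 ∧ v (edge i l (-δ)) = 0 ∧
          v (edge j l (ε * δ)) = 0) := by
  have hsum : ∀ a b d, a ≠ b → a ≠ d → b ≠ d → pdet (v (hC a)) (v (hC b)) ≠ 0 →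
      v (hC a) + v (hC b) + v (edge a b 1) + v (edge a b (-1)) = 0 ∧
        pdet (v (hC d)) (v (hC a) + v (hC b)) = 0 := by
    intro a b d hab had hbd hne
    have hs := (hv.plane_dichotomy hab).resolve_right (fun h => hne h.1)
    refine ⟨hs, ?_⟩
    have := congrArg (pdet (v (hC d))) hs
    rw [add_assoc, pdet_add_right _ (v (hC a) + v (hC b)), pdet_add_right _ (v (edge a b 1)),
      hv.coord_edge d a b 1 had.symm hbd.symm hab,
      hv.coord_edge d a b (-1) had.symm hbd.symm hab] at this
    simpa using this
  obtain ⟨sij, pij⟩ := hsum i j l hij hil hjl h1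
  obtain ⟨sil, pil⟩ := hsum i l j hil hij hjl.symm h2
  obtain ⟨sjl, -⟩ := hsum j l i hjl hij.symm hil.symm h3
  have htot : v (hC i) + v (hC j) + v (hC l) = 0 := by
    apply eq_zero_of_pdet h3
    · rw [add_right_comm, pdet_add_right, pil]
      simp
    · rw [pdet_add_right, pij]
      simp
  have hcl : v (hC l) = -(v (hC i) + v (hC j)) := eq_neg_of_add_eq_zero_right htot
  refine ⟨hcl, ?_⟩
  have hi0 := left_ne_zero_of_pdet h1
  have hj0 := left_ne_zero_of_pdet h3
  have hl0 := left_ne_zero_of_pdet (pdet_ne_zero_comm.1 h2)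
  have hx : ∀ ε, ∃ x : k, v (edge i j ε) = x • v (hC l) := fun ε =>
    exists_smul_of_pdet_eq_zero hl0 (hv.coord_edge l i j ε hil.symm hjl.symm hij)
  have hy : ∀ ε, ∃ x : k, v (edge i l ε) = x • v (hC j) := fun ε =>
    exists_smul_of_pdet_eq_zero hj0 (hv.coord_edge j i l ε hij.symm hjl hil)
  have hz : ∀ ε, ∃ x : k, v (edge j l ε) = x • v (hC i) := fun ε =>
    exists_smul_of_pdet_eq_zero hi0 (hv.coord_edge i j l ε hij hil hjl)
  choose x hx using hx
  choose y hy using hy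
  choose z hz using hz
  have hone : ∀ (a b : k) (w : k × k), w ≠ 0 → a • w + b • w = w → a + b = 1 := by
    intro a b w hw h
    rw [← add_smul] at h
    have h' : (a + b - 1) • w = 0 := by rw [sub_smul, h, one_smul, sub_self]
    exact sub_eq_zero.1 ((smul_eq_zero.1 h').resolve_right hw)
  have hx1 : x 1 + x (-1) = 1 := hone _ _ _ hl0 (by
    rw [← hx, ← hx, hcl]
    exact eq_neg_of_add_eq_zero_right (by rw [← sij]; abel))
  have hy1 : y 1 + y (-1) = 1 := hone _ _ _ hj0 (by
    rw [← hy, ← hy]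
    have : v (edge i l 1) + v (edge i l (-1)) = -(v (hC i) + v (hC l)) :=
      eq_neg_of_add_eq_zero_right (by rw [← sil]; abel)
    rw [this, hcl]; abel)
  have hz1 : z 1 + z (-1) = 1 := hone _ _ _ hi0 (by
    rw [← hz, ← hz]
    have : v (edge j l 1) + v (edge j l (-1)) = -(v (hC j) + v (hC l)) :=
      eq_neg_of_add_eq_zero_right (by rw [← sjl]; abel)
    rw [this, hcl]; abel)
  have htri : ∀ ε δ, (z (-(ε * δ)) = y δ ∧ y δ = x ε) ∨ (z (-(ε * δ)) = 0 ∧ y δ = 0) ∨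
      (z (-(ε * δ)) = 0 ∧ x ε = 0) ∨ (y δ = 0 ∧ x ε = 0) := by
    intro ε δ
    apply triangle_coeff h1
    rw [← hcl, ← hx, ← hy, ← hz]
    have h := hv.triangle_dichotomy (-(ε * δ)) δ hjl hij.symm hil.symm
    rw [edge_comm l i, edge_comm j i, neg_mul_neg_mul_self] at h
    exact h
  have key : (x 1 = 2⁻¹ ∧ x (-1) = 2⁻¹ ∧ y 1 = 2⁻¹ ∧ y (-1) = 2⁻¹ ∧ z 1 = 2⁻¹ ∧ z (-1) = 2⁻¹) ∨
      ∃ ε δ, x ε = 1 ∧ y δ = 1 ∧ z (-(ε * δ)) = 1 ∧ x (-ε) = 0 ∧ y (-δ) = 0 ∧ z (ε * δ) = 0 := by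
    have t1 := htri 1 1
    have t2 := htri 1 (-1)
    have t3 := htri (-1) 1
    have t4 := htri (-1) (-1)
    simp only [mul_one, neg_neg, mul_neg] at t1 t2 t3 t4
    rcases balanced_coeff hx1 hy1 hz1 t1 t2 t3 t4 with h | h | h | h | h
    · exact Or.inl h
    · exact Or.inr ⟨1, 1, by simpa using h⟩
    · exact Or.inr ⟨1, -1, by simpa using h⟩
    · exact Or.inr ⟨-1, 1, by simpa using h⟩
    · exact Or.inr ⟨-1, -1, by simpa using h⟩
  rcases key with ⟨a1, a2, a3, a4, a5, a6⟩ | ⟨ε, δ, a1, a2, a3, a4, a5, a6⟩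
  · left
    intro ε
    rcases Int.units_eq_one_or ε with rfl | rfl
    · rw [hx, hy, hz, a1, a3, a5]
      exact ⟨rfl, rfl, rfl⟩
    · rw [hx, hy, hz, a2, a4, a6]
      exact ⟨rfl, rfl, rfl⟩
  · right
    refine ⟨ε, δ, ?_, ?_, ?_, ?_, ?_, ?_⟩
    · rw [hx, a1, one_smul]
    · rw [hy, a2, one_smul]
    · rw [hz, a3, one_smul]
    · rw [hx, a4, zero_smul]
    · rw [hy, a5, zero_smul]
    · rw [hz, a6, zero_smul]

/-- On three coordinates of which exactly one carries a nonzero vector. -/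
lemma values_of_single_coord [CharZero k] (hv : IsBParallel v) {i j l : Fin n} (hij : i ≠ j)
    (hil : i ≠ l) (hjl : j ≠ l) (hj : v (hC j) = 0) (hl : v (hC l) = 0)
    (h1 : ∃ ε, pdet (v (hC i)) (v (edge i j ε)) ≠ 0)
    (h2 : ∃ ε, pdet (v (hC i)) (v (edge i l ε)) ≠ 0) :
    pdet (v (hC i)) (v (edge i j 1)) ≠ 0 ∧
      v (edge i j (-1)) = -(v (hC i) + v (edge i j 1)) ∧
      ∃ σ, v (edge i l σ) = v (edge i j 1) ∧ v (edge i l (-σ)) = v (edge i j (-1)) ∧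
        v (edge j l σ) = v (hC i) ∧ v (edge j l (-σ)) = 0 := by
  have hsum : ∀ j, i ≠ j → v (hC j) = 0 → (∃ ε, pdet (v (hC i)) (v (edge i j ε)) ≠ 0) →
      v (edge i j (-1)) = -(v (hC i) + v (edge i j 1)) ∧
      pdet (v (hC i)) (v (edge i j 1)) ≠ 0 := by
    rintro j hij hj ⟨ε, hε⟩
    have hs := (hv.plane_dichotomy hij).resolve_right (fun h => hε (h.2.1 ε))
    rw [hj, add_zero] at hs
    have he := eq_neg_of_add_eq_zero_right hs
    refine ⟨he, ?_⟩
    rcases Int.units_eq_one_or ε with rfl | rfl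
    · exact hε
    · rw [he] at hε
      simpa using hε
  obtain ⟨hq, hp⟩ := hsum j hij hj h1
  obtain ⟨hs, hr⟩ := hsum l hil hl h2
  refine ⟨hp, hq, ?_⟩
  have hw : ∀ σ, pdet (v (hC i)) (v (edge j l σ)) = 0 := fun σ => hv.coord_edge i j l σ hij hil hjl
  have htri : ∀ ε δ, v (edge i j ε) + v (edge i l δ) + v (edge j l (-(ε * δ))) = 0 ∨
      (pdet (v (edge i j ε)) (v (edge i l δ)) = 0 ∧
        pdet (v (edge i j ε)) (v (edge j l (-(ε * δ)))) = 0 ∧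
        pdet (v (edge i l δ)) (v (edge j l (-(ε * δ)))) = 0) := by
    intro ε δ
    have := hv.triangle_dichotomy ε δ hij.symm hjl hil
    rwa [edge_comm j i] at this
  have t1 := htri 1 1
  have t2 := htri 1 (-1)
  simp only [mul_one, neg_neg, mul_neg] at t1 t2
  have hlam : ∀ {x y z : k × k}, x + y + z = 0 →
      pdet (v (hC i)) x + pdet (v (hC i)) y + pdet (v (hC i)) z = 0 := by
    intro x y z h
    have := congrArg (pdet (v (hC i))) h
    simpa using this
  -- the two triangles on `edge i j 1` can neither both have sum zero nor both be parallel
  rcases t1 with t1 | ⟨p1, p2, p3⟩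
  · have hd1 := hlam t1
    rw [hw, add_zero] at hd1
    refine ⟨-1, ?_⟩
    rcases t2 with t2 | ⟨p1, p2, p3⟩
    · exfalso
      have hd2 := hlam t2
      rw [hw, hs] at hd2
      simp only [pdet_neg_right, pdet_add_right, pdet_self] at hd2
      have : (2 : k) * pdet (v (hC i)) (v (edge i j 1)) = 0 := by linear_combination hd1 + hd2
      simp [hp] at this
    · have e1 : v (edge i j 1) - v (edge i l (-1)) = 0 := by
        apply eq_zero_of_pdet hp
        · rw [hs]
          simp [sub_eq_add_neg]
          linear_combination hd1
        · rw [sub_eq_add_neg, pdet_add_right, pdet_neg_right, p1]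
          simp
      have e2 : v (edge i l (-1)) = v (edge i j 1) := (sub_eq_zero.1 e1).symm
      have e3 : v (edge i l 1) = v (edge i j (-1)) := by
        rw [hq, ← e2, hs]
        abel
      refine ⟨e2, by rw [neg_neg, e3], ?_, ?_⟩
      · rw [e3, hq] at t1
        rw [← sub_eq_zero, ← t1]
        abel
      · rw [neg_neg]
        exact eq_zero_of_pdet hp (hw 1) p2
  · refine ⟨1, ?_⟩
    have hw1 : v (edge j l (-1)) = 0 := eq_zero_of_pdet hp (hw _) p2
    rcases t2 with t2 | ⟨q1, q2, q3⟩
    · have hd2 := hlam t2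
      rw [hw, hs] at hd2
      simp only [pdet_neg_right, pdet_add_right, pdet_self] at hd2
      have e1 : v (edge i j 1) - v (edge i l 1) = 0 := by
        apply eq_zero_of_pdet hp
        · simp [sub_eq_add_neg]
          linear_combination hd2
        · rw [sub_eq_add_neg, pdet_add_right, pdet_neg_right, p1]
          simp
      have e2 : v (edge i l 1) = v (edge i j 1) := (sub_eq_zero.1 e1).symm
      have e3 : v (edge i l (-1)) = v (edge i j (-1)) := by rw [hs, e2, hq]
      refine ⟨e2, e3, ?_, hw1⟩
      rw [e3, hq] at t2
      rw [← sub_eq_zero, ← t2]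
      abel
    · exfalso
      have := pdet_eq_zero_trans (left_ne_zero_of_pdet (pdet_ne_zero_comm.1 hp)) p1 q1
      rw [hs] at this
      simp only [pdet_neg_right, pdet_add_right, pdet_self] at this
      apply hr
      rw [pdet_eq_zero_comm]
      linear_combination -this

/-- On three coordinates, a pencil that vanishes on the coordinate hyperplanes is supported on one
balanced triangle, or takes the same value on opposite edges. -/
lemma values_of_spread (hv : IsBParallel v) (h0 : ∀ m, v (hC m) = 0) {i j l : Fin n}
    (hij : i ≠ j) (hil : i ≠ l) (hjl : j ≠ l) {ε δ : ℤˣ}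
    (h : pdet (v (edge i j ε)) (v (edge i l δ)) ≠ 0) :
    v (edge j l (-(ε * δ))) = -(v (edge i j ε) + v (edge i l δ)) ∧
      ((v (edge i j (-ε)) = 0 ∧ v (edge i l (-δ)) = 0 ∧ v (edge j l (ε * δ)) = 0) ∨
        (v (edge i j (-ε)) = v (edge i j ε) ∧ v (edge i l (-δ)) = v (edge i l δ) ∧
          v (edge j l (ε * δ)) = v (edge j l (-(ε * δ))))) := by
  have hc := closing_edge hv hij hil hjl h
  refine ⟨hc, ?_⟩
  have hself : ∀ i j ε, i ≠ j → pdet (v (edge i j ε)) (v (edge i j (-ε))) = 0 := by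
    intro i j ε hij
    have := hv.plane_edge i j ε hij
    rcases Int.units_eq_one_or ε with rfl | rfl
    · simpa [h0] using this
    · simpa [h0] using this
  obtain ⟨a, ha⟩ := exists_smul_of_pdet_eq_zero (left_ne_zero_of_pdet h) (hself i j ε hij)
  obtain ⟨b, hb⟩ := exists_smul_of_pdet_eq_zero
    (left_ne_zero_of_pdet (pdet_ne_zero_comm.1 h)) (hself i l δ hil)
  have hcne : v (edge j l (-(ε * δ))) ≠ 0 := by
    intro e
    rw [e] at hc
    have := congrArg (pdet (v (edge i j ε))) hc
    simp at this
    exact h this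
  obtain ⟨c, hc'⟩ := exists_smul_of_pdet_eq_zero hcne (hself j l (-(ε * δ)) hjl)
  rw [neg_neg] at hc'
  have htri : ∀ ε' δ' γ', γ' = -(ε' * δ') →
      (v (edge i j ε') + v (edge i l δ') + v (edge j l γ') = 0 ∨
      (pdet (v (edge i j ε')) (v (edge i l δ')) = 0 ∧
        pdet (v (edge i j ε')) (v (edge j l γ')) = 0 ∧
        pdet (v (edge i l δ')) (v (edge j l γ')) = 0)) := by
    rintro ε' δ' γ' rfl
    have := hv.triangle_dichotomy ε' δ' hij.symm hjl hil
    rwa [edge_comm j i] at this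
  have t1 := htri ε (-δ) (ε * δ) (by simp)
  have t2 := htri (-ε) δ (ε * δ) (by simp)
  have t3 := htri (-ε) (-δ) (-(ε * δ)) (by simp)
  rw [hc', hc, hb] at t1
  rw [hc', hc, ha] at t2
  rw [hc, ha, hb] at t3
  have c1 := triangle_coeff h (a := 1) (b := b) (c := c) (by rwa [one_smul])
  have c2 := triangle_coeff h (a := a) (b := 1) (c := c) (by rwa [one_smul])
  have c3 := triangle_coeff h (a := a) (b := b) (c := 1) (by rwa [one_smul])
  have hone : (1 : k) ≠ 0 := one_ne_zero
  have key : (a = 0 ∧ b = 0 ∧ c = 0) ∨ (a = 1 ∧ b = 1 ∧ c = 1) := by grind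
  rcases key with ⟨rfl, rfl, rfl⟩ | ⟨rfl, rfl, rfl⟩
  · left
    rw [ha, hb, hc']
    simp
  · right
    rw [ha, hb, hc']
    simp

end Values

/-! ### Pencils given by integer vectors -/

section RowSpace

/-- The two-generated subspace of all `h ↦ x (P h)₁ + y (P h)₂`. -/
def rowSpace (k : Type*) [Field k] {ι : Type*} (P : ι → ℤ × ℤ) : Submodule k (ι → k) where
  carrier := {u | ∃ x y : k, ∀ h, u h = x * ((P h).1 : k) + y * ((P h).2 : k)}
  add_mem' := by
    rintro u v ⟨x, y, h⟩ ⟨x', y', h'⟩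
    exact ⟨x + x', y + y', fun i => by rw [Pi.add_apply, h, h']; ring⟩
  zero_mem' := ⟨0, 0, by simp⟩
  smul_mem' := by
    rintro c u ⟨x, y, h⟩
    exact ⟨c * x, c * y, fun i => by rw [Pi.smul_apply, smul_eq_mul, h]; ring⟩

variable {k : Type*} [Field k] {ι ι' : Type*}

lemma mem_rowSpace {P : ι → ℤ × ℤ} {u : ι → k} :
    u ∈ rowSpace k P ↔ ∃ x y : k, ∀ h, u h = x * ((P h).1 : k) + y * ((P h).2 : k) := Iff.rfl

lemma mem_rowSpace_extend_iff (f : ι' ↪ ι) (P : ι' → ℤ × ℤ) (u : ι → k) :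
    u ∈ rowSpace k (Function.extend f P 0) ↔
      (fun h => u (f h)) ∈ rowSpace k P ∧ ∀ h, h ∉ Set.range f → u h = 0 := by
  constructor
  · rintro ⟨x, y, h⟩
    refine ⟨⟨x, y, fun i => ?_⟩, fun i hi => ?_⟩
    · simp only [h, f.injective.extend_apply]
    · rw [h, Function.extend_apply' _ _ _ (by simpa using hi)]
      simp
  · rintro ⟨⟨x, y, h⟩, h0⟩
    refine ⟨x, y, fun i => ?_⟩
    by_cases hi : i ∈ Set.range f
    · obtain ⟨i, rfl⟩ := hi
      rw [f.injective.extend_apply]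
      exact h i
    · rw [h0 i hi, Function.extend_apply' _ _ _ (by simpa using hi)]
      simp

/-- The support of a row space is the support of its pencil; characteristic zero is used to
embed `ℤ`. -/
lemma exists_mem_rowSpace_ne_zero_iff [CharZero k] {P : ι → ℤ × ℤ} {h : ι} :
    (∃ u ∈ rowSpace k P, u h ≠ 0) ↔ P h ≠ 0 := by
  constructor
  · rintro ⟨u, ⟨x, y, hu⟩, hne⟩ h0
    rw [hu, h0] at hne
    simp at hne
  · intro hne
    by_cases h1 : (P h).1 = 0
    · refine ⟨fun h => ((P h).2 : k), ⟨0, 1, by simp⟩, ?_⟩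
      rw [Int.cast_ne_zero]
      exact fun h2 => hne (Prod.ext h1 h2)
    · exact ⟨fun h => ((P h).1 : k), ⟨1, 0, by simp⟩, Int.cast_ne_zero.2 h1⟩

/-- Both coordinate vectors occur among the values of `P`. -/
def HasUnits (P : ι → ℤ × ℤ) : Prop := (∃ h, P h = (1, 0)) ∧ ∃ h, P h = (0, 1)

lemma HasUnits.extend {P : ι' → ℤ × ℤ} (hP : HasUnits P) (f : ι' ↪ ι) :
    HasUnits (Function.extend f P 0) := by
  obtain ⟨⟨a, ha⟩, b, hb⟩ := hP
  exact ⟨⟨f a, by rw [f.injective.extend_apply, ha]⟩, f b, by rw [f.injective.extend_apply, hb]⟩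

lemma finrank_rowSpace {P : ι → ℤ × ℤ} (hP : HasUnits P) :
    Module.finrank k (rowSpace k P) = 2 := by
  let φ : k × k →ₗ[k] (ι → k) :=
    { toFun := fun z h => z.1 * ((P h).1 : k) + z.2 * ((P h).2 : k)
      map_add' := fun z w => by ext h; simp; ring
      map_smul' := fun c z => by ext h; simp; ring }
  obtain ⟨⟨a, ha⟩, b, hb⟩ := hP
  have hinj : Function.Injective φ := by
    intro z w hzw
    have h1 := congrFun hzw a
    have h2 := congrFun hzw b
    simp [φ, ha, hb] at h1 h2
    exact Prod.ext h1 h2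
  have hr : rowSpace k P = LinearMap.range φ := by
    ext u
    rw [mem_rowSpace, LinearMap.mem_range]
    constructor
    · rintro ⟨x, y, h⟩
      exact ⟨(x, y), funext fun i => (h i).symm⟩
    · rintro ⟨z, rfl⟩
      exact ⟨z.1, z.2, fun _ => rfl⟩
  rw [hr, LinearMap.finrank_range_of_inj hinj]
  simp

lemma exists_mem_rowSpace_notMem_span {P : ι → ℤ × ℤ} (hP : HasUnits P) (u : ι → k) :
    ∃ b ∈ rowSpace k P, b ∉ Submodule.span k {u} := by
  by_contra! hcon
  have h1 : Module.finrank k (rowSpace k P) ≤ Module.finrank k (Submodule.span k {u}) :=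
    Submodule.finrank_mono fun b hb => hcon b hb
  have h2 : Module.finrank k (Submodule.span k {u}) ≤ 1 := by
    simpa using finrank_span_le_card (R := k) ({u} : Set (ι → k))
  rw [finrank_rowSpace hP] at h1
  omega

/-- Two members of the row space of a family satisfying the local conditions satisfy them. -/
lemma isBParallel_of_mem_rowSpace {n : ℕ} {P : BIdx n → ℤ × ℤ} (hP : IsBParallel P)
    {u b : BIdx n → k} (hu : u ∈ rowSpace k P) (hb : b ∈ rowSpace k P) :
    IsBParallel (fun h => (u h, b h)) := by
  obtain ⟨x, y, hu⟩ := hu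
  obtain ⟨x', y', hb⟩ := hb
  let φ : ℤ × ℤ → k × k := fun z => (x * (z.1 : k) + y * (z.2 : k), x' * (z.1 : k) + y' * (z.2 : k))
  have hφ : (fun h => (u h, b h)) = fun h => φ (P h) := by
    ext h <;> simp [φ, hu, hb]
  have hadd : ∀ z w, φ z + φ w = φ (z + w) := by
    intro z w
    ext <;> simp [φ] <;> ring
  have hdet : ∀ z w, pdet z w = 0 → pdet (φ z) (φ w) = 0 := by
    intro z w hzw
    have h1 : ((z.1 : k) * (w.2 : k) - (z.2 : k) * (w.1 : k)) = 0 := by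
      have := congrArg (Int.cast : ℤ → k) hzw
      simpa [pdet] using this
    simp only [pdet, φ]
    linear_combination (x * y' - x' * y) * h1
  rw [hφ]
  constructor
  · exact fun i a b ε h1 h2 h3 => hdet _ _ (hP.coord_edge i a b ε h1 h2 h3)
  · exact fun i j a b ε δ h1 h2 h3 h4 h5 h6 =>
      hdet _ _ (hP.edge_edge i j a b ε δ h1 h2 h3 h4 h5 h6)
  · intro i j h
    rw [hadd, hadd, hadd]
    exact hdet _ _ (hP.plane_coord i j h)
  · intro i j ε h
    rw [hadd, hadd, hadd]
    exact hdet _ _ (hP.plane_edge i j ε h)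
  · intro i j l ε δ h1 h2 h3
    rw [hadd, hadd]
    exact hdet _ _ (hP.triangle i j l ε δ h1 h2 h3)

end RowSpace

/-! ### Subarrangements on fewer coordinates -/

section Embeddings

/-- The inclusion of type B arrangements induced by a choice of `m` of the `n` coordinates. -/
def embB {m n : ℕ} (g : Fin m ↪o Fin n) : BIdx m ↪ BIdx n where
  toFun := Sum.elim (fun i => hC (g i))
    fun e => Sum.inr (⟨(g e.1.1.1, g e.1.1.2), g.lt_iff_lt.2 e.1.2⟩, e.2)
  inj' := by
    rintro (i | ⟨⟨⟨i, j⟩, hij⟩, ε⟩) (a | ⟨⟨⟨a, b⟩, hab⟩, δ⟩) h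
    · simpa using h
    · simp at h
    · simp at h
    · simpa using h

variable {m n : ℕ}

@[simp] lemma embB_hC (g : Fin m ↪o Fin n) (i : Fin m) : embB g (hC i) = hC (g i) := rfl

@[simp] lemma embB_edge (g : Fin m ↪o Fin n) (i j : Fin m) (ε : ℤˣ) :
    embB g (edge i j ε) = edge (g i) (g j) ε := by
  rcases lt_trichotomy i j with h | rfl | h
  · rw [edge_of_lt h, edge_of_lt (g.lt_iff_lt.2 h)]
    rfl
  · simp [edge]
  · rw [edge_comm i j, edge_of_lt h, edge_comm (g i), edge_of_lt (g.lt_iff_lt.2 h)]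
    rfl

lemma arrB_embB (g : Fin m ↪o Fin n) (h : BIdx m) :
    arrB n (embB g h) = (arrB m h).comp (LinearMap.funLeft ℂ ℂ g) := by
  rcases h with i | e <;> rfl

lemma isSubArr_embB (g : Fin m ↪o Fin n) : IsSubArr (arrB m) (arrB n) (embB g) := by
  intro p q h
  rw [mem_flatClosure, mem_flatClosure, Submodule.mem_span_pair, Submodule.mem_span_pair]
  refine exists_congr fun c => exists_congr fun d => ?_
  rw [arrB_embB, arrB_embB, arrB_embB, ← LinearMap.smul_comp, ← LinearMap.smul_comp,
    ← LinearMap.add_comp]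
  exact LinearMap.cancel_right (LinearMap.funLeft_surjective_of_injective ℂ ℂ g g.injective)

lemma isSubArr_inr (n : ℕ) : IsSubArr (arrD n) (arrB n) Function.Embedding.inr := by
  intro p q h
  rw [mem_flatClosure, mem_flatClosure]
  rfl

lemma isSimpleArr_arrD (n : ℕ) : IsSimpleArr (arrD n) :=
  ⟨fun p => (isSimpleArr_arrB n).1 (Sum.inr p),
    fun p q hpq => (isSimpleArr_arrB n).2 (Sum.inr p) (Sum.inr q) (by simpa using hpq)⟩

variable {k : Type*} [Field k]

lemma extendDB_eq_extend (u : DIdx n → k) :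
    extendDB u = Function.extend (Function.Embedding.inr : DIdx n ↪ BIdx n) u 0 := by
  ext h
  rcases h with i | e
  · rw [Function.extend_apply' _ _ _ (by simp)]
    rfl
  · exact (Function.Embedding.inr.injective.extend_apply u (0 : BIdx n → k) e).symm

section Transport

lemma extend_smul_zero {ι ι' : Type*} (f : ι' ↪ ι) (c : k) (u : ι' → k) :
    c • Function.extend f u 0 = Function.extend f (c • u) 0 := by
  ext h
  by_cases hh : ∃ h', f h' = h
  · obtain ⟨h, rfl⟩ := hh
    simp [f.injective.extend_apply]
  · simp [Function.extend_apply' _ _ _ hh]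

lemma extend_injective_zero {ι ι' : Type*} (f : ι' ↪ ι) {u w : ι' → k}
    (h : Function.extend f u 0 = Function.extend f w 0) : u = w := by
  ext i
  simpa [f.injective.extend_apply] using congrFun h (f i)

variable {V V' ι ι' : Type*} [AddCommGroup V] [Module ℂ V]
  [AddCommGroup V'] [Module ℂ V'] [Fintype ι] [Fintype ι'] [DecidableEq ι] [DecidableEq ι']
  {α : ι → Module.Dual ℂ V} {α' : ι' → Module.Dual ℂ V'}

lemma mem_arrResonance_and_extend_mem (hα : IsSimpleArr α) (hα' : IsSimpleArr α') {f : ι' ↪ ι}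
    (hf : IsSubArr α' α f) {u b : ι' → k} (hb : b ∉ Submodule.span k {u})
    (h : IsLocallyParallel α (Function.extend f u 0) (Function.extend f b 0)) :
    u ∈ arrResonance k α' ∧ Function.extend f u 0 ∈ arrResonance k α := by
  refine ⟨(mem_arrResonance_iff hα' u).2 ⟨b, hb, (isLocallyParallel_extend_iff hα hf u b).1 h⟩,
    (mem_arrResonance_iff hα _).2 ⟨_, fun hmem => hb ?_, h⟩⟩
  obtain ⟨c, hc⟩ := Submodule.mem_span_singleton.1 hmem
  rw [extend_smul_zero] at hc
  exact Submodule.mem_span_singleton.2 ⟨c, extend_injective_zero f hc⟩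

lemma extend_mem_arrResonance (hα : IsSimpleArr α) (hα' : IsSimpleArr α') {f : ι' ↪ ι}
    (hf : IsSubArr α' α f) {u : ι' → k} (hu : u ∈ arrResonance k α') :
    Function.extend f u 0 ∈ arrResonance k α := by
  obtain ⟨b, hb, h⟩ := (mem_arrResonance_iff hα' u).1 hu
  exact (mem_arrResonance_and_extend_mem hα hα' hf hb
    ((isLocallyParallel_extend_iff hα hf u b).2 h)).2

end Transport

/-- A pencil of type B that vanishes on the coordinate hyperplanes is a pencil of type D. -/
lemma mem_image_extendDB {u b : BIdx n → k} (hu : ∀ i, u (hC i) = 0) (hb : ∀ i, b (hC i) = 0)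
    (hbu : b ∉ Submodule.span k {u}) (h : IsLocallyParallel (arrB n) u b) :
    u ∈ extendDB '' arrResonance k (arrD n) := by
  have hext : ∀ w : BIdx n → k, (∀ i, w (hC i) = 0) →
      Function.extend (Function.Embedding.inr : DIdx n ↪ BIdx n) (fun e => w (Sum.inr e)) 0 =
        w := by
    intro w hw
    rw [← extendDB_eq_extend]
    ext x
    rcases x with i | e
    · exact (hw i).symm
    · rfl
  rw [← hext u hu, ← hext b hb] at h
  refine ⟨fun e => u (Sum.inr e), (mem_arrResonance_and_extend_mem (isSimpleArr_arrB n)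
    (isSimpleArr_arrD n) (isSubArr_inr n) (fun hmem => hbu ?_) h).1, ?_⟩
  · obtain ⟨c, hc⟩ := Submodule.mem_span_singleton.1 hmem
    refine Submodule.mem_span_singleton.2 ⟨c, ?_⟩
    rw [← hext u hu, ← hext b hb, extend_smul_zero, hc]
  · rw [extendDB_eq_extend, hext u hu]

lemma rowSpace_extend_subset_arrResonance (g : Fin m ↪o Fin n) {P : BIdx m → ℤ × ℤ}
    (hP : IsBParallel P) (hP' : HasUnits P) :
    (rowSpace k (Function.extend (embB g) P 0) : Set (BIdx n → k)) ⊆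
      arrResonance k (arrB n) := by
  intro u hu
  obtain ⟨h1, h2⟩ := (mem_rowSpace_extend_iff _ _ _).1 hu
  obtain ⟨b, hb, hbu⟩ := exists_mem_rowSpace_notMem_span (k := k) hP' (fun h => u (embB g h))
  have hmem : (fun h => u (embB g h)) ∈ arrResonance k (arrB m) :=
    (mem_arrResonance_iff (isSimpleArr_arrB m) _).2 ⟨b, hbu,
      (isLocallyParallel_arrB_iff _ _).2 (isBParallel_of_mem_rowSpace hP h1 hb)⟩
  have := extend_mem_arrResonance (isSimpleArr_arrB n) (isSimpleArr_arrB m) (isSubArr_embB g) hmem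
  convert this using 1
  ext h
  by_cases hh : ∃ h', embB g h' = h
  · obtain ⟨h, rfl⟩ := hh
    rw [(embB g).injective.extend_apply]
  · rw [Function.extend_apply' _ _ _ hh, h2 h (by simpa using hh)]
    rfl

end Embeddings

/-! ### The three-block patterns on three and four coordinates -/

section Patterns

/-- The integer pencil with values `w h • (1, 0)`, `w h • (0, 1)` and `w h • (-1, -1)` on the three
blocks, and zero elsewhere. -/
def netVec {ι : Type*} [DecidableEq ι] (b : Fin 3 → Finset ι) (w : ι → ℤ) (h : ι) : ℤ × ℤ :=
  if h ∈ b 0 then (w h, 0) else if h ∈ b 1 then (0, w h) else if h ∈ b 2 then (-w h, -w h) else 0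

/-- The partitions of subarrangements of `B_3` that contain coordinate hyperplanes: ten braid
arrangements, followed by the full arrangement. -/
def coordBlocks : Fin 11 → Fin 3 → Finset (BIdx 3) :=
  ![![{hC 0, edge 1 2 (-1)}, {hC 1, edge 0 2 (-1)}, {hC 2, edge 0 1 (-1)}],
    ![{hC 0, edge 1 2 1}, {hC 1, edge 0 2 1}, {hC 2, edge 0 1 (-1)}],
    ![{hC 0, edge 1 2 1}, {hC 1, edge 0 2 (-1)}, {hC 2, edge 0 1 1}],
    ![{hC 0, edge 1 2 (-1)}, {hC 1, edge 0 2 1}, {hC 2, edge 0 1 1}],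
    ![{hC 0, edge 1 2 (-1)}, {edge 0 1 (-1), edge 0 2 1}, {edge 0 1 1, edge 0 2 (-1)}],
    ![{hC 0, edge 1 2 1}, {edge 0 1 (-1), edge 0 2 (-1)}, {edge 0 1 1, edge 0 2 1}],
    ![{hC 1, edge 0 2 (-1)}, {edge 0 1 (-1), edge 1 2 1}, {edge 0 1 1, edge 1 2 (-1)}],
    ![{hC 1, edge 0 2 1}, {edge 0 1 (-1), edge 1 2 (-1)}, {edge 0 1 1, edge 1 2 1}],
    ![{hC 2, edge 0 1 (-1)}, {edge 0 2 (-1), edge 1 2 1}, {edge 0 2 1, edge 1 2 (-1)}],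
    ![{hC 2, edge 0 1 1}, {edge 0 2 (-1), edge 1 2 (-1)}, {edge 0 2 1, edge 1 2 1}],
    ![{hC 0, edge 1 2 (-1), edge 1 2 1}, {hC 1, edge 0 2 (-1), edge 0 2 1},
      {hC 2, edge 0 1 (-1), edge 0 1 1}]]

/-- The multiplicities: the coordinate hyperplanes count twice in the full `B_3` arrangement. -/
def coordWeight (q : Fin 11) : BIdx 3 → ℤ :=
  Sum.elim (fun _ => if q = 10 then 2 else 1) fun _ => 1

/-- The partitions of subarrangements of `D_3`: the full arrangement, and the balanced triangles. -/
def edgeBlocks : Option (ℤˣ × ℤˣ) → Fin 3 → Finset (BIdx 3)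
  | none => ![{edge 0 1 1, edge 0 1 (-1)}, {edge 0 2 1, edge 0 2 (-1)},
      {edge 1 2 1, edge 1 2 (-1)}]
  | some (ε, δ) => ![{edge 0 1 ε}, {edge 0 2 δ}, {edge 1 2 (-(ε * δ))}]

/-- The partitions of subarrangements of `D_4`: the full arrangement, and the braid arrangements
given by the balanced complete graphs. -/
def quadBlocks : Option (ℤˣ × ℤˣ × ℤˣ) → Fin 3 → Finset (BIdx 4)
  | none => ![{edge 0 1 1, edge 0 1 (-1), edge 2 3 1, edge 2 3 (-1)},
      {edge 0 2 1, edge 0 2 (-1), edge 1 3 1, edge 1 3 (-1)},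
      {edge 0 3 1, edge 0 3 (-1), edge 1 2 1, edge 1 2 (-1)}]
  | some (ε, δ, γ) => ![{edge 0 1 ε, edge 2 3 (-(δ * γ))}, {edge 0 2 δ, edge 1 3 (-(ε * γ))},
      {edge 0 3 γ, edge 1 2 (-(ε * δ))}]

/-- The partitions supported on three coordinates. -/
abbrev TripleKind : Type := Fin 11 ⊕ Option (ℤˣ × ℤˣ)

/-- The partitions supported on four coordinates. -/
abbrev QuadKind : Type := Option (ℤˣ × ℤˣ × ℤˣ)

/-- The integer pencil of a partition supported on three coordinates. -/
def tripleVec : TripleKind → BIdx 3 → ℤ × ℤ :=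
  Sum.elim (fun q => netVec (coordBlocks q) (coordWeight q))
    fun q => netVec (edgeBlocks q) fun _ => 1

/-- The integer pencil of a partition supported on four coordinates. -/
def quadVec (q : QuadKind) : BIdx 4 → ℤ × ℤ := netVec (quadBlocks q) fun _ => 1

set_option synthInstance.maxHeartbeats 400000 in
set_option synthInstance.maxSize 2000 in
lemma isBParallel_tripleVec (q : TripleKind) : IsBParallel (tripleVec q) := by
  constructor
  · revert q; unfold pdet; decide +kernel
  · revert q; unfold pdet; decide +kernel
  · revert q; unfold pdet; decide +kernel
  · revert q; unfold pdet; decide +kernel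
  · revert q; unfold pdet; decide +kernel

set_option synthInstance.maxHeartbeats 400000 in
set_option synthInstance.maxSize 2000 in
lemma isBParallel_quadVec (q : QuadKind) : IsBParallel (quadVec q) := by
  constructor
  · revert q; unfold pdet; decide +kernel
  · revert q; unfold pdet; decide +kernel
  · revert q; unfold pdet; decide +kernel
  · revert q; unfold pdet; decide +kernel
  · revert q; unfold pdet; decide +kernel

lemma hasUnits_tripleVec (q : TripleKind) : HasUnits (tripleVec q) := by
  unfold HasUnits
  revert q
  decide +kernel

lemma hasUnits_quadVec (q : QuadKind) : HasUnits (quadVec q) := by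
  unfold HasUnits
  revert q
  decide +kernel

/-- The coordinates in the equation of a hyperplane. -/
def vertices {n : ℕ} : BIdx n → Finset (Fin n) :=
  Sum.elim (fun i => {i}) fun e => {e.1.1.1, e.1.1.2}

lemma vertices_tripleVec (q : TripleKind) (a : Fin 3) :
    ∃ h, tripleVec q h ≠ 0 ∧ a ∈ vertices h := by
  revert q a
  decide +kernel

lemma vertices_quadVec (q : QuadKind) (a : Fin 4) :
    ∃ h, quadVec q h ≠ 0 ∧ a ∈ vertices h := by
  revert q a
  decide +kernel

lemma tripleVec_injective_support (q r : TripleKind)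
    (h : ∀ x, tripleVec q x = 0 ↔ tripleVec r x = 0) : q = r := by
  revert q r
  decide +kernel

lemma quadVec_injective_support (q r : QuadKind)
    (h : ∀ x, quadVec q x = 0 ↔ quadVec r x = 0) : q = r := by
  revert q r
  decide +kernel

lemma sum_tripleVec (q : Fin 11) : ∑ h, tripleVec (Sum.inl q) h = 0 := by
  revert q
  decide +kernel

lemma tripleVec_inl_ne_zero_iff (q : Fin 11) (h : BIdx 3) :
    tripleVec (Sum.inl q) h ≠ 0 ↔ ∃ s, h ∈ coordBlocks q s := by
  revert q h
  decide +kernel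

set_option synthInstance.maxHeartbeats 400000 in
set_option synthInstance.maxSize 2000 in
/-- Two parallel values of the pencil of a partition belong to the same block. -/
lemma same_block_of_pdet (q : Fin 11) (h h' : BIdx 3) (s t : Fin 3) (hs : h ∈ coordBlocks q s)
    (ht : h' ∈ coordBlocks q t)
    (h0 : pdet (tripleVec (Sum.inl q) h) (tripleVec (Sum.inl q) h') = 0) : s = t := by
  revert q h h' s t
  unfold pdet
  decide +kernel

lemma coordBlocks_disjoint (q : Fin 11) (h : BIdx 3) (s t : Fin 3) (hs : h ∈ coordBlocks q s)
    (ht : h ∈ coordBlocks q t) : s = t :=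
  same_block_of_pdet q h h s t hs ht (pdet_self _)

end Patterns

/-! ### Pencils on few coordinates belong to the patterns -/

section Membership

set_option synthInstance.maxHeartbeats 400000
set_option synthInstance.maxSize 2000

variable {k : Type*} [Field k]

/-- The three blocks carry `x`, `y` and `-(x + y)`, up to the multiplicities. -/
lemma mem_rowSpace_netVec {ι : Type*} [DecidableEq ι] {b : Fin 3 → Finset ι} {w : ι → ℤ}
    {u : ι → k} (x y : k) (Z : Finset ι) (hZ : ∀ h, h ∈ b 0 ∨ h ∈ b 1 ∨ h ∈ b 2 ∨ h ∈ Z)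
    (h0 : ∀ h ∈ b 0, u h = w h * x) (h1 : ∀ h ∈ b 1, u h = w h * y)
    (h2 : ∀ h ∈ b 2, u h = w h * -(x + y)) (hz : ∀ h ∈ Z, u h = 0) :
    u ∈ rowSpace k (netVec b w) := by
  refine ⟨x, y, fun h => ?_⟩
  unfold netVec
  split_ifs with c0 c1 c2
  · rw [h0 h c0]
    push_cast
    ring
  · rw [h1 h c1]
    push_cast
    ring
  · rw [h2 h c2]
    push_cast
    ring
  · rw [hz h (by have := hZ h; tauto)]
    simp

@[simp] lemma coordWeight_hC (q : Fin 11) (i : Fin 3) :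
    coordWeight q (hC i) = if q = 10 then 2 else 1 := rfl

lemma coordWeight_edge (q : Fin 11) {i j : Fin 3} (h : i ≠ j) (ε : ℤˣ) :
    coordWeight q (edge i j ε) = 1 := by
  rcases h.lt_or_gt with h | h
  · rw [edge_of_lt h]
    rfl
  · rw [edge_comm, edge_of_lt h]
    rfl

variable {n : ℕ} {v : BIdx n → k × k}

lemma SupportedOn.eq_zero_of_notMem_range {M : Type*} [Zero M] {v : BIdx n → M}
    {S : Finset (Fin n)} (hS : SupportedOn v S) {m : ℕ} (hm : S.card = m) {h : BIdx n}
    (hh : h ∉ Set.range (embB (S.orderEmbOfFin hm))) : v h = 0 := by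
  have hex : ∀ a ∈ S, ∃ i, S.orderEmbOfFin hm i = a := fun a ha => by
    have : a ∈ Set.range (S.orderEmbOfFin hm) := by
      rw [Finset.range_orderEmbOfFin]
      exact ha
    exact this
  induction h using BIdx.cases_edge with
  | h1 a =>
    apply hS.1
    intro ha
    obtain ⟨i, rfl⟩ := hex a ha
    exact hh ⟨hC i, rfl⟩
  | h2 a b ε hab =>
    by_cases ha : a ∈ S
    · by_cases hb : b ∈ S
      · obtain ⟨i, rfl⟩ := hex a ha
        obtain ⟨j, rfl⟩ := hex b hb
        exact absurd ⟨edge i j ε, embB_edge _ _ _ _⟩ hh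
      · rw [edge_comm]
        exact hS.2 b a ε hab.symm hb
    · exact hS.2 a b ε hab ha

lemma exists_mem_rowSpace_of_coord [CharZero k] (hv : IsBParallel v) (g : Fin 3 ↪o Fin n)
    (h01 : pdet (v (hC (g 0))) (v (hC (g 1))) ≠ 0) (h02 : pdet (v (hC (g 0))) (v (hC (g 2))) ≠ 0)
    (h12 : pdet (v (hC (g 1))) (v (hC (g 2))) ≠ 0) :
    ∃ q : Fin 11, (fun h => (v (embB g h)).1) ∈ rowSpace k (tripleVec (Sum.inl q)) := by
  have n01 : g 0 ≠ g 1 := g.injective.ne (by decide)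
  have n02 : g 0 ≠ g 2 := g.injective.ne (by decide)
  have n12 : g 1 ≠ g 2 := g.injective.ne (by decide)
  obtain ⟨hs, hall | ⟨ε, δ, e1, e2, e3, e4, e5, e6⟩⟩ :=
    values_of_coord hv n01 n02 n12 h01 h02 h12
  · refine ⟨10, mem_rowSpace_netVec (2⁻¹ * (v (hC (g 0))).1) (2⁻¹ * (v (hC (g 1))).1) ∅
      (by decide +kernel) ?_ ?_ ?_ (by simp)⟩
    · simp [coordBlocks, coordWeight_edge, hall]
    · simp [coordBlocks, coordWeight_edge, hall]
    · simp [coordBlocks, coordWeight_edge, hall, hs]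
      ring
  · rcases Int.units_eq_one_or ε with rfl | rfl <;> rcases Int.units_eq_one_or δ with rfl | rfl <;>
      simp only [mul_one, neg_neg, mul_neg] at e1 e2 e3 e4 e5 e6
    · refine ⟨3, mem_rowSpace_netVec (v (hC (g 0))).1 (v (hC (g 1))).1
        {edge 1 2 1, edge 0 2 (-1), edge 0 1 (-1)} (by decide +kernel) ?_ ?_ ?_ ?_⟩ <;>
      simp [coordBlocks, coordWeight_edge, *]
    · refine ⟨2, mem_rowSpace_netVec (v (hC (g 0))).1 (v (hC (g 1))).1
        {edge 1 2 (-1), edge 0 2 1, edge 0 1 (-1)} (by decide +kernel) ?_ ?_ ?_ ?_⟩ <;>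
      simp [coordBlocks, coordWeight_edge, *]
    · refine ⟨1, mem_rowSpace_netVec (v (hC (g 0))).1 (v (hC (g 1))).1
        {edge 1 2 (-1), edge 0 2 (-1), edge 0 1 1} (by decide +kernel) ?_ ?_ ?_ ?_⟩ <;>
      simp [coordBlocks, coordWeight_edge, *]
    · refine ⟨0, mem_rowSpace_netVec (v (hC (g 0))).1 (v (hC (g 1))).1
        {edge 1 2 1, edge 0 2 1, edge 0 1 1} (by decide +kernel) ?_ ?_ ?_ ?_⟩ <;>
      simp [coordBlocks, coordWeight_edge, *]

lemma exists_mem_rowSpace_of_single_coord [CharZero k] (hv : IsBParallel v) (g : Fin 3 ↪o Fin n)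
    (a : Fin 3) (ha : ∀ b, b ≠ a → v (hC (g b)) = 0 ∧
      ∃ ε, pdet (v (hC (g a))) (v (edge (g a) (g b) ε)) ≠ 0) :
    ∃ q : Fin 11, (fun h => (v (embB g h)).1) ∈ rowSpace k (tripleVec (Sum.inl q)) := by
  have n01 : g 0 ≠ g 1 := g.injective.ne (by decide)
  have n02 : g 0 ≠ g 2 := g.injective.ne (by decide)
  have n12 : g 1 ≠ g 2 := g.injective.ne (by decide)
  fin_cases a
  · obtain ⟨z1, d1⟩ := ha 1 (by decide)
    obtain ⟨z2, d2⟩ := ha 2 (by decide)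
    obtain ⟨-, hq, σ, e1, e2, e3, e4⟩ := values_of_single_coord hv n01 n02 n12 z1 z2 d1 d2
    rcases Int.units_eq_one_or σ with rfl | rfl
    · refine ⟨5, mem_rowSpace_netVec (v (hC (g 0))).1 (v (edge (g 0) (g 1) (-1))).1
        {hC 1, hC 2, edge 1 2 (-1)} (by decide +kernel) ?_ ?_ ?_ ?_⟩ <;>
      simp [coordBlocks, coordWeight_edge, *]
    · rw [neg_neg] at e2 e4
      refine ⟨4, mem_rowSpace_netVec (v (hC (g 0))).1 (v (edge (g 0) (g 1) (-1))).1
        {hC 1, hC 2, edge 1 2 1} (by decide +kernel) ?_ ?_ ?_ ?_⟩ <;>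
      simp [coordBlocks, coordWeight_edge, *]
  · obtain ⟨z1, d1⟩ := ha 0 (by decide)
    obtain ⟨z2, d2⟩ := ha 2 (by decide)
    obtain ⟨-, hq, σ, e1, e2, e3, e4⟩ := values_of_single_coord hv n01.symm n12 n02 z1 z2 d1 d2
    simp only [edge_comm (g 1) (g 0)] at hq e1 e2
    rcases Int.units_eq_one_or σ with rfl | rfl
    · refine ⟨7, mem_rowSpace_netVec (v (hC (g 1))).1 (v (edge (g 0) (g 1) (-1))).1
        {hC 0, hC 2, edge 0 2 (-1)} (by decide +kernel) ?_ ?_ ?_ ?_⟩ <;>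
      simp [coordBlocks, coordWeight_edge, *]
    · rw [neg_neg] at e2 e4
      refine ⟨6, mem_rowSpace_netVec (v (hC (g 1))).1 (v (edge (g 0) (g 1) (-1))).1
        {hC 0, hC 2, edge 0 2 1} (by decide +kernel) ?_ ?_ ?_ ?_⟩ <;>
      simp [coordBlocks, coordWeight_edge, *]
  · obtain ⟨z1, d1⟩ := ha 0 (by decide)
    obtain ⟨z2, d2⟩ := ha 1 (by decide)
    obtain ⟨-, hq, σ, e1, e2, e3, e4⟩ :=
      values_of_single_coord hv n02.symm n12.symm n01 z1 z2 d1 d2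
    simp only [edge_comm (g 2) (g 0), edge_comm (g 2) (g 1)] at hq e1 e2
    rcases Int.units_eq_one_or σ with rfl | rfl
    · refine ⟨9, mem_rowSpace_netVec (v (hC (g 2))).1 (v (edge (g 0) (g 2) (-1))).1
        {hC 0, hC 1, edge 0 1 (-1)} (by decide +kernel) ?_ ?_ ?_ ?_⟩ <;>
      simp [coordBlocks, coordWeight_edge, *]
    · rw [neg_neg] at e2 e4
      refine ⟨8, mem_rowSpace_netVec (v (hC (g 2))).1 (v (edge (g 0) (g 2) (-1))).1
        {hC 0, hC 1, edge 0 1 1} (by decide +kernel) ?_ ?_ ?_ ?_⟩ <;>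
      simp [coordBlocks, coordWeight_edge, *]

lemma exists_mem_rowSpace_of_spread_triple (hv : IsBParallel v) (h0 : ∀ m, v (hC m) = 0)
    (g : Fin 3 ↪o Fin n) (hg : Spread v (g 0) (g 1) (g 2)) :
    ∃ q, (fun h => (v (embB g h)).1) ∈ rowSpace k (tripleVec (Sum.inr q)) := by
  have n01 : g 0 ≠ g 1 := g.injective.ne (by decide)
  have n02 : g 0 ≠ g 2 := g.injective.ne (by decide)
  have n12 : g 1 ≠ g 2 := g.injective.ne (by decide)
  obtain ⟨ε, δ, hεδ⟩ := hg
  obtain ⟨e3, ⟨f1, f2, f3⟩ | ⟨f1, f2, f3⟩⟩ := values_of_spread hv h0 n01 n02 n12 hεδ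
  · refine ⟨some (ε, δ), mem_rowSpace_netVec (v (edge (g 0) (g 1) ε)).1
      (v (edge (g 0) (g 2) δ)).1
      {hC 0, hC 1, hC 2, edge 0 1 (-ε), edge 0 2 (-δ), edge 1 2 (ε * δ)} ?_ ?_ ?_ ?_ ?_⟩
    · clear hεδ e3 f1 f2 f3
      revert ε δ
      decide +kernel
    · simp [edgeBlocks]
    · simp [edgeBlocks]
    · simp [edgeBlocks, e3]
    · simp [h0, f1, f2, f3]
  · refine ⟨none, mem_rowSpace_netVec (v (edge (g 0) (g 1) ε)).1
      (v (edge (g 0) (g 2) δ)).1 {hC 0, hC 1, hC 2} (by decide +kernel) ?_ ?_ ?_ ?_⟩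
    · rcases Int.units_eq_one_or ε with rfl | rfl <;> simp_all [edgeBlocks]
    · rcases Int.units_eq_one_or δ with rfl | rfl <;> simp_all [edgeBlocks]
    · rw [e3] at f3
      rcases Int.units_eq_one_or (ε * δ) with h | h <;> rw [h] at e3 f3 <;>
        simp_all [edgeBlocks]
    · simp [h0]

lemma exists_mem_rowSpace_of_spread_quad (hv : IsBParallel v) (h0 : ∀ m, v (hC m) = 0)
    (g : Fin 4 ↪o Fin n) (hg : ∀ a b c, a ≠ b → a ≠ c → b ≠ c → Spread v (g a) (g b) (g c)) :
    ∃ q, (fun h => (v (embB g h)).1) ∈ rowSpace k (quadVec q) := by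
  have hne : ∀ {a b : Fin 4}, a ≠ b → g a ≠ g b := fun h => g.injective.ne h
  have n01 : g 0 ≠ g 1 := hne (by decide)
  have n02 : g 0 ≠ g 2 := hne (by decide)
  have n12 : g 1 ≠ g 2 := hne (by decide)
  have n03 : g 0 ≠ g 3 := hne (by decide)
  have n13 : g 1 ≠ g 3 := hne (by decide)
  have n23 : g 2 ≠ g 3 := hne (by decide)
  obtain ⟨ε, δ, h012⟩ := hg 0 1 2 (by decide) (by decide) (by decide)
  obtain ⟨e12, hd012⟩ := values_of_spread hv h0 n01 n02 n12 h012
  obtain ⟨γ, h013⟩ : ∃ γ, pdet (v (edge (g 0) (g 1) ε)) (v (edge (g 0) (g 3) γ)) ≠ 0 := by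
    obtain ⟨ε', γ, h⟩ := hg 0 1 3 (by decide) (by decide) (by decide)
    refine ⟨γ, ?_⟩
    by_cases hεε : ε' = ε
    · rwa [← hεε]
    · obtain rfl : ε' = -ε := Int.units_ne_iff_eq_neg.1 hεε
      rcases hd012 with hd | hd
      · rw [hd.1] at h
        simp at h
      · rwa [hd.1] at h
  obtain ⟨e13, hd013⟩ := values_of_spread hv h0 n01 n03 n13 h013
  -- the values on opposite edges agree
  have e03 : v (edge (g 0) (g 3) γ) = -(v (edge (g 0) (g 1) ε) + v (edge (g 0) (g 2) δ)) := by
    have p1 := hv.edge_edge _ _ _ _ γ (-(ε * δ)) n03 n12 n01 n02 n13.symm n23.symm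
    have p2 := hv.edge_edge _ _ _ _ (-(ε * γ)) δ n13 n02 n01.symm n12 n03.symm n23.symm
    rw [e12] at p1
    rw [e13] at p2
    simp only [pdet_neg_left, pdet_neg_right, pdet_add_left, pdet_add_right, neg_eq_zero] at p1 p2
    rw [eq_neg_iff_add_eq_zero]
    have s1 := pdet_swap (v (edge (g 0) (g 1) ε)) (v (edge (g 0) (g 3) γ))
    have s2 := pdet_swap (v (edge (g 0) (g 2) δ)) (v (edge (g 0) (g 3) γ))
    have s3 := pdet_swap (v (edge (g 0) (g 1) ε)) (v (edge (g 0) (g 2) δ))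
    apply eq_zero_of_pdet h012
    · simp only [pdet_add_right, pdet_self, zero_add]
      linear_combination p2 - p1 + s1
    · simp only [pdet_add_right, pdet_self, add_zero]
      linear_combination -p2 + s2 + s3
  have e13' : v (edge (g 1) (g 3) (-(ε * γ))) = v (edge (g 0) (g 2) δ) := by
    rw [e13, e03]
    abel
  have h023 : pdet (v (edge (g 0) (g 2) δ)) (v (edge (g 0) (g 3) γ)) ≠ 0 := by
    rw [e03]
    simp only [pdet_neg_right, pdet_add_right, pdet_self, add_zero, ne_eq, neg_eq_zero]
    exact pdet_ne_zero_comm.1 h012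
  obtain ⟨e23, hd023⟩ := values_of_spread hv h0 n02 n03 n23 h023
  have e23' : v (edge (g 2) (g 3) (-(δ * γ))) = v (edge (g 0) (g 1) ε) := by
    rw [e23, e03]
    abel
  have z1 : v (edge (g 0) (g 1) ε) ≠ 0 := left_ne_zero_of_pdet h012
  have z2 : v (edge (g 0) (g 2) δ) ≠ 0 := left_ne_zero_of_pdet h023
  rcases hd012 with ⟨a1, a2, a3⟩ | ⟨a1, a2, a3⟩
  · obtain ⟨b1, b2, b3⟩ := hd013.resolve_right (fun h => z1 (by rw [← h.1, a1]))
    obtain ⟨c1, c2, c3⟩ := hd023.resolve_right (fun h => z2 (by rw [← h.1, a2]))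
    refine ⟨some (ε, δ, γ), mem_rowSpace_netVec (v (edge (g 0) (g 1) ε)).1
      (v (edge (g 0) (g 2) δ)).1
      {hC 0, hC 1, hC 2, hC 3, edge 0 1 (-ε), edge 0 2 (-δ), edge 1 2 (ε * δ), edge 0 3 (-γ),
        edge 1 3 (ε * γ), edge 2 3 (δ * γ)} ?_ ?_ ?_ ?_ ?_⟩
    · clear h012 h013 h023 e12 e13 e23 e03 e13' e23' a1 a2 a3 b1 b2 b3 c1 c2 c3 hd013 hd023 z1 z2
      revert ε δ γ
      decide +kernel
    · simp [quadBlocks, e23']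
    · simp [quadBlocks, e13']
    · simp [quadBlocks, e12, e03]
    · simp [h0, a1, a2, a3, b2, b3, c3]
  · obtain ⟨b1, b2, b3⟩ := hd013.resolve_left (fun h => z1 (by rw [← a1, h.1]))
    obtain ⟨c1, c2, c3⟩ := hd023.resolve_left (fun h => z2 (by rw [← a2, h.1]))
    have hboth : ∀ {i j : Fin n} {σ : ℤˣ} {x : k × k}, v (edge i j σ) = x →
        v (edge i j (-σ)) = x → v (edge i j 1) = x ∧ v (edge i j (-1)) = x := by
      intro i j σ x h1 h2
      rcases Int.units_eq_one_or σ with rfl | rfl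
      · exact ⟨h1, h2⟩
      · exact ⟨h2, h1⟩
    have f01 := hboth rfl a1
    have f02 := hboth rfl a2
    have f03 := hboth e03 (b2.trans e03)
    have f12 := hboth e12 (by rw [neg_neg, a3, e12])
    have f13 := hboth e13' (by rw [neg_neg, b3, e13'])
    have f23 := hboth e23' (by rw [neg_neg, c3, e23'])
    refine ⟨none, mem_rowSpace_netVec (v (edge (g 0) (g 1) ε)).1 (v (edge (g 0) (g 2) δ)).1
      {hC 0, hC 1, hC 2, hC 3} (by decide +kernel) ?_ ?_ ?_ ?_⟩
    · simp [quadBlocks, f01, f23]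
    · simp [quadBlocks, f02, f13]
    · simp [quadBlocks, f03, f12]
    · simp [h0]

end Membership

/-! ### Subspaces attached to partitions -/

section RankTwo

variable {V ι : Type*} [AddCommGroup V] [Module ℂ V]
  {α : ι → Module.Dual ℂ V}

lemma le_ker_iff_mem_dualAnnihilator (X : Submodule ℂ V) (φ : Module.Dual ℂ V) :
    X ≤ LinearMap.ker φ ↔ φ ∈ X.dualAnnihilator := by
  rw [Submodule.mem_dualAnnihilator]
  rfl

variable [FiniteDimensional ℂ V]

lemma finrank_dualAnnihilator (X : Submodule ℂ V) :
    Module.finrank ℂ X.dualAnnihilator = Module.finrank ℂ (V ⧸ X) :=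
  (Subspace.quotEquivAnnihilator X).finrank_eq.symm

variable [Fintype ι]

/-- A rank two flat is cut out by two hyperplanes of the subarrangement. -/
lemma IsRankTwoFlat.exists_pair (hα : IsSimpleArr α) {S : Set ι} {X : Submodule ℂ V}
    (hX : IsRankTwoFlat α S X) : ∃ p ∈ S, ∃ q ∈ S, p ≠ q ∧
      ∀ h, X ≤ LinearMap.ker (α h) ↔ h ∈ flatClosure α p q := by
  obtain ⟨⟨B, hBS, rfl⟩, h2⟩ := hX
  obtain ⟨p, hp, q, hq, hpq⟩ : ∃ p ∈ B, ∃ q ∈ B, p ≠ q := by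
    by_contra! hcon
    rcases B.eq_empty_or_nonempty with rfl | ⟨p, hp⟩
    · have htop : (⨅ i ∈ (∅ : Set ι), LinearMap.ker (α i)) = ⊤ := by simp
      rw [htop, ← finrank_dualAnnihilator, Submodule.dualAnnihilator_top, finrank_bot] at h2
      omega
    · obtain rfl : B = {p} := Set.eq_singleton_iff_unique_mem.2 ⟨hp, fun q hq => hcon q hq p hp⟩
      rw [iInf_singleton, (α p).quotKerEquivRange.finrank_eq] at h2
      have := Submodule.finrank_le (LinearMap.range (α p))
      rw [Module.finrank_self] at this
      omega
  refine ⟨p, hBS hp, q, hBS hq, hpq, fun h => ?_⟩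
  have hle : Submodule.span ℂ {α p, α q} ≤
      (⨅ i ∈ B, LinearMap.ker (α i)).dualAnnihilator := by
    rw [Submodule.span_le]
    rintro x (rfl | rfl)
    · exact (le_ker_iff_mem_dualAnnihilator _ _).1 (iInf₂_le p hp)
    · exact (le_ker_iff_mem_dualAnnihilator _ _).1 (iInf₂_le q hq)
  rw [le_ker_iff_mem_dualAnnihilator, mem_flatClosure, Submodule.eq_of_le_of_finrank_eq hle
    ((finrank_span_pair hα hpq).trans ((finrank_dualAnnihilator _).trans h2).symm)]

lemma exists_isRankTwoFlat (hα : IsSimpleArr α) {S : Set ι} {p q : ι} (hp : p ∈ S) (hq : q ∈ S)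
    (hpq : p ≠ q) : ∃ X, IsRankTwoFlat α S X ∧
      ∀ h, X ≤ LinearMap.ker (α h) ↔ h ∈ flatClosure α p q := by
  have hker : ∀ φ : Module.Dual ℂ V, LinearMap.ker (α p) ⊓ LinearMap.ker (α q) ≤ LinearMap.ker φ ↔
      φ ∈ Submodule.span ℂ {α p, α q} := by
    intro φ
    constructor
    · intro h
      have := mem_span_of_iInf_ker_le_ker (L := ![α p, α q]) (K := φ) (by
        refine le_trans (le_inf ?_ ?_) h
        · exact iInf_le (fun i => LinearMap.ker (![α p, α q] i)) 0
        · exact iInf_le (fun i => LinearMap.ker (![α p, α q] i)) 1)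
      rwa [Matrix.range_cons_cons_empty] at this
    · intro h x hx
      obtain ⟨c, d, rfl⟩ := Submodule.mem_span_pair.1 h
      obtain ⟨h1, h2⟩ := Submodule.mem_inf.1 hx
      rw [LinearMap.mem_ker] at h1 h2 ⊢
      simp [h1, h2]
  refine ⟨LinearMap.ker (α p) ⊓ LinearMap.ker (α q), ⟨⟨{p, q}, ?_, ?_⟩, ?_⟩, fun h => ?_⟩
  · rintro x (rfl | rfl) <;> assumption
  · rw [iInf_pair]
  · have he : (LinearMap.ker (α p) ⊓ LinearMap.ker (α q)).dualAnnihilator =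
        Submodule.span ℂ {α p, α q} := by
      ext φ
      rw [← le_ker_iff_mem_dualAnnihilator, hker]
    rw [← finrank_dualAnnihilator, he, finrank_span_pair hα hpq]
  · rw [hker, mem_flatClosure]

end RankTwo

section PairComponent

variable {k : Type*} [Field k] {n : ℕ} {i j : Fin n} (h : i < j)

/-- The hyperplanes containing `x_i = x_j = 0`. -/
lemma flatClosure_hC_hC_of_lt :
    flatClosure (arrB n) (hC i) (hC j) = {hC i, hC j, hP h, hM h} := by
  rw [flatClosure_hC_hC h.ne, edge_of_lt h, edge_of_lt h]

lemma mem_compL_iff (u : BIdx n → k) :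
    u ∈ compL k h ↔ ∑ x, u x = 0 ∧ ∀ x ∉ flatClosure (arrB n) (hC i) (hC j), u x = 0 := by
  have hU : ∀ x, x ∈ ⋃₀ ({{hC i}, {hC j}, {hM h}, {hP h}} : Set (Set (BIdx n))) ↔
      x ∈ flatClosure (arrB n) (hC i) (hC j) := by
    intro x
    rw [flatClosure_hC_hC_of_lt h]
    simp
    tauto
  constructor
  · rintro ⟨h1, -, h3⟩
    exact ⟨h1, fun x hx => h3 x (fun hx' => hx ((hU x).1 hx'))⟩
  · rintro ⟨h1, h2⟩
    refine ⟨h1, fun X hX _ => ?_, fun x hx => h2 x (fun hx' => hx ((hU x).2 hx'))⟩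
    obtain ⟨p, hp, q, hq, hpq, hmem⟩ := hX.exists_pair (isSimpleArr_arrB n)
    rw [hU] at hp hq
    simp only [hmem]
    rw [flatClosure_eq_of_mem (isSimpleArr_arrB n) hpq hp hq]
    rw [← h1]
    refine Finset.sum_subset_zero_on_sdiff (Finset.subset_univ _) (fun x hx => ?_) fun _ _ => rfl
    exact h2 x (by simpa using hx)

lemma finrank_compL : Module.finrank k (compL k h) = 3 := by
  let φ : k × k × k →ₗ[k] (BIdx n → k) :=
    { toFun := fun z x => if x = hC i then z.1 else if x = hC j then z.2.1 else
        if x = hP h then z.2.2 else if x = hM h then -(z.1 + z.2.1 + z.2.2) else 0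
      map_add' := fun z w => by
        ext x
        simp only [Prod.fst_add, Prod.snd_add, Pi.add_apply]
        split_ifs <;> ring
      map_smul' := fun c z => by
        ext x
        simp only [Prod.smul_fst, Prod.smul_snd, smul_eq_mul, Pi.smul_apply, RingHom.id_apply]
        split_ifs <;> ring }
  have hij : j ≠ i := h.ne'
  have hinj : Function.Injective φ := by
    intro z w hzw
    have h1 := congrFun hzw (hC i)
    have h2 := congrFun hzw (hC j)
    have h3 := congrFun hzw (hP h)
    simp [φ, hij] at h1 h2 h3
    exact Prod.ext h1 (Prod.ext h2 h3)
  have hsum : ∀ u : BIdx n → k, (∀ x ∉ flatClosure (arrB n) (hC i) (hC j), u x = 0) →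
      ∑ x, u x = u (hC i) + u (hC j) + u (hP h) + u (hM h) := by
    intro u hu
    rw [← Finset.sum_subset (Finset.subset_univ (flatClosure (arrB n) (hC i) (hC j)))
      (fun x _ hx => hu x hx), flatClosure_hC_hC h.ne, sum_plane u h.ne, edge_of_lt h, edge_of_lt h]
  have hr : compL k h = LinearMap.range φ := by
    ext u
    rw [mem_compL_iff, LinearMap.mem_range]
    constructor
    · rintro ⟨h1, h2⟩
      rw [hsum u h2] at h1
      refine ⟨(u (hC i), u (hC j), u (hP h)), ?_⟩
      ext x
      by_cases hx : x ∈ flatClosure (arrB n) (hC i) (hC j)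
      · rw [flatClosure_hC_hC_of_lt h] at hx
        simp only [Finset.mem_insert, Finset.mem_singleton] at hx
        rcases hx with rfl | rfl | rfl | rfl
        · simp [φ]
        · simp [φ, hij]
        · simp [φ]
        · simp [φ]
          linear_combination -h1
      · rw [h2 x hx]
        rw [flatClosure_hC_hC_of_lt h] at hx
        simp only [Finset.mem_insert, Finset.mem_singleton, not_or] at hx
        simp [φ, hx]
    · rintro ⟨z, rfl⟩
      have h2 : ∀ x ∉ flatClosure (arrB n) (hC i) (hC j), φ z x = 0 := by
        intro x hx
        rw [flatClosure_hC_hC_of_lt h] at hx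
        simp only [Finset.mem_insert, Finset.mem_singleton, not_or] at hx
        simp [φ, hx]
      refine ⟨?_, h2⟩
      rw [hsum _ h2]
      simp [φ, hij]
  rw [hr, LinearMap.finrank_range_of_inj hinj]
  simp

/-- Vectors supported on the rank two flat of `B_2` with sum zero are resonant. -/
lemma compL_subset_arrResonance :
    (compL k h : Set (BIdx n → k)) ⊆ arrResonance k (arrB n) := by
  intro u hu
  obtain ⟨b, hb, hbu⟩ : ∃ b ∈ compL k h, b ∉ Submodule.span k {u} := by
    by_contra! hcon
    have h1 : Module.finrank k (compL k h) ≤ Module.finrank k (Submodule.span k {u}) :=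
      Submodule.finrank_mono fun b hb => hcon b hb
    have h2 : Module.finrank k (Submodule.span k {u}) ≤ 1 := by
      simpa using finrank_span_le_card (R := k) ({u} : Set (BIdx n → k))
    rw [finrank_compL] at h1
    omega
  refine (mem_arrResonance_iff (isSimpleArr_arrB n) u).2 ⟨b, hbu, ?_⟩
  intro p q _ x hx
  have key : ∀ w ∈ compL k h, ∀ p q, p ≠ q → p ∈ flatClosure (arrB n) (hC i) (hC j) →
      q ∈ flatClosure (arrB n) (hC i) (hC j) → ∑ y ∈ flatClosure (arrB n) p q, w y = 0 := by
    intro w hw p q hpq hp hq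
    obtain ⟨h1, h2⟩ := (mem_compL_iff h w).1 hw
    rw [flatClosure_eq_of_mem (isSimpleArr_arrB n) hpq hp hq, ← h1]
    exact Finset.sum_subset (Finset.subset_univ _) fun x _ hx => h2 x hx
  have hzero := fun (w : BIdx n → k) hw => ((mem_compL_iff h w).1 hw).2
  by_cases hxF : x ∈ flatClosure (arrB n) (hC i) (hC j)
  · by_cases hex : ∃ y ∈ flatClosure (arrB n) p q, y ≠ x ∧
      y ∈ flatClosure (arrB n) (hC i) (hC j)
    · obtain ⟨y, hy, hyx, hyF⟩ := hex
      rw [← flatClosure_eq_of_mem (isSimpleArr_arrB n) hyx hy hx, key u hu y x hyx hyF hxF,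
        key b hb y x hyx hyF hxF]
      simp
    · push Not at hex
      rw [Finset.sum_eq_single_of_mem x hx fun y hy hyx => hzero u hu y (hex y hy hyx),
        Finset.sum_eq_single_of_mem x hx fun y hy hyx => hzero b hb y (hex y hy hyx), mul_comm]
  · rw [hzero u hu x hxF, hzero b hb x hxF]
    simp

end PairComponent

/-! ### The partition subspaces on three coordinates -/

section TripleComponent

set_option synthInstance.maxHeartbeats 400000
set_option synthInstance.maxSize 2000

variable {k : Type*} [Field k]

lemma mem_rowSpace_tripleVec {q : Fin 11} {u : BIdx 3 → k} {x y : k}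
    (hz : ∀ h, (∀ s, h ∉ coordBlocks q s) → u h = 0)
    (h0 : ∀ h ∈ coordBlocks q 0, u h = coordWeight q h * x)
    (h1 : ∀ h ∈ coordBlocks q 1, u h = coordWeight q h * y)
    (h2 : ∀ h ∈ coordBlocks q 2, u h = coordWeight q h * -(x + y)) :
    u ∈ rowSpace k (tripleVec (Sum.inl q)) := by
  refine mem_rowSpace_netVec x y {h | ∀ s, h ∉ coordBlocks q s} (fun h => ?_) h0 h1 h2
    fun h hh => hz h (by simpa using hh)
  by_cases hh : ∃ s, h ∈ coordBlocks q s
  · obtain ⟨s, hs⟩ := hh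
    match s, hs with
    | 0, hs => exact Or.inl hs
    | 1, hs => exact Or.inr (Or.inl hs)
    | 2, hs => exact Or.inr (Or.inr (Or.inl hs))
  · exact Or.inr (Or.inr (Or.inr (by simpa using hh)))

/-- The solutions of the linear system attached to a partition on three coordinates. -/
lemma mem_rowSpace_of_sum_eq_zero [CharZero k] (q : Fin 11) {u : BIdx 3 → k}
    (hz : ∀ h, (∀ s, h ∉ coordBlocks q s) → u h = 0)
    (hF : ∀ s t p r, s ≠ t → p ∈ coordBlocks q s → r ∈ coordBlocks q t →
      ∑ h ∈ flatClosure (arrB 3) p r, u h = 0) :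
    u ∈ rowSpace k (tripleVec (Sum.inl q)) := by
  have hne : ∀ s t p r, s ≠ t → p ∈ coordBlocks q s → r ∈ coordBlocks q t → p ≠ r := by
    rintro s t p _ hst hp hr rfl
    exact hst (coordBlocks_disjoint q p s t hp hr)
  have hplane : ∀ i j : Fin 3, i ≠ j →
      (∃ p ∈ ({hC i, hC j, edge i j 1, edge i j (-1)} : Finset (BIdx 3)),
        ∃ r ∈ ({hC i, hC j, edge i j 1, edge i j (-1)} : Finset (BIdx 3)),
        ∃ s t, s ≠ t ∧ p ∈ coordBlocks q s ∧ r ∈ coordBlocks q t) →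
      u (hC i) + u (hC j) + u (edge i j 1) + u (edge i j (-1)) = 0 := by
    rintro i j hij ⟨p, hp, r, hr, s, t, hst, hps, hrt⟩
    have h1 := hF s t p r hst hps hrt
    rw [← flatClosure_hC_hC hij] at hp hr
    rw [flatClosure_eq_of_mem (isSimpleArr_arrB 3) (hne s t p r hst hps hrt) hp hr,
      flatClosure_hC_hC hij, sum_plane u hij] at h1
    exact h1
  have htri : ∀ ε δ : ℤˣ,
      (∃ p ∈ ({edge 0 1 ε, edge 1 2 δ, edge 0 2 (-(ε * δ))} : Finset (BIdx 3)),
        ∃ r ∈ ({edge 0 1 ε, edge 1 2 δ, edge 0 2 (-(ε * δ))} : Finset (BIdx 3)),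
        ∃ s t, s ≠ t ∧ p ∈ coordBlocks q s ∧ r ∈ coordBlocks q t) →
      u (edge 0 1 ε) + u (edge 1 2 δ) + u (edge 0 2 (-(ε * δ))) = 0 := by
    rintro ε δ ⟨p, hp, r, hr, s, t, hst, hps, hrt⟩
    have h1 := hF s t p r hst hps hrt
    have h01 : (0 : Fin 3) ≠ 1 := by decide
    have h02 : (0 : Fin 3) ≠ 2 := by decide
    have h12 : (1 : Fin 3) ≠ 2 := by decide
    rw [← flatClosure_triangle ε δ h01 h02 h12] at hp hr
    rw [flatClosure_eq_of_mem (isSimpleArr_arrB 3) (hne s t p r hst hps hrt) hp hr,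
      flatClosure_triangle ε δ h01 h02 h12, sum_triangle u ε δ h01 h02 h12] at h1
    exact h1
  clear hF hne
  have h01 := hplane 0 1 (by decide)
  have h02 := hplane 0 2 (by decide)
  have h12 := hplane 1 2 (by decide)
  have tpp := htri 1 1
  have tpm := htri 1 (-1)
  have tmp := htri (-1) 1
  have tmm := htri (-1) (-1)
  simp only [mul_one, mul_neg, neg_neg] at tpp tpm tmp tmm
  clear hplane htri
  -- a flat gives an equation if it meets two blocks, and hyperplanes outside the blocks drop out;
  -- the remaining linear system is solved separately for each partition
  have close := fun x y => mem_rowSpace_tripleVec (x := x) (y := y) hz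
  fin_cases q
  · specialize h01 (by decide +kernel)
    specialize h02 (by decide +kernel)
    specialize h12 (by decide +kernel)
    specialize tmm (by decide +kernel)
    have z0 := hz (edge 0 1 1) (by decide +kernel)
    have z1 := hz (edge 0 2 1) (by decide +kernel)
    have z2 := hz (edge 1 2 1) (by decide +kernel)
    refine close (u (hC 0)) (u (hC 1)) ?_ ?_ ?_ <;>
      simp [coordBlocks, coordWeight_edge] <;> grind
  · specialize h01 (by decide +kernel)
    specialize h02 (by decide +kernel)
    specialize h12 (by decide +kernel)
    specialize tmp (by decide +kernel)
    have z0 := hz (edge 0 1 1) (by decide +kernel)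
    have z1 := hz (edge 0 2 (-1)) (by decide +kernel)
    have z2 := hz (edge 1 2 (-1)) (by decide +kernel)
    refine close (u (hC 0)) (u (hC 1)) ?_ ?_ ?_ <;>
      simp [coordBlocks, coordWeight_edge] <;> grind
  · specialize h01 (by decide +kernel)
    specialize h02 (by decide +kernel)
    specialize h12 (by decide +kernel)
    specialize tpp (by decide +kernel)
    have z0 := hz (edge 0 1 (-1)) (by decide +kernel)
    have z1 := hz (edge 0 2 1) (by decide +kernel)
    have z2 := hz (edge 1 2 (-1)) (by decide +kernel)
    refine close (u (hC 0)) (u (hC 1)) ?_ ?_ ?_ <;>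
      simp [coordBlocks, coordWeight_edge] <;> grind
  · specialize h01 (by decide +kernel)
    specialize h02 (by decide +kernel)
    specialize h12 (by decide +kernel)
    specialize tpm (by decide +kernel)
    have z0 := hz (edge 0 1 (-1)) (by decide +kernel)
    have z1 := hz (edge 0 2 (-1)) (by decide +kernel)
    have z2 := hz (edge 1 2 1) (by decide +kernel)
    refine close (u (hC 0)) (u (hC 1)) ?_ ?_ ?_ <;>
      simp [coordBlocks, coordWeight_edge] <;> grind
  · specialize h01 (by decide +kernel)
    specialize h02 (by decide +kernel)
    specialize tpm (by decide +kernel)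
    specialize tmm (by decide +kernel)
    have z0 := hz (hC 1) (by decide +kernel)
    have z1 := hz (hC 2) (by decide +kernel)
    have z2 := hz (edge 1 2 1) (by decide +kernel)
    refine close (u (hC 0)) (u (edge 0 1 (-1))) ?_ ?_ ?_ <;>
      simp [coordBlocks, coordWeight_edge] <;> grind
  · specialize h01 (by decide +kernel)
    specialize h02 (by decide +kernel)
    specialize tpp (by decide +kernel)
    specialize tmp (by decide +kernel)
    have z0 := hz (hC 1) (by decide +kernel)
    have z1 := hz (hC 2) (by decide +kernel)
    have z2 := hz (edge 1 2 (-1)) (by decide +kernel)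
    refine close (u (hC 0)) (u (edge 0 1 (-1))) ?_ ?_ ?_ <;>
      simp [coordBlocks, coordWeight_edge] <;> grind
  · specialize h01 (by decide +kernel)
    specialize h12 (by decide +kernel)
    specialize tpp (by decide +kernel)
    specialize tmm (by decide +kernel)
    have z0 := hz (hC 0) (by decide +kernel)
    have z1 := hz (hC 2) (by decide +kernel)
    have z2 := hz (edge 0 2 1) (by decide +kernel)
    refine close (u (hC 1)) (u (edge 0 1 (-1))) ?_ ?_ ?_ <;>
      simp [coordBlocks, coordWeight_edge] <;> grind
  · specialize h01 (by decide +kernel)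
    specialize h12 (by decide +kernel)
    specialize tpm (by decide +kernel)
    specialize tmp (by decide +kernel)
    have z0 := hz (hC 0) (by decide +kernel)
    have z1 := hz (hC 2) (by decide +kernel)
    have z2 := hz (edge 0 2 (-1)) (by decide +kernel)
    refine close (u (hC 1)) (u (edge 0 1 (-1))) ?_ ?_ ?_ <;>
      simp [coordBlocks, coordWeight_edge] <;> grind
  · specialize h02 (by decide +kernel)
    specialize h12 (by decide +kernel)
    specialize tmp (by decide +kernel)
    specialize tmm (by decide +kernel)
    have z0 := hz (hC 0) (by decide +kernel)
    have z1 := hz (hC 1) (by decide +kernel)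
    have z2 := hz (edge 0 1 1) (by decide +kernel)
    refine close (u (hC 2)) (u (edge 0 2 (-1))) ?_ ?_ ?_ <;>
      simp [coordBlocks, coordWeight_edge] <;> grind
  · specialize h02 (by decide +kernel)
    specialize h12 (by decide +kernel)
    specialize tpp (by decide +kernel)
    specialize tpm (by decide +kernel)
    have z0 := hz (hC 0) (by decide +kernel)
    have z1 := hz (hC 1) (by decide +kernel)
    have z2 := hz (edge 0 1 (-1)) (by decide +kernel)
    refine close (u (hC 2)) (u (edge 0 2 (-1))) ?_ ?_ ?_ <;>
      simp [coordBlocks, coordWeight_edge] <;> grind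
  · specialize h01 (by decide +kernel)
    specialize h02 (by decide +kernel)
    specialize h12 (by decide +kernel)
    specialize tpp (by decide +kernel)
    specialize tpm (by decide +kernel)
    specialize tmp (by decide +kernel)
    specialize tmm (by decide +kernel)
    refine close (u (edge 1 2 1)) (u (edge 0 2 1)) ?_ ?_ ?_ <;>
      simp [coordBlocks, coordWeight_edge] <;> grind

end TripleComponent

/-! ### The partition subspaces on three of the coordinates -/

section TripleComponentEmbedded

variable {k : Type*} [Field k] [CharZero k] {n : ℕ}

/-- The partition of a subarrangement on the three coordinates in the range of `g`. -/
def tripleParts (g : Fin 3 ↪o Fin n) (q : Fin 11) : Set (Set (BIdx n)) :=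
  Set.range fun s => embB g '' (coordBlocks q s : Set (BIdx 3))

lemma mem_sUnion_tripleParts {g : Fin 3 ↪o Fin n} {q : Fin 11} {h : BIdx n} :
    h ∈ ⋃₀ tripleParts g q ↔ ∃ s, ∃ h' ∈ coordBlocks q s, embB g h' = h := by
  simp [tripleParts]

lemma range_fin_three {β : Type*} (f : Fin 3 → β) : Set.range f = {f 0, f 1, f 2} := by
  ext x
  simp [Fin.exists_fin_succ, eq_comm]

/-- The local condition on a flat that meets two blocks forces the sum of the integer pencil over
that flat to vanish, since values in different blocks are not parallel. -/
lemma sum_tripleVec_flatClosure (q : Fin 11) {p r : BIdx 3} (hpr : p ≠ r)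
    (hex : ∃ h ∈ flatClosure (arrB 3) p r, ∃ h' ∈ flatClosure (arrB 3) p r, ∃ s t, s ≠ t ∧
      h ∈ coordBlocks q s ∧ h' ∈ coordBlocks q t) {u : BIdx 3 → k}
    (hu : u ∈ rowSpace k (tripleVec (Sum.inl q))) :
    ∑ h ∈ flatClosure (arrB 3) p r, u h = 0 := by
  obtain ⟨h, hh, h', hh', s, t, hst, hs, ht⟩ := hex
  set P := tripleVec (Sum.inl q) with hP
  let w₁ : BIdx 3 → k := fun h => ((P h).1 : k)
  let w₂ : BIdx 3 → k := fun h => ((P h).2 : k)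
  have hp := (isLocallyParallel_arrB_iff _ _).2 (isBParallel_of_mem_rowSpace
    (isBParallel_tripleVec (Sum.inl q)) (u := w₁) (b := w₂) ⟨1, 0, by simp [w₁, hP]⟩
    ⟨0, 1, by simp [w₂, hP]⟩) p r hpr
  have e1 := hp h hh
  have e2 := hp h' hh'
  have hdet : w₁ h * w₂ h' - w₂ h * w₁ h' ≠ 0 := by
    intro h0
    refine hst (same_block_of_pdet q h h' s t hs ht ?_)
    apply Int.cast_injective (α := k)
    simpa [pdet, w₁, w₂] using h0
  have s1 : ∑ h ∈ flatClosure (arrB 3) p r, w₁ h = 0 := by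
    refine (mul_eq_zero.1 ?_).resolve_left hdet
    linear_combination w₁ h * e2 - w₁ h' * e1
  have s2 : ∑ h ∈ flatClosure (arrB 3) p r, w₂ h = 0 := by
    refine (mul_eq_zero.1 ?_).resolve_left hdet
    linear_combination w₂ h * e2 - w₂ h' * e1
  obtain ⟨x, y, hxy⟩ := hu
  simp only [hxy, Finset.sum_add_distrib, ← Finset.mul_sum]
  change x * ∑ h ∈ flatClosure (arrB 3) p r, w₁ h + y * ∑ h ∈ flatClosure (arrB 3) p r, w₂ h = 0
  rw [s1, s2]
  ring

/-- The equations of a partition on three coordinates cut out the row space of its integer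
pencil. -/
theorem partitionComponent_tripleParts (g : Fin 3 ↪o Fin n) (q : Fin 11) :
    partitionComponent k (arrB n) (tripleParts g q) =
      rowSpace k (Function.extend (embB g) (tripleVec (Sum.inl q)) 0) := by
  ext u
  rw [mem_rowSpace_extend_iff]
  have hU : ∀ s, ∀ h ∈ coordBlocks q s, embB g h ∈ ⋃₀ tripleParts g q := fun s h hh =>
    mem_sUnion_tripleParts.2 ⟨s, h, hh, rfl⟩
  have hblock : ∀ h s, embB g h ∈ embB g '' (coordBlocks q s : Set (BIdx 3)) ↔
      h ∈ coordBlocks q s := fun h s => by simp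
  have hext : (∀ h, h ∉ Set.range (embB g) → u h = 0) →
      u = Function.extend (embB g) (fun h => u (embB g h)) 0 := by
    intro h0
    ext h
    by_cases hh : ∃ h', embB g h' = h
    · obtain ⟨h, rfl⟩ := hh
      rw [(embB g).injective.extend_apply]
    · rw [Function.extend_apply' _ _ _ hh, h0 h hh]
      rfl
  constructor
  · rintro ⟨h1, h2, h3⟩
    have h0 : ∀ h, h ∉ Set.range (embB g) → u h = 0 := fun h hh => h3 h fun hh' => by
      obtain ⟨s, h', -, rfl⟩ := mem_sUnion_tripleParts.1 hh'
      exact hh ⟨h', rfl⟩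
    refine ⟨mem_rowSpace_of_sum_eq_zero q (fun h hh => h3 _ fun hh' => ?_)
      fun s t p r hst hp hr => ?_, h0⟩
    · obtain ⟨s, h', hs, he⟩ := mem_sUnion_tripleParts.1 hh'
      exact hh s ((embB g).injective he ▸ hs)
    · have hpr : p ≠ r := by
        rintro rfl
        exact hst (coordBlocks_disjoint q p s t hp hr)
      obtain ⟨X, hX, hmem⟩ := exists_isRankTwoFlat (isSimpleArr_arrB n) (hU s p hp) (hU t r hr)
        ((embB g).injective.ne hpr)
      have h4 := h2 X hX ?_
      · rw [← sum_flatClosure_extend (isSubArr_embB g), ← hext h0, ← h4]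
        refine Finset.sum_congr ?_ fun _ _ => rfl
        ext h
        simp [hmem]
      · rintro ⟨_, ⟨a, rfl⟩, ha⟩
        have e1 := (hblock _ _).1 (ha _ (hU s p hp) ((hmem _).2 (left_mem_flatClosure _ _)))
        have e2 := (hblock _ _).1 (ha _ (hU t r hr) ((hmem _).2 (right_mem_flatClosure _ _)))
        exact hst ((coordBlocks_disjoint q p s a hp e1).trans
          (coordBlocks_disjoint q r t a hr e2).symm)
  · rintro ⟨h1, h0⟩
    have hz : ∀ h, (∀ s, h ∉ coordBlocks q s) → u (embB g h) = 0 := by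
      intro h hh
      obtain ⟨x, y, hxy⟩ := h1
      have := (tripleVec_inl_ne_zero_iff q h).not_right.2 (by simpa using hh)
      exact (hxy h).trans (by simp [this])
    refine ⟨?_, fun X hX hP => ?_, fun h hh => ?_⟩
    · obtain ⟨x, y, hxy⟩ := h1
      rw [← Fintype.sum_of_injective _ (embB g).injective (fun h => u (embB g h)) u h0
        fun _ => rfl]
      have h1 := congrArg (fun z : ℤ × ℤ => (z.1 : k)) (sum_tripleVec q)
      have h2 := congrArg (fun z : ℤ × ℤ => (z.2 : k)) (sum_tripleVec q)
      simp only [Prod.fst_sum, Prod.snd_sum, Int.cast_sum, Prod.fst_zero, Prod.snd_zero,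
        Int.cast_zero] at h1 h2
      refine (Finset.sum_congr rfl fun h _ => hxy h).trans ?_
      rw [Finset.sum_add_distrib, ← Finset.mul_sum, ← Finset.mul_sum, h1, h2]
      ring
    · obtain ⟨p, hp, r, hr, hpr, hmem⟩ := hX.exists_pair (isSimpleArr_arrB n)
      obtain ⟨s, p, hs, rfl⟩ := mem_sUnion_tripleParts.1 hp
      obtain ⟨t, r, ht, rfl⟩ := mem_sUnion_tripleParts.1 hr
      have hpr' : p ≠ r := fun h => hpr (congrArg _ h)
      have := sum_tripleVec_flatClosure q hpr' ?_ h1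
      · rw [← sum_flatClosure_extend (isSubArr_embB g), ← hext h0] at this
        rw [← this]
        refine Finset.sum_congr ?_ fun _ _ => rfl
        ext h
        simp [hmem]
      · by_contra! hcon
        refine hP ⟨_, ⟨s, rfl⟩, fun i hi hXi => ?_⟩
        obtain ⟨a, i, ha, rfl⟩ := mem_sUnion_tripleParts.1 hi
        rw [hmem, isSubArr_embB g] at hXi
        obtain rfl : s = a := by
          by_contra hsa
          exact hcon p (left_mem_flatClosure _ _) i hXi s a hsa hs ha
        exact ⟨i, ha, rfl⟩
    · by_cases hr : h ∈ Set.range (embB g)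
      · obtain ⟨h, rfl⟩ := hr
        exact hz h fun s hs => hh (hU s h hs)
      · exact h0 h hr

/-- The order embedding with values `i < j < l`. -/
def tripleEmb {i j l : Fin n} (hij : i < j) (hjl : j < l) : Fin 3 ↪o Fin n :=
  OrderEmbedding.ofStrictMono ![i, j, l] (by
    simp [Fin.strictMono_iff_lt_succ, Fin.forall_fin_two, hij, hjl])

lemma partY_eq {i j l : Fin n} (hij : i < j) (hjl : j < l) (q : Fin 10) :
    partY hij hjl q = tripleParts (tripleEmb hij hjl) q.castSucc := by
  have h0 : tripleEmb hij hjl 0 = i := rfl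
  have h1 : tripleEmb hij hjl 1 = j := rfl
  have h2 : tripleEmb hij hjl 2 = l := rfl
  rw [tripleParts, range_fin_three]
  fin_cases q <;>
    simp [partY, coordBlocks, Set.image_insert_eq, h0, h1, h2, edge_of_lt hij, edge_of_lt hjl,
      edge_of_lt (hij.trans hjl)]

theorem compY_eq_rowSpace {i j l : Fin n} (hij : i < j) (hjl : j < l) (q : Fin 10) :
    compY k hij hjl q = rowSpace k (Function.extend (embB (tripleEmb hij hjl))
      (tripleVec (Sum.inl q.castSucc)) 0) := by
  rw [compY, partY_eq, partitionComponent_tripleParts]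

theorem compZ_eq_rowSpace {i j l : Fin n} (hij : i < j) (hjl : j < l) :
    compZ k hij hjl = rowSpace k (Function.extend (embB (tripleEmb hij hjl))
      (tripleVec (Sum.inl (Fin.last 10))) 0) := by
  have h0 : tripleEmb hij hjl 0 = i := rfl
  have h1 : tripleEmb hij hjl 1 = j := rfl
  have h2 : tripleEmb hij hjl 2 = l := rfl
  rw [← partitionComponent_tripleParts, compZ, tripleParts, range_fin_three]
  simp [coordBlocks, Set.image_insert_eq, h0, h1, h2, edge_of_lt hij, edge_of_lt hjl,
    edge_of_lt (hij.trans hjl), Fin.last]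

end TripleComponentEmbedded

/-! ### The family of components -/

section Family

/-- Indices of the components: a choice of three, four or two coordinates, with a partition on
these coordinates in the first two cases. -/
abbrev ComponentIndex (n : ℕ) : Type :=
  ((Fin 3 ↪o Fin n) × TripleKind ⊕ (Fin 4 ↪o Fin n) × QuadKind) ⊕ (Fin 2 ↪o Fin n)

/-- The components of the first resonance variety of the type B arrangement. -/
noncomputable def component (k : Type*) [Field k] {n : ℕ} :
    ComponentIndex n → Submodule k (BIdx n → k)
  | Sum.inl (Sum.inl (g, q)) => rowSpace k (Function.extend (embB g) (tripleVec q) 0)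
  | Sum.inl (Sum.inr (g, q)) => rowSpace k (Function.extend (embB g) (quadVec q) 0)
  | Sum.inr g => compL k (g.strictMono (by decide : (0 : Fin 2) < 1))

/-- The coordinates in the equations of the hyperplanes on which some member of `W` does not
vanish. -/
def touched {k : Type*} [Field k] {n : ℕ} (W : Submodule k (BIdx n → k)) : Set (Fin n) :=
  {a | ∃ u ∈ W, ∃ h, u h ≠ 0 ∧ a ∈ vertices h}

/-- The coordinates chosen by the index of a component. -/
def ComponentIndex.coords {n : ℕ} : ComponentIndex n → Set (Fin n)
  | Sum.inl (Sum.inl (g, _)) => Set.range g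
  | Sum.inl (Sum.inr (g, _)) => Set.range g
  | Sum.inr g => Set.range g

variable {k : Type*} [Field k] {m n : ℕ}

lemma vertices_embB (g : Fin m ↪o Fin n) (h : BIdx m) :
    vertices (embB g h) = (vertices h).map g.toEmbedding := by
  rcases h with i | e
  · rfl
  · change ({g e.1.1.1, g e.1.1.2} : Finset (Fin n)) = Finset.map _ {e.1.1.1, e.1.1.2}
    simp

lemma extend_ne_zero_iff {ι ι' M : Type*} [Zero M] (f : ι' ↪ ι) (P : ι' → M) (h : ι) :
    Function.extend f P 0 h ≠ 0 ↔ ∃ h', f h' = h ∧ P h' ≠ 0 := by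
  constructor
  · intro hh
    by_cases hx : ∃ h', f h' = h
    · obtain ⟨h', rfl⟩ := hx
      rw [f.injective.extend_apply] at hh
      exact ⟨h', rfl, hh⟩
    · exact absurd (Function.extend_apply' _ _ _ hx) hh
  · rintro ⟨h', rfl, hh⟩
    rwa [f.injective.extend_apply]

lemma touched_rowSpace_extend [CharZero k] (g : Fin m ↪o Fin n) {P : BIdx m → ℤ × ℤ}
    (hP : ∀ a, ∃ h, P h ≠ 0 ∧ a ∈ vertices h) :
    touched (rowSpace k (Function.extend (embB g) P 0)) = Set.range g := by
  ext a
  constructor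
  · rintro ⟨u, hu, h, hne, ha⟩
    obtain ⟨h, rfl, -⟩ :=
      (extend_ne_zero_iff _ _ _).1 (exists_mem_rowSpace_ne_zero_iff.1 ⟨u, hu, hne⟩)
    rw [vertices_embB, Finset.mem_map] at ha
    obtain ⟨b, -, rfl⟩ := ha
    exact ⟨b, rfl⟩
  · rintro ⟨b, rfl⟩
    obtain ⟨h, hne, hb⟩ := hP b
    obtain ⟨u, hu, hne'⟩ := (exists_mem_rowSpace_ne_zero_iff (k := k)).2
      ((extend_ne_zero_iff (embB g) P (embB g h)).2 ⟨h, rfl, hne⟩)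
    refine ⟨u, hu, _, hne', ?_⟩
    rw [vertices_embB]
    exact Finset.mem_map_of_mem _ hb

lemma touched_compL {i j : Fin n} (h : i < j) : touched (compL k h) = {i, j} := by
  have hij : i ≠ j := h.ne
  ext a
  constructor
  · rintro ⟨u, hu, x, hne, ha⟩
    have hx : x ∈ flatClosure (arrB n) (hC i) (hC j) :=
      by_contra fun hx => hne (((mem_compL_iff h u).1 hu).2 x hx)
    rw [flatClosure_hC_hC_of_lt h] at hx
    simp only [Finset.mem_insert, Finset.mem_singleton] at hx
    rcases hx with rfl | rfl | rfl | rfl <;> simp [vertices] at ha <;> simp [ha]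
  · intro ha
    refine ⟨Pi.single (hC i) 1 - Pi.single (hC j) 1, (mem_compL_iff h _).2 ⟨?_, fun x hx => ?_⟩, ?_⟩
    · simp
    · have h1 : x ≠ hC i := fun e => hx (e ▸ left_mem_flatClosure _ _)
      have h2 : x ≠ hC j := fun e => hx (e ▸ right_mem_flatClosure _ _)
      simp [h1, h2]
    · rcases ha with rfl | rfl
      · exact ⟨hC a, by simp [hij], by simp [vertices]⟩
      · exact ⟨hC a, by simp [hij.symm], by simp [vertices]⟩

lemma touched_component [CharZero k] (c : ComponentIndex n) :
    touched (component k c) = c.coords := by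
  rcases c with (⟨g, q⟩ | ⟨g, q⟩) | g
  · exact touched_rowSpace_extend g (vertices_tripleVec q)
  · exact touched_rowSpace_extend g (vertices_quadVec q)
  · refine (touched_compL _).trans ?_
    ext a
    simp [ComponentIndex.coords, eq_comm]

lemma finrank_component_inl (c) : Module.finrank k (component k (n := n) (Sum.inl c)) = 2 := by
  rcases c with ⟨g, q⟩ | ⟨g, q⟩
  · exact finrank_rowSpace ((hasUnits_tripleVec q).extend _)
  · exact finrank_rowSpace ((hasUnits_quadVec q).extend _)

lemma finrank_component_inr (g) : Module.finrank k (component k (n := n) (Sum.inr g)) = 3 :=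
  finrank_compL _

lemma ncard_range_orderEmbedding (g : Fin m ↪o Fin n) : (Set.range g).ncard = m := by
  rw [← Set.image_univ, Set.ncard_image_of_injective _ g.injective, Set.ncard_univ, Nat.card_fin]

lemma eq_zero_iff_of_rowSpace_extend_eq [CharZero k] {ι ι' : Type*} (f : ι' ↪ ι)
    {P Q : ι' → ℤ × ℤ}
    (h : rowSpace k (Function.extend f P 0) = rowSpace k (Function.extend f Q 0)) (x : ι') :
    P x = 0 ↔ Q x = 0 := by
  rw [← not_iff_not]
  change P x ≠ 0 ↔ Q x ≠ 0
  rw [← f.injective.extend_apply P 0 x, ← f.injective.extend_apply Q 0 x,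
    ← exists_mem_rowSpace_ne_zero_iff (k := k), h, exists_mem_rowSpace_ne_zero_iff]

/-- A component is determined by the coordinates that it touches and by its support. -/
lemma component_injective [CharZero k] : Function.Injective (component k (n := n)) := by
  intro c d h
  have ht : c.coords = d.coords := by rw [← touched_component (k := k), h, touched_component]
  have hn := congrArg Set.ncard ht
  rcases c with (⟨g, q⟩ | ⟨g, q⟩) | g <;> rcases d with (⟨g', r⟩ | ⟨g', r⟩) | g' <;>
    simp only [ComponentIndex.coords, ncard_range_orderEmbedding] at hn ht <;>
    first
    | omega
    | obtain rfl := OrderEmbedding.range_inj.1 ht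
  · rw [tripleVec_injective_support q r (eq_zero_iff_of_rowSpace_extend_eq (k := k) _ h)]
  · rw [quadVec_injective_support q r (eq_zero_iff_of_rowSpace_extend_eq (k := k) _ h)]
  · rfl

lemma component_antichain [CharZero k] (c d : ComponentIndex n)
    (h : component k c ≤ component k d) : c = d := by
  have hle := Submodule.finrank_mono h
  have heq : Module.finrank k (component k c) = Module.finrank k (component k d) →
      c = d := fun he => component_injective (Submodule.eq_of_le_of_finrank_eq h he)
  rcases c with c | g <;> rcases d with d | g'
  · exact heq (by rw [finrank_component_inl, finrank_component_inl])
  · exfalso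
    have ht : ComponentIndex.coords (Sum.inl c) ⊆ ComponentIndex.coords (Sum.inr g') := by
      rw [← touched_component (k := k), ← touched_component (k := k)]
      rintro a ⟨u, hu, x⟩
      exact ⟨u, h hu, x⟩
    have := Set.ncard_le_ncard ht
    rcases c with ⟨g, q⟩ | ⟨g, q⟩ <;>
      simp only [ComponentIndex.coords, ncard_range_orderEmbedding] at this <;> omega
  · rw [finrank_component_inl, finrank_component_inr] at hle
    omega
  · exact heq (by rw [finrank_component_inr, finrank_component_inr])

lemma component_subset_arrResonance (c : ComponentIndex n) :
    (component k c : Set (BIdx n → k)) ⊆ arrResonance k (arrB n) := by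
  rcases c with (⟨g, q⟩ | ⟨g, q⟩) | g
  · exact rowSpace_extend_subset_arrResonance g (isBParallel_tripleVec q) (hasUnits_tripleVec q)
  · exact rowSpace_extend_subset_arrResonance g (isBParallel_quadVec q) (hasUnits_quadVec q)
  · exact compL_subset_arrResonance _

lemma card_orderEmbedding (m n : ℕ) : Nat.card (Fin m ↪o Fin n) = n.choose m := by
  rw [Nat.card_congr Set.powersetCard.ofFinEmbEquiv, Set.powersetCard.card, Nat.card_fin]

instance (m n : ℕ) : Finite (Fin m ↪o Fin n) := .of_equiv _ Set.powersetCard.ofFinEmbEquiv.symm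

lemma card_triple_add_quad (n : ℕ) :
    Nat.card ((Fin 3 ↪o Fin n) × TripleKind ⊕ (Fin 4 ↪o Fin n) × QuadKind) =
      16 * n.choose 3 + 9 * n.choose 4 := by
  rw [Nat.card_sum, Nat.card_prod, Nat.card_prod, card_orderEmbedding, card_orderEmbedding,
    Nat.card_eq_fintype_card, Nat.card_eq_fintype_card]
  have h1 : Fintype.card TripleKind = 16 := rfl
  have h2 : Fintype.card QuadKind = 9 := rfl
  rw [h1, h2, mul_comm, mul_comm (n.choose 4)]

end Family

/-! ### Classification of the resonant vectors -/

section Classification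

variable {k : Type*} [Field k] {n : ℕ}

lemma mem_rowSpace_extend_of_supportedOn {v : BIdx n → k × k} {S : Finset (Fin n)}
    (hS : SupportedOn v S) {m : ℕ} (hm : S.card = m) {P : BIdx m → ℤ × ℤ}
    (h : (fun h => (v (embB (S.orderEmbOfFin hm) h)).1) ∈ rowSpace k P) :
    (fun h => (v h).1) ∈ rowSpace k (Function.extend (embB (S.orderEmbOfFin hm)) P 0) :=
  (mem_rowSpace_extend_iff _ _ _).2
    ⟨h, fun x hx => by rw [hS.eq_zero_of_notMem_range hm hx]; rfl⟩

lemma mem_flatClosure_of_mem_range {g : Fin 2 ↪o Fin n} {h : BIdx n}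
    (hh : h ∈ Set.range (embB g)) : h ∈ flatClosure (arrB n) (hC (g 0)) (hC (g 1)) := by
  obtain ⟨h, rfl⟩ := hh
  rw [← embB_hC, ← embB_hC, isSubArr_embB g, flatClosure_hC_hC (by decide)]
  revert h
  decide

/-- A pencil supported on two coordinates has coordinate sum zero, because otherwise all its values
would be parallel. -/
lemma mem_compL_of_supportedOn {v : BIdx n → k × k} (hv : IsBParallel v)
    (hnd : ∃ p q, pdet (v p) (v q) ≠ 0) {S : Finset (Fin n)} (hS : SupportedOn v S)
    (hm : S.card = 2) :
    (fun h => (v h).1) ∈ component k (Sum.inr (S.orderEmbOfFin hm)) := by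
  set g := S.orderEmbOfFin hm with hg
  have hij : g 0 ≠ g 1 := g.injective.ne (by decide)
  have hz : ∀ x ∉ flatClosure (arrB n) (hC (g 0)) (hC (g 1)), v x = 0 := fun x hx =>
    hS.eq_zero_of_notMem_range hm fun hr => hx (mem_flatClosure_of_mem_range hr)
  refine (mem_compL_iff _ _).2 ⟨?_, fun x hx => by rw [hz x hx]; rfl⟩
  have hsum : ∑ x, v x = 0 := by
    rw [← Finset.sum_subset (Finset.subset_univ _) fun x _ hx => hz x hx, flatClosure_hC_hC hij,
      sum_plane v hij]
    refine (hv.plane_dichotomy hij).resolve_right ?_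
    rintro ⟨h1, h2, h3, h4⟩
    obtain ⟨p, q, hpq⟩ := hnd
    have hp : p ∈ flatClosure (arrB n) (hC (g 0)) (hC (g 1)) :=
      by_contra fun hp => hpq (by rw [hz p hp, pdet_zero_left])
    have hq : q ∈ flatClosure (arrB n) (hC (g 0)) (hC (g 1)) :=
      by_contra fun hq => hpq (by rw [hz q hq, pdet_zero_right])
    rw [flatClosure_hC_hC hij] at hp hq
    simp only [Finset.mem_insert, Finset.mem_singleton] at hp hq
    have h1' := pdet_eq_zero_comm.1 h1
    have h2' := fun ε => pdet_eq_zero_comm.1 (h2 ε)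
    have h3' := fun ε => pdet_eq_zero_comm.1 (h3 ε)
    have h4' := pdet_eq_zero_comm.1 h4
    rcases hp with rfl | rfl | rfl | rfl <;> rcases hq with rfl | rfl | rfl | rfl <;>
      exact hpq (by simp only [h1, h2, h3, h4, h1', h2', h3', h4', pdet_self])
  simpa [Prod.fst_sum] using congrArg Prod.fst hsum

/-- The possible positions of a resonant vector `u`, with `b` a witness of its resonance. -/
lemma classification [CharZero k] {u b : BIdx n → k} (hbu : b ∉ Submodule.span k {u})
    (hu : u ≠ 0) (h : IsLocallyParallel (arrB n) u b) :
    (∃ g, u ∈ component k (Sum.inr g)) ∨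
      (∃ g, ∃ q : Fin 11, u ∈ component k (Sum.inl (Sum.inl (g, Sum.inl q)))) ∨
      ((∀ i, u (hC i) = 0) ∧ (∀ i, b (hC i) = 0) ∧ ∃ c, u ∈ component k (Sum.inl c)) := by
  have hv := (isLocallyParallel_arrB_iff u b).1 h
  set v : BIdx n → k × k := fun h => (u h, b h) with hvdef
  have hnd : ∃ p q, pdet (v p) (v q) ≠ 0 := by
    by_contra! hcon
    obtain ⟨p, hp⟩ := Function.ne_iff.1 hu
    refine hbu (Submodule.mem_span_singleton.2 ⟨b p / u p, ?_⟩)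
    ext q
    have := hcon p q
    simp only [pdet, hvdef] at this
    rw [Pi.smul_apply, smul_eq_mul]
    rw [Pi.zero_apply] at hp
    field_simp
    linear_combination -this
  have hmem : ∀ {S : Finset (Fin n)} {m : ℕ} (hm : S.card = m) (i : Fin m),
      S.orderEmbOfFin hm i ∈ S := fun hm i => Finset.orderEmbOfFin_mem _ hm i
  by_cases hc : ∃ i j, pdet (v (hC i)) (v (hC j)) ≠ 0
  · obtain ⟨i, j, hij⟩ := hc
    obtain ⟨S, hS, h2 | ⟨h3, hS3⟩⟩ := exists_supportedOn_of_coord hv hij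
    · exact Or.inl ⟨_, mem_compL_of_supportedOn hv hnd hS h2⟩
    · have key : ∀ a b : Fin 3, a ≠ b → pdet (v (hC (S.orderEmbOfFin h3 a)))
          (v (hC (S.orderEmbOfFin h3 b))) ≠ 0 := fun a b hab =>
        hS3 _ (hmem h3 a) _ (hmem h3 b) ((S.orderEmbOfFin h3).injective.ne hab)
      obtain ⟨q, hq⟩ := exists_mem_rowSpace_of_coord hv (S.orderEmbOfFin h3)
        (key 0 1 (by decide)) (key 0 2 (by decide)) (key 1 2 (by decide))
      exact Or.inr (Or.inl ⟨_, q, mem_rowSpace_extend_of_supportedOn hS h3 hq⟩)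
  push Not at hc
  by_cases h0 : ∃ i, v (hC i) ≠ 0
  · obtain ⟨i, hi⟩ := h0
    obtain ⟨S, hS, h2 | ⟨h3, i, hiS, hS3⟩⟩ := exists_supportedOn_of_coord_parallel hv hnd hc hi
    · exact Or.inl ⟨_, mem_compL_of_supportedOn hv hnd hS h2⟩
    · obtain ⟨a, rfl⟩ : ∃ a, S.orderEmbOfFin h3 a = i := by
        have : i ∈ Set.range (S.orderEmbOfFin h3) := by
          rw [Finset.range_orderEmbOfFin]
          exact hiS
        exact this
      obtain ⟨q, hq⟩ := exists_mem_rowSpace_of_single_coord hv (S.orderEmbOfFin h3) a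
        fun b hb => hS3 _ (hmem h3 b) ((S.orderEmbOfFin h3).injective.ne hb)
      exact Or.inr (Or.inl ⟨_, q, mem_rowSpace_extend_of_supportedOn hS h3 hq⟩)
  push Not at h0
  refine Or.inr (Or.inr ⟨fun i => congrArg Prod.fst (h0 i), fun i => congrArg Prod.snd (h0 i), ?_⟩)
  obtain ⟨S, hS, h3 | h4, hsp⟩ := exists_supportedOn_of_coord_zero hv hnd h0
  · have hne := fun {a b : Fin 3} (hab : a ≠ b) => (S.orderEmbOfFin h3).injective.ne hab
    obtain ⟨q, hq⟩ := exists_mem_rowSpace_of_spread_triple hv h0 (S.orderEmbOfFin h3)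
      (hsp _ (hmem h3 0) _ (hmem h3 1) _ (hmem h3 2) (hne (by decide)) (hne (by decide))
        (hne (by decide)))
    exact ⟨Sum.inl (_, Sum.inr q), mem_rowSpace_extend_of_supportedOn hS h3 hq⟩
  · have hne := fun {a b : Fin 4} (hab : a ≠ b) => (S.orderEmbOfFin h4).injective.ne hab
    obtain ⟨q, hq⟩ := exists_mem_rowSpace_of_spread_quad hv h0 (S.orderEmbOfFin h4)
      fun a b c hab hac hbc => hsp _ (hmem h4 a) _ (hmem h4 b) _ (hmem h4 c) (hne hab) (hne hac)
        (hne hbc)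
    exact ⟨Sum.inr (_, q), mem_rowSpace_extend_of_supportedOn hS h4 hq⟩

/-- The order embedding with values `i < j`. -/
def pairEmb {i j : Fin n} (h : i < j) : Fin 2 ↪o Fin n :=
  OrderEmbedding.ofStrictMono ![i, j] (by simp [Fin.strictMono_iff_lt_succ, h])

lemma component_pairEmb {i j : Fin n} (h : i < j) :
    component k (Sum.inr (pairEmb h)) = compL k h := rfl

lemma component_tripleEmb_castSucc [CharZero k] {i j l : Fin n} (hij : i < j) (hjl : j < l)
    (q : Fin 10) :
    component k (Sum.inl (Sum.inl (tripleEmb hij hjl, Sum.inl q.castSucc))) = compY k hij hjl q :=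
  (compY_eq_rowSpace hij hjl q).symm

lemma component_tripleEmb_last [CharZero k] {i j l : Fin n} (hij : i < j) (hjl : j < l) :
    component k (Sum.inl (Sum.inl (tripleEmb hij hjl, Sum.inl (Fin.last 10)))) = compZ k hij hjl :=
  (compZ_eq_rowSpace hij hjl).symm

lemma exists_eq_tripleEmb (g : Fin 3 ↪o Fin n) :
    ∃ (i j l : Fin n) (hij : i < j) (hjl : j < l), g = tripleEmb hij hjl := by
  refine ⟨g 0, g 1, g 2, g.strictMono (by decide), g.strictMono (by decide), ?_⟩
  ext a
  fin_cases a <;> rfl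

theorem arrResonance_arrB_eq_iUnion [CharZero k] (hn : 2 ≤ n) :
    arrResonance k (arrB n) = ⋃ c : ComponentIndex n, (component k c : Set (BIdx n → k)) := by
  refine Set.Subset.antisymm (fun u hu => ?_) (Set.iUnion_subset component_subset_arrResonance)
  rw [Set.mem_iUnion]
  obtain ⟨b, hb, h⟩ := (mem_arrResonance_iff (isSimpleArr_arrB n) u).1 hu
  by_cases hu0 : u = 0
  · subst hu0
    exact ⟨Sum.inr (Fin.castLEOrderEmb hn), zero_mem _⟩
  · rcases classification hb hu0 h with ⟨g, hg⟩ | ⟨g, q, hg⟩ | ⟨-, -, c, hc⟩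
    exacts [⟨_, hg⟩, ⟨_, hg⟩, ⟨_, hc⟩]

theorem arrResonance_arrB_eq_union [CharZero k] (hn : 2 ≤ n) :
    arrResonance k (arrB n) =
      extendDB '' arrResonance k (arrD n) ∪
        (⋃ (i : Fin n) (j : Fin n) (h : i < j), (compL k h : Set (BIdx n → k))) ∪
        ⋃ (i : Fin n) (j : Fin n) (l : Fin n) (hij : i < j) (hjl : j < l),
          ((compZ k hij hjl : Set (BIdx n → k)) ∪
            ⋃ q : Fin 10, (compY k hij hjl q : Set (BIdx n → k))) := by
  refine Set.Subset.antisymm (fun u hu => ?_) ?_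
  · have hL : ∀ g : Fin 2 ↪o Fin n, u ∈ component k (Sum.inr g) → u ∈
        ⋃ (i : Fin n) (j : Fin n) (h : i < j), (compL k h : Set (BIdx n → k)) := by
      intro g hg
      simp only [Set.mem_iUnion]
      exact ⟨_, _, _, hg⟩
    obtain ⟨b, hb, h⟩ := (mem_arrResonance_iff (isSimpleArr_arrB n) u).1 hu
    by_cases hu0 : u = 0
    · subst hu0
      exact Or.inl (Or.inr (hL (Fin.castLEOrderEmb hn) (zero_mem _)))
    · rcases classification hb hu0 h with ⟨g, hg⟩ | ⟨g, q, hg⟩ | ⟨h1, h2, -⟩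
      · exact Or.inl (Or.inr (hL g hg))
      · refine Or.inr ?_
        obtain ⟨i, j, l, hij, hjl, rfl⟩ := exists_eq_tripleEmb g
        simp only [Set.mem_iUnion]
        refine ⟨i, j, l, hij, hjl, ?_⟩
        induction q using Fin.lastCases with
        | last =>
          rw [component_tripleEmb_last] at hg
          exact Or.inl hg
        | cast q =>
          rw [component_tripleEmb_castSucc] at hg
          exact Or.inr (Set.mem_iUnion.2 ⟨q, hg⟩)
      · exact Or.inl (Or.inl (mem_image_extendDB h1 h2 hb h))
  · refine Set.union_subset (Set.union_subset ?_ ?_) ?_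
    · rintro _ ⟨u, hu, rfl⟩
      rw [extendDB_eq_extend]
      exact extend_mem_arrResonance (isSimpleArr_arrB n) (isSimpleArr_arrD n) (isSubArr_inr n) hu
    · simp only [Set.iUnion_subset_iff]
      exact fun i j h => compL_subset_arrResonance h
    · simp only [Set.iUnion_subset_iff, Set.union_subset_iff]
      refine fun i j l hij hjl => ⟨?_, fun q => ?_⟩
      · rw [← component_tripleEmb_last]
        exact component_subset_arrResonance _
      · rw [← component_tripleEmb_castSucc]
        exact component_subset_arrResonance _

theorem isZariskiComponent_arrResonance_iff [CharZero k] (hn : 2 ≤ n) (C : Set (BIdx n → k)) :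
    IsZariskiComponent (arrResonance k (arrB n)) C ↔
      ∃ c : ComponentIndex n, C = component k c := by
  have := CharZero.infinite k
  exact isZariskiComponent_iff_of_antichain (component k) (arrResonance_arrB_eq_iUnion hn)
    component_antichain C

lemma setOf_component_finrank_two [CharZero k] (hn : 2 ≤ n) :
    {W : Submodule k (BIdx n → k) |
      IsZariskiComponent (arrResonance k (arrB n)) (W : Set (BIdx n → k)) ∧
        Module.finrank k W = 2} = Set.range (component k ∘ Sum.inl) := by
  ext W
  rw [Set.mem_ofPred_eq, isZariskiComponent_arrResonance_iff hn]
  constructor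
  · rintro ⟨⟨c | g, hc⟩, h2⟩ <;> obtain rfl := SetLike.coe_injective hc
    · exact ⟨c, rfl⟩
    · rw [finrank_component_inr] at h2
      omega
  · rintro ⟨c, rfl⟩
    exact ⟨⟨_, rfl⟩, finrank_component_inl c⟩

lemma setOf_component_finrank_three [CharZero k] (hn : 2 ≤ n) :
    {W : Submodule k (BIdx n → k) |
      IsZariskiComponent (arrResonance k (arrB n)) (W : Set (BIdx n → k)) ∧
        Module.finrank k W = 3} = Set.range (component k ∘ Sum.inr) := by
  ext W
  rw [Set.mem_ofPred_eq, isZariskiComponent_arrResonance_iff hn]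
  constructor
  · rintro ⟨⟨c | g, hc⟩, h2⟩ <;> obtain rfl := SetLike.coe_injective hc
    · rw [finrank_component_inl] at h2
      omega
    · exact ⟨g, rfl⟩
  · rintro ⟨g, rfl⟩
    exact ⟨⟨_, rfl⟩, finrank_component_inr g⟩

end Classification

theorem mainTheorem6 (k : Type*) [Field k] [CharZero k] (n : ℕ) (hn : 2 ≤ n) :
    -- the decomposition of the resonance variety
    (arrResonance k (arrB n) =
      extendDB '' arrResonance k (arrD n) ∪
        (⋃ (i : Fin n) (j : Fin n) (h : i < j), (compL k h : Set (BIdx n → k))) ∪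
        ⋃ (i : Fin n) (j : Fin n) (l : Fin n) (hij : i < j) (hjl : j < l),
          ((compZ k hij hjl : Set (BIdx n → k)) ∪
            ⋃ q : Fin 10, (compY k hij hjl q : Set (BIdx n → k)))) ∧
    -- the listed subspaces are irreducible components of the stated dimensions
    (∀ (i j : Fin n) (h : i < j),
      IsZariskiComponent (arrResonance k (arrB n)) (compL k h : Set (BIdx n → k)) ∧
        Module.finrank k (compL k h) = 3) ∧
    (∀ (i j l : Fin n) (hij : i < j) (hjl : j < l),
      IsZariskiComponent (arrResonance k (arrB n)) (compZ k hij hjl : Set (BIdx n → k)) ∧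
        Module.finrank k (compZ k hij hjl) = 2) ∧
    (∀ (i j l : Fin n) (hij : i < j) (hjl : j < l) (q : Fin 10),
      IsZariskiComponent (arrResonance k (arrB n)) (compY k hij hjl q : Set (BIdx n → k)) ∧
        Module.finrank k (compY k hij hjl q) = 2) ∧
    -- the resonance variety is the union of its components, which are linear, with these counts
    arrResonance k (arrB n) = ⋃₀ {C | IsZariskiComponent (arrResonance k (arrB n)) C} ∧
    (∀ C : Set (BIdx n → k), IsZariskiComponent (arrResonance k (arrB n)) C →
      ∃ W : Submodule k (BIdx n → k), (W : Set (BIdx n → k)) = C ∧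
        (Module.finrank k W = 2 ∨ Module.finrank k W = 3)) ∧
    {W : Submodule k (BIdx n → k) |
      IsZariskiComponent (arrResonance k (arrB n)) (W : Set (BIdx n → k)) ∧
        Module.finrank k W = 2}.encard = ((16 * n.choose 3 + 9 * n.choose 4 : ℕ) : ℕ∞) ∧
    {W : Submodule k (BIdx n → k) |
      IsZariskiComponent (arrResonance k (arrB n)) (W : Set (BIdx n → k)) ∧
        Module.finrank k W = 3}.encard = ((n.choose 2 : ℕ) : ℕ∞) := by
  have hcomp := isZariskiComponent_arrResonance_iff (k := k) (n := n) hn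
  refine ⟨arrResonance_arrB_eq_union hn, fun i j h => ⟨(hcomp _).2 ⟨_, by rw [← component_pairEmb]⟩,
    finrank_compL h⟩, fun i j l hij hjl => ?_, fun i j l hij hjl q => ?_, ?_, fun C hC => ?_,
    ?_, ?_⟩
  · rw [← component_tripleEmb_last]
    exact ⟨(hcomp _).2 ⟨_, rfl⟩, finrank_component_inl _⟩
  · rw [← component_tripleEmb_castSucc]
    exact ⟨(hcomp _).2 ⟨_, rfl⟩, finrank_component_inl _⟩
  · have hset : {C | IsZariskiComponent (arrResonance k (arrB n)) C} =
        Set.range fun c : ComponentIndex n => (component k c : Set (BIdx n → k)) := by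
      ext C
      rw [Set.mem_ofPred_eq, hcomp]
      exact exists_congr fun _ => eq_comm
    rw [hset, Set.sUnion_range, arrResonance_arrB_eq_iUnion hn]
  · obtain ⟨c, rfl⟩ := (hcomp C).1 hC
    refine ⟨_, rfl, ?_⟩
    rcases c with c | g
    · exact Or.inl (finrank_component_inl c)
    · exact Or.inr (finrank_component_inr g)
  · rw [setOf_component_finrank_two hn, ← Set.image_univ,
      (component_injective.comp Sum.inl_injective).encard_image, Set.encard_univ,
      ENat.card_eq_coe_natCard, card_triple_add_quad]
  · rw [setOf_component_finrank_three hn, ← Set.image_univ,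
      (component_injective.comp Sum.inr_injective).encard_image, Set.encard_univ,
      ENat.card_eq_coe_natCard, card_orderEmbedding]
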